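/- Let $F$ be a field, let $n\ge 0$, and for $0\le k\le n$ let $\mathcal P_k$ be the set of $k$-element subsets of $\{1,\dots,n\}$. For a bijection $\phi:S\to T$ with $S,T\in\mathcal P_k$ put $\mathrm{Inv}(\phi)=\{(i,j)\in T\times T: i<j,\ \phi^{-1}(i)>\phi^{-1}(j)\}$ and $I(\phi)=\{t\in T:\phi^{-1}(t)<t\}$, and for $i,j\in T$ let $\phi_{i,j}$ be the bijection that agrees with $\phi$ except that $\phi_{i,j}(\phi^{-1}(i))=j$ and $\phi_{i,j}(\phi^{-1}(j))=i$. Let $R(n;k)^{\mathrm{nil}}$ be the $F$-vector space generated by the symbols $(S,T,\phi,D)$, where $S,T\in\mathcal P_k$, $\phi:S\to T$ is a nondecreasing bijection ($\phi(s)\ge s$ for all $s$) and $D$ is a subset of $I(\phi)$ with a total order, subject to the relations that a transposition of two elements in the order of $D$ changes the sign of the symbol; so a choice of one order for each subset of $I(\phi)$ gives a basis. Write $D\# D'$ for the disjoint union ordered with $D$ first and $D'$ next; a symbol with $D\# D'$ in it is $0$ if $D\cap D'\neq\varnothing$. The product is $$(S,T,\phi,D)\cdot(T,V,\psi,D')=(S,V,\psi\circ\phi,\psi(D)\#D')\quad\text{if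 } |\mathrm{Inv}(\psi\circ\phi)|=|\mathrm{Inv}(\psi)|+|\mathrm{Inv}(\phi)|,$$ and all other products of symbols are $0$. The differential is $$d(S,T,\phi,D)=\sum_{(i,j)}\bigl((S,T,\phi_{i,j},\{i\}\#D)-(S,T,\phi_{i,j},\{j\}\#D)\bigr),$$ summed over the $(i,j)\in\mathrm{Inv}(\phi)$ with $|\mathrm{Inv}(\phi_{i,j})|=|\mathrm{Inv}(\phi)|-1$. With the cohomological degree $|D|$ and the $q$-degree $-2(|D|+|\mathrm{Inv}(\phi)|)+\sum_{t\in T}t-\sum_{s\in S}s$ of $(S,T,\phi,D)$ this is a $q$-graded dg algebra (the differential has bidegree $(1,0)$). For $S\in\mathcal P_k$ put $\mathbf 1_S=(S,S,\mathrm{id},\varnothing)$, and let $P(S)=\mathbf 1_S\,R(n;k)^{\mathrm{nil}}$ be the corresponding right dg module. Let $\mathcal C_{n,k}$ be the bounded derived category of finitely generated $q$-graded right dg $R(n;k)^{\mathrm{nil}}$-modules $M=\bigoplus_{i,j}M^i_j$ ($i$ the cohomological, $j$ the $q$-grading): the category of these dg modules, with the $R(n;k)^{\mathrm{nil}}$-linear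 maps that preserve both gradings and commute with $d$, localized at the quasi-isomorphisms, with the distinguished triangles $X\to Y\to Z\to X[1]$ that come from mapping cones. Let $K_0(\mathcal C_{n,k})$ be the abelian group generated by the classes $[X]$ of the objects of $\mathcal C_{n,k}$ with the relations $[Y]=[X]+[Z]$ for all distinguished triangles; it is a $\mathbb Z[q,q^{-1}]$-module through $q^b[M]=[M\{b\}]$, where $M\{b\}^i_j=M^i_{j-b}$. Let $V$ be the free $\mathbb Z[q,q^{-1}]$-module with basis $v_{-1},v_1$, let $V^{\otimes n}$ be its $n$-th tensor power over $\mathbb Z[q,q^{-1}]$, and for $S\subseteq\{1,\dots,n\}$ let $v(S)=v_{\epsilon_1}\otimes\cdots\otimes v_{\epsilon_n}$ with $\epsilon_i=1$ if $i\in S$ and $\epsilon_i=-1$ if $i\notin S$. Theorem. $\bigoplus_{0\le k\le n}K_0(\mathcal C_{n,k})$ and $V^{\otimes n}$ are free $\mathbb Z[q,q^{-1}]$-modules, and there is an isomorphism of $\mathbb Z[q,q^{-1}]$-modules $$\bigoplus_{0\le k\le n}K_0(\mathcal C_{n,k})\;\cong\;V^{\otimes n}$$ that sends $[P(S)]$ to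 $v(S)$ for all $0\le k\le n$ and all $S\in\mathcal P_k$. -/

import Mathlib

set_option linter.unusedSectionVars false

open CategoryTheory
open scoped DirectSum LaurentPolynomial TensorProduct

universe u

namespace NilStrands

section Inversions

variable {α β γ : Type*} [Fintype α] [LinearOrder α] [Fintype β] [LinearOrder β]
  [Fintype γ] [LinearOrder γ]

/-- The inversions of a bijection `φ`, recorded by the target endpoints: the pairs `i < j`
with `φ⁻¹(i) > φ⁻¹(j)`. -/
def inversions (φ : α ≃ β) : Finset (β × β) :=
  Finset.univ.filter fun p => p.1 < p.2 ∧ φ.symm p.2 < φ.symm p.1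

/-- The number of crossings of the strand diagram of `φ`. -/
def crossings (φ : α ≃ β) : ℕ := (inversions φ).card

/-- `resolve φ i j` is `φ_{i,j}`: it agrees with `φ` except that the strands ending at `i`
and `j` now end at `j` and `i`. -/
def resolve (φ : α ≃ β) (i j : β) : α ≃ β := φ.trans (Equiv.swap i j)

theorem mem_inversions (φ : α ≃ β) (i j : β) :
    (i, j) ∈ inversions φ ↔ i < j ∧ φ.symm j < φ.symm i := by
  simp [inversions]

theorem crossings_refl : crossings (Equiv.refl α) = 0 := by
  simp only [crossings, Finset.card_eq_zero, Finset.eq_empty_iff_forall_notMem]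
  rintro ⟨i, j⟩ h
  rw [mem_inversions] at h
  exact lt_asymm h.1 h.2

theorem crossings_trans_le (φ : α ≃ β) (ψ : β ≃ γ) :
    crossings (φ.trans ψ) ≤ crossings φ + crossings ψ := by
  have hsub : inversions (φ.trans ψ) ⊆
      inversions ψ ∪ (inversions φ).image (Prod.map ψ ψ) := by
    rintro ⟨p, q⟩ h
    rw [mem_inversions] at h
    rw [Finset.mem_union]
    by_cases hc : ψ.symm q < ψ.symm p
    · left; exact (mem_inversions _ _ _).2 ⟨h.1, hc⟩
    · right
      refine Finset.mem_image.2 ⟨(ψ.symm p, ψ.symm q), (mem_inversions _ _ _).2 ⟨?_, h.2⟩, by simp⟩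
      refine lt_of_le_of_ne (not_lt.1 hc) fun e => ?_
      exact h.1.ne (ψ.symm.injective e)
  calc crossings (φ.trans ψ) ≤ _ := Finset.card_le_card hsub
    _ ≤ _ := Finset.card_union_le _ _
    _ ≤ crossings ψ + crossings φ := by
        gcongr
        · exact le_rfl
        · exact Finset.card_image_le
    _ = _ := add_comm _ _

theorem resolve_resolve (φ : α ≃ β) (i j : β) : resolve (resolve φ i j) i j = φ := by
  ext x; simp [resolve]

theorem resolve_comm (φ : α ≃ β) (i j : β) : resolve φ i j = resolve φ j i := by
  simp [resolve, Equiv.swap_comm]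

theorem crossings_resolve_lt (φ : α ≃ β) {i j : β} (h : (i, j) ∈ inversions φ) :
    crossings (resolve φ i j) < crossings φ := by
  have hij := (mem_inversions _ _ _).1 h
  set τ : Equiv.Perm β := Equiv.swap i j with hτ
  have key : ∀ p q : β, (p, q) ∈ inversions (resolve φ i j) ↔
      p < q ∧ φ.symm (τ q) < φ.symm (τ p) := by
    intro p q; rw [mem_inversions]; simp [resolve, hτ]
  have hττ : ∀ x, τ (τ x) = x := fun x => by simp [hτ]
  have hcard : crossings (resolve φ i j) ≤ ((inversions φ).erase (i, j)).card := by
    refine Finset.card_le_card_of_injOn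
      (fun p => if τ p.1 < τ p.2 then (τ p.1, τ p.2) else p) ?_ ?_
    · rintro ⟨p, q⟩ hpq
      have hpq' := (key p q).1 hpq
      simp only [Finset.mem_coe, Finset.mem_erase]
      split_ifs with hc
      · refine ⟨fun e => ?_, (mem_inversions _ _ _).2 ⟨hc, hpq'.2⟩⟩
        have e1 : p = j := by
          have := (Prod.mk.inj e).1; rw [← hττ p, this]; simp [hτ]
        have e2 : q = i := by
          have := (Prod.mk.inj e).2; rw [← hττ q, this]; simp [hτ]
        subst e1 e2
        exact lt_asymm hpq'.1 hij.1
      · have hne : (p, q) ≠ (i, j) := by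
          intro e
          obtain ⟨rfl, rfl⟩ := Prod.mk.inj e
          have := hpq'.2
          simp only [hτ, Equiv.swap_apply_left, Equiv.swap_apply_right] at this
          exact lt_asymm this hij.2
        refine ⟨hne, (mem_inversions _ _ _).2 ⟨hpq'.1, ?_⟩⟩
        have h2 := hpq'.2
        have h1 := hpq'.1
        have hij1 := hij.1
        have hij2 := hij.2
        by_cases hpi : p = i
        · subst hpi
          have hqj : q ≠ j := fun e => hne (by rw [e])
          have hq : τ q = q := Equiv.swap_apply_of_ne_of_ne h1.ne' hqj
          have hp : τ p = j := Equiv.swap_apply_left _ _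
          rw [hq, hp] at h2
          exact h2.trans hij2
        · by_cases hqj : q = j
          · subst hqj
            have hp : τ p = p := Equiv.swap_apply_of_ne_of_ne hpi h1.ne
            have hq : τ q = i := Equiv.swap_apply_right _ _
            rw [hq, hp] at h2
            exact hij2.trans h2
          · exfalso
            by_cases hpj : p = j
            · have hp : τ p = i := by rw [hpj]; exact Equiv.swap_apply_right _ _
              have hq : τ q = q := Equiv.swap_apply_of_ne_of_ne
                (fun e => by rw [e, hpj] at h1; exact lt_asymm h1 hij1) hqj
              rw [hp, hq] at hc
              exact hc (hij1.trans (hpj ▸ h1))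
            · have hp : τ p = p := Equiv.swap_apply_of_ne_of_ne hpi hpj
              by_cases hqi : q = i
              · have hq : τ q = j := by rw [hqi]; exact Equiv.swap_apply_left _ _
                rw [hp, hq] at hc
                exact hc ((hqi ▸ h1).trans hij1)
              · rw [hp, Equiv.swap_apply_of_ne_of_ne hqi hqj] at hc
                exact hc h1
    · rintro ⟨p, q⟩ hpq ⟨p', q'⟩ hpq' e
      have h1 := ((key p q).1 hpq).1
      have h2 := ((key p' q').1 hpq').1
      dsimp only at e
      split_ifs at e with c1 c2 c2
      · obtain ⟨e1, e2⟩ := Prod.mk.inj e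
        rw [τ.injective e1, τ.injective e2]
      · obtain ⟨e1, e2⟩ := Prod.mk.inj e
        rw [← e1, ← e2, hττ, hττ] at c2
        exact absurd h1 c2
      · obtain ⟨e1, e2⟩ := Prod.mk.inj e
        rw [e1, e2, hττ, hττ] at c1
        exact absurd h2 c1
      · exact e
  rw [Finset.card_erase_of_mem h] at hcard
  have hpos : 0 < (inversions φ).card := Finset.card_pos.2 ⟨_, h⟩
  unfold crossings at *
  omega

theorem mem_inversions_resolve (φ : α ≃ β) {i j : β} (hij : i < j) :
    (i, j) ∈ inversions (resolve φ i j) ↔ (i, j) ∉ inversions φ := by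
  rw [mem_inversions, mem_inversions]
  have : φ.symm i ≠ φ.symm j := fun e => hij.ne (φ.symm.injective e)
  simp only [resolve, Equiv.symm_trans_apply, Equiv.symm_swap, Equiv.swap_apply_left,
    Equiv.swap_apply_right, hij, true_and, not_lt]
  exact ⟨le_of_lt, fun h => lt_of_le_of_ne h this⟩

/-- A bijection with a crossing factors as a simple crossing followed by a bijection with
one crossing less. -/
theorem exists_simple_factor (φ : α ≃ β) (h : crossings φ ≠ 0) :
    ∃ σ : α ≃ α, crossings σ = 1 ∧ crossings (σ.symm.trans φ) + 1 = crossings φ := by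
  obtain ⟨⟨i, j⟩, hij⟩ := Finset.card_ne_zero.1 h
  have hne : (Finset.univ.filter fun p : α × α => p.1 < p.2 ∧ φ p.2 < φ p.1).Nonempty := by
    refine ⟨(φ.symm j, φ.symm i), ?_⟩
    have := (mem_inversions _ _ _).1 hij
    simp [this.1, this.2]
  obtain ⟨⟨a, b⟩, hab, hmin⟩ := Finset.exists_min_image _
    (fun p : α × α => (Finset.univ.filter fun c => p.1 < c ∧ c < p.2).card) hne
  simp only [Finset.mem_filter, Finset.mem_univ, true_and] at hab hmin
  have hbtw : ∀ c, ¬(a < c ∧ c < b) := by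
    rintro c ⟨hac, hcb⟩
    by_cases hc : φ c < φ a
    · refine absurd (hmin (a, c) ⟨hac, hc⟩) (not_le.2 (Finset.card_lt_card ?_))
      refine Finset.ssubset_iff_of_subset (fun x hx => ?_) |>.2 ⟨c, ?_, ?_⟩
      · simp only [Finset.mem_filter, Finset.mem_univ, true_and] at hx ⊢
        exact ⟨hx.1, hx.2.trans hcb⟩
      · simp [hac, hcb]
      · simp
    · refine absurd (hmin (c, b) ⟨hcb, hab.2.trans_le (not_lt.1 hc)⟩)
        (not_le.2 (Finset.card_lt_card ?_))
      refine Finset.ssubset_iff_of_subset (fun x hx => ?_) |>.2 ⟨c, ?_, ?_⟩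
      · simp only [Finset.mem_filter, Finset.mem_univ, true_and] at hx ⊢
        exact ⟨hac.trans hx.1, hx.2⟩
      · simp [hac, hcb]
      · simp
  have hσ : crossings (Equiv.swap a b) = 1 := by
    refine Finset.card_eq_one.2 ⟨(a, b), ?_⟩
    ext ⟨p, q⟩
    rw [mem_inversions, Finset.mem_singleton, Prod.mk.injEq, Equiv.symm_swap]
    constructor
    · rintro ⟨hpq, hs⟩
      have h1 := hbtw p
      have h2 := hbtw q
      have h3 := hab.1
      simp only [Equiv.swap_apply_def] at hs
      grind
    · rintro ⟨rfl, rfl⟩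
      simpa using hab.1
  refine ⟨Equiv.swap a b, hσ, ?_⟩
  have e : (Equiv.swap a b).symm.trans φ = resolve φ (φ b) (φ a) := by
    ext x
    simp only [resolve, Equiv.symm_swap, Equiv.trans_apply, Equiv.swap_apply_def]
    split_ifs <;> simp_all
  have h1 := crossings_trans_le (Equiv.swap a b) ((Equiv.swap a b).symm.trans φ)
  rw [← Equiv.trans_assoc, Equiv.self_trans_symm, Equiv.refl_trans, hσ] at h1
  have h2 : crossings (resolve φ (φ b) (φ a)) < crossings φ :=
    crossings_resolve_lt φ ((mem_inversions _ _ _).2 ⟨hab.2, by simpa using hab.1⟩)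
  rw [← e] at h2
  omega

end Inversions

end NilStrands

namespace NilStrands

section Combinatorics

variable {α β γ : Type*} [Fintype α] [LinearOrder α] [Fintype β] [LinearOrder β]
  [Fintype γ] [LinearOrder γ]

/-- The strands ending at `i` and `j` cross (in a form symmetric in `i` and `j`). -/
def Crosses (φ : α ≃ β) (i j : β) : Prop :=
  (i < j ∧ φ.symm j < φ.symm i) ∨ (j < i ∧ φ.symm i < φ.symm j)

theorem crosses_comm (φ : α ≃ β) (i j : β) : Crosses φ i j ↔ Crosses φ j i := or_comm

theorem crosses_iff (φ : α ≃ β) {i j : β} (h : i < j) :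
    Crosses φ i j ↔ (i, j) ∈ inversions φ := by
  rw [mem_inversions]
  exact ⟨fun h' => h'.resolve_right fun h'' => lt_asymm h h''.1, Or.inl⟩

theorem crossings_resolve_lt' (φ : α ≃ β) {i j : β} (h : Crosses φ i j) :
    crossings (resolve φ i j) < crossings φ := by
  rcases h with h | h
  · exact crossings_resolve_lt φ ((mem_inversions _ _ _).2 h)
  · rw [resolve_comm]
    exact crossings_resolve_lt φ ((mem_inversions _ _ _).2 h)

theorem crosses_symm_iff (φ : α ≃ β) (ψ : β ≃ γ) {i j : γ} (h : i < j) :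
    Crosses φ (ψ.symm i) (ψ.symm j) ↔
      ¬((i, j) ∈ inversions (φ.trans ψ) ↔ (i, j) ∈ inversions ψ) := by
  rw [mem_inversions, mem_inversions]
  have h1 : ψ.symm i ≠ ψ.symm j := fun e => h.ne (ψ.symm.injective e)
  have h2 : φ.symm (ψ.symm i) ≠ φ.symm (ψ.symm j) := fun e => h1 (φ.symm.injective e)
  simp only [Crosses, Equiv.symm_trans_apply, h, true_and]
  rcases lt_or_gt_of_ne h1 with h1 | h1 <;> rcases lt_or_gt_of_ne h2 with h2 | h2 <;>
    simp [h1, h2, h1.not_gt, h2.not_gt]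

theorem resolve_trans (φ : α ≃ β) (ψ : β ≃ γ) (i j : γ) :
    (resolve φ (ψ.symm i) (ψ.symm j)).trans ψ = resolve (φ.trans ψ) i j := by
  ext x
  simp only [resolve, Equiv.trans_apply, Equiv.swap_apply_def]
  split_ifs <;> simp_all [Equiv.eq_symm_apply]

theorem resolve_symm_trans (φ : α ≃ β) (θ : β ≃ γ) (a b : β) :
    (resolve φ a b).symm.trans (φ.trans θ) = resolve θ (θ a) (θ b) := by
  ext x
  simp only [resolve, Equiv.trans_apply, Equiv.symm_trans_apply, Equiv.symm_swap,
    Equiv.apply_symm_apply, Equiv.swap_apply_def]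
  split_ifs <;> simp_all

theorem sum_lt_reindex {M : Type*} [AddCommMonoid M] (θ : β ≃ γ) (t : γ → γ → M)
    (ht : ∀ i j, t i j = t j i) :
    ∑ p : β × β, (if p.1 < p.2 then t (θ p.1) (θ p.2) else 0) =
      ∑ q : γ × γ, (if q.1 < q.2 then t q.1 q.2 else 0) := by
  rw [← Finset.sum_filter, ← Finset.sum_filter]
  refine Finset.sum_bij'
    (fun p _ => if θ p.1 < θ p.2 then (θ p.1, θ p.2) else (θ p.2, θ p.1))
    (fun q _ => if θ.symm q.1 < θ.symm q.2 then (θ.symm q.1, θ.symm q.2)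
      else (θ.symm q.2, θ.symm q.1)) ?_ ?_ ?_ ?_ ?_
  · rintro ⟨a, b⟩ h
    simp only [Finset.mem_filter, Finset.mem_univ, true_and] at h ⊢
    split_ifs with hc
    · exact hc
    · exact lt_of_le_of_ne (not_lt.1 hc) fun e => h.ne (θ.injective e.symm)
  · rintro ⟨a, b⟩ h
    simp only [Finset.mem_filter, Finset.mem_univ, true_and] at h ⊢
    split_ifs with hc
    · exact hc
    · exact lt_of_le_of_ne (not_lt.1 hc) fun e => h.ne (θ.symm.injective e.symm)
  · rintro ⟨a, b⟩ h
    simp only [Finset.mem_filter, Finset.mem_univ, true_and] at h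
    dsimp only
    split_ifs <;> simp_all [h.not_gt]
  · rintro ⟨a, b⟩ h
    simp only [Finset.mem_filter, Finset.mem_univ, true_and] at h
    dsimp only
    split_ifs <;> simp_all [h.not_gt]
  · rintro ⟨a, b⟩ h
    dsimp only
    split_ifs
    · rfl
    · exact ht _ _

end Combinatorics

/-- `P_k(n)`: the set of `k`-element subsets of `{1, …, n}`, modelled on `Fin n`. -/
abbrev KSubset (n k : ℕ) : Type := {S : Finset (Fin n) // S.card = k}

/-- A diagram of `k` strands: subsets `S`, `T` and a bijection `φ : S → T`. -/
abbrev Diagram (n k : ℕ) : Type := Σ S T : KSubset n k, (S.1 ≃ T.1)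

section Dots

variable (F : Type u) [Field F] {n k : ℕ}

/-- The exterior algebra on dots `ξ_t`, `t ∈ T`. An ordered subset `D = (t₁, …, t_m)` of `T`
corresponds to the monomial `ξ_{t₁} ⋯ ξ_{t_m}`: reordering `D` changes it by the sign
`(-1)^{μ(D,D')}`, the ordered union `#` is the product, and `⋆` is `0`. -/
abbrev Dots (T : KSubset n k) : Type u := ExteriorAlgebra F (T.1 → F)

variable {F}

/-- The dot `ξ_t`. -/
def dot {T : KSubset n k} (t : T.1) : Dots F T := ExteriorAlgebra.ι F (Pi.single t 1)

/-- The isomorphism `ξ_t ↦ ξ_{ψ(t)}` that moves dots along the strands of `ψ : T → V`,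
written `D ↦ ψ(D)` on monomials. -/
def relabel {T V : KSubset n k} (ψ : T.1 ≃ V.1) : Dots F T →ₐ[F] Dots F V :=
  ExteriorAlgebra.map (LinearMap.funLeft F F ψ.symm)

theorem relabel_ι {T V : KSubset n k} (ψ : T.1 ≃ V.1) (v : T.1 → F) :
    relabel ψ (ExteriorAlgebra.ι F v) = ExteriorAlgebra.ι F (v ∘ ψ.symm) :=
  ExteriorAlgebra.map_apply_ι _ _

theorem relabel_dot {T V : KSubset n k} (ψ : T.1 ≃ V.1) (t : T.1) :
    relabel ψ (dot t : Dots F T) = dot (ψ t) := by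
  rw [dot, relabel_ι, dot]
  congr 1
  funext x
  by_cases h : x = ψ t
  · subst h; simp
  · rw [Pi.single_eq_of_ne h, Function.comp_apply, Pi.single_eq_of_ne]
    rintro rfl; simp at h

theorem relabel_refl {T : KSubset n k} (x : Dots F T) : relabel (Equiv.refl _) x = x := by
  have : relabel (F := F) (Equiv.refl T.1) = AlgHom.id F _ := by
    apply ExteriorAlgebra.hom_ext
    ext v
    simp [relabel]
  rw [this]; rfl

theorem relabel_relabel {T V W : KSubset n k} (ψ : T.1 ≃ V.1) (χ : V.1 ≃ W.1) (x : Dots F T) :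
    relabel χ (relabel ψ x) = relabel (ψ.trans χ) x := by
  have : (relabel (F := F) χ).comp (relabel ψ) = relabel (ψ.trans χ) := by
    apply ExteriorAlgebra.hom_ext
    refine LinearMap.ext fun v => ?_
    simp only [LinearMap.comp_apply, AlgHom.toLinearMap_apply, AlgHom.comp_apply, relabel_ι]
    rfl
  rw [← this]; rfl

/-- The sign automorphism `x ↦ (-1)^{deg x} x`. -/
def signAut (T : KSubset n k) : Dots F T →ₐ[F] Dots F T := ExteriorAlgebra.map (-LinearMap.id)

theorem signAut_ι (T : KSubset n k) (v : T.1 → F) :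
    signAut T (ExteriorAlgebra.ι F v) = -ExteriorAlgebra.ι F v := by
  simp [signAut]

theorem signAut_signAut (T : KSubset n k) (x : Dots F T) : signAut T (signAut T x) = x := by
  have : (signAut (F := F) T).comp (signAut T) = AlgHom.id F _ := by
    apply ExteriorAlgebra.hom_ext
    ext v
    simp [signAut_ι]
  exact DFunLike.congr_fun this x

theorem signAut_relabel {T V : KSubset n k} (ψ : T.1 ≃ V.1) (x : Dots F T) :
    signAut V (relabel ψ x) = relabel ψ (signAut T x) := by
  have : (signAut (F := F) V).comp (relabel ψ) = (relabel ψ).comp (signAut T) := by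
    apply ExteriorAlgebra.hom_ext
    refine LinearMap.ext fun v => ?_
    simp [signAut_ι, relabel_ι]
  exact DFunLike.congr_fun this x

theorem mul_ι (T : KSubset n k) (v : T.1 → F) (x : Dots F T) :
    signAut T x * ExteriorAlgebra.ι F v = ExteriorAlgebra.ι F v * x := by
  induction x using ExteriorAlgebra.induction with
  | algebraMap r => simp [Algebra.commutes]
  | ι w =>
    rw [signAut_ι, neg_mul, neg_eq_iff_add_eq_zero]
    exact ExteriorAlgebra.ι_add_mul_swap _ _
  | mul a b ha hb => rw [map_mul, mul_assoc, hb, ← mul_assoc, ha, mul_assoc]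
  | add a b ha hb => rw [map_add, add_mul, ha, hb, mul_add]

theorem dot_sub_dot {T : KSubset n k} (i j : T.1) :
    (dot i - dot j : Dots F T) = ExteriorAlgebra.ι F (Pi.single i 1 - Pi.single j 1) := by
  rw [map_sub]; rfl

theorem signAut_mem {T : KSubset n k} {p : ℕ} {x : Dots F T} (hx : x ∈ ⋀[F]^p (T.1 → F)) :
    signAut T x = (-1 : ℤ) ^ p • x := by
  rw [← ExteriorAlgebra.ιMulti_span_fixedDegree] at hx
  induction hx using Submodule.span_induction with
  | mem x hx =>
    obtain ⟨v, rfl⟩ := hx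
    rw [signAut, ExteriorAlgebra.map_apply_ιMulti]
    have : (⇑(-LinearMap.id : (T.1 → F) →ₗ[F] (T.1 → F)) ∘ v) = fun i => (-1 : F) • v i := by
      funext i; simp
    rw [this, AlternatingMap.map_smul_univ]
    simp only [Finset.prod_const, Finset.card_univ, Fintype.card_fin]
    rcases Nat.even_or_odd p with h | h <;> simp [h.neg_one_pow]
  | zero => simp
  | add x y _ _ hx hy => rw [map_add, hx, hy, smul_add]
  | smul c x _ hx => rw [map_smul, hx, smul_comm]

/-- Multiplying by `ξ_i - ξ_j` forgets whether a dot sits on the strand `i` or `j`. -/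
theorem dot_sub_mul_relabel {T V : KSubset n k} (θ : T.1 ≃ V.1) (i j : V.1) (x : Dots F T) :
    (dot i - dot j : Dots F V) * relabel (resolve θ i j) x = (dot i - dot j) * relabel θ x := by
  rw [dot_sub_dot]
  set v : V.1 → F := Pi.single i 1 - Pi.single j 1 with hv
  induction x using ExteriorAlgebra.induction with
  | algebraMap r => simp
  | ι w =>
    rw [relabel_ι, relabel_ι]
    have : w ∘ (resolve θ i j).symm =
        w ∘ θ.symm + (w (θ.symm j) - w (θ.symm i)) • v := by
      funext t
      simp only [resolve, Function.comp_apply, Equiv.symm_trans_apply, Equiv.symm_swap,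
        Equiv.swap_apply_def, hv, Pi.add_apply, Pi.smul_apply, Pi.sub_apply, smul_eq_mul,
        Pi.single_apply]
      split_ifs <;> simp_all
    rw [this, map_add, map_smul, mul_add, mul_smul_comm, ExteriorAlgebra.ι_sq_zero, smul_zero,
      add_zero]
  | mul a b ha hb =>
    rw [map_mul, map_mul, ← mul_assoc, ha, ← mul_ι, mul_assoc, hb, ← mul_assoc, mul_ι, mul_assoc]
  | add a b ha hb => rw [map_add, map_add, mul_add, ha, hb, mul_add]

end Dots

end NilStrands

namespace NilStrands

/-- Linear combinations of dotted strand diagrams, with no condition on the slopes of the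
strands and on the dots: the coefficient at `(S, T, φ)` is an element of the exterior algebra
on dots at the right endpoints `T`. -/
def AllStrands (F : Type u) [Field F] (n k : ℕ) : Type u := ∀ c : Diagram n k, Dots F c.2.1

namespace AllStrands

variable {F : Type u} [Field F] {n k : ℕ}

noncomputable instance : AddCommGroup (AllStrands F n k) :=
  inferInstanceAs (AddCommGroup (∀ c : Diagram n k, Dots F c.2.1))

noncomputable instance : Module F (AllStrands F n k) :=
  inferInstanceAs (Module F (∀ c : Diagram n k, Dots F c.2.1))

@[ext]
theorem ext {f g : AllStrands F n k} (h : ∀ S T (φ : S.1 ≃ T.1), f ⟨S, T, φ⟩ = g ⟨S, T, φ⟩) :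
    f = g := funext fun c => h c.1 c.2.1 c.2.2

@[simp] theorem add_apply (f g : AllStrands F n k) (c) : (f + g) c = f c + g c := rfl
@[simp] theorem neg_apply (f : AllStrands F n k) (c) : (-f) c = -f c := rfl
@[simp] theorem zero_apply (c) : (0 : AllStrands F n k) c = 0 := rfl
@[simp] theorem smul_apply (r : F) (f : AllStrands F n k) (c) : (r • f) c = r • f c := rfl

/-- The product. It is bilinear with
`(S, T, φ, x) · (T, V, ψ, y) = (S, V, ψ ∘ φ, ψ(x) y)` if the numbers of crossings of `φ` and
`ψ` add up to that of `ψ ∘ φ`, and `0` otherwise. In the coefficient at `(S, V, χ)` the second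
factor is `ψ = χ ∘ φ⁻¹`. -/
noncomputable instance : Mul (AllStrands F n k) where
  mul f g := fun c => ∑ T : KSubset n k, ∑ φ : c.1.1 ≃ T.1,
    if crossings c.2.2 = crossings φ + crossings (φ.symm.trans c.2.2) then
      relabel (φ.symm.trans c.2.2) (f ⟨c.1, T, φ⟩) * g ⟨T, c.2.1, φ.symm.trans c.2.2⟩
    else 0

/-- `idem S = (S, S, id, ∅)`. -/
noncomputable def idem (S : KSubset n k) : AllStrands F n k := fun c =>
  open scoped Classical in
  if c.1 = S ∧ ∀ s : c.1.1, (c.2.2 s : Fin n) = s then 1 else 0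

noncomputable instance : One (AllStrands F n k) where
  one := fun c =>
    open scoped Classical in if ∀ s : c.1.1, (c.2.2 s : Fin n) = s then 1 else 0

/-- The differential. It is linear with
`d(S, T, φ, x) = ∑ (S, T, φ_{i,j}, (ξ_i - ξ_j) x)`, summed over the inversions `(i, j)` of `φ`
such that `φ_{i,j}` has exactly one crossing less than `φ`. In the coefficient at `(S, T, χ)`
this means `φ = χ_{i,j}`. -/
noncomputable def diff : AllStrands F n k →ₗ[F] AllStrands F n k where
  toFun f := fun c => ∑ p : c.2.1.1 × c.2.1.1,
    if p ∈ inversions (resolve c.2.2 p.1 p.2) ∧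
        crossings (resolve c.2.2 p.1 p.2) = crossings c.2.2 + 1 then
      (dot p.1 - dot p.2) * f ⟨c.1, c.2.1, resolve c.2.2 p.1 p.2⟩
    else 0
  map_add' f g := by
    funext c
    refine Eq.trans ?_ Finset.sum_add_distrib
    refine Finset.sum_congr rfl fun p _ => ?_
    split_ifs
    · rw [add_apply, mul_add]
    · simp
  map_smul' r f := by
    funext c
    refine Eq.trans ?_ (Finset.smul_sum (r := r)).symm
    refine Finset.sum_congr rfl fun p _ => ?_
    split_ifs
    · rw [smul_apply, mul_smul_comm]
    · simp

theorem mul_apply (f g : AllStrands F n k) (S V : KSubset n k) (χ : S.1 ≃ V.1) :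
    (f * g) ⟨S, V, χ⟩ = ∑ T : KSubset n k, ∑ φ : S.1 ≃ T.1,
      if crossings χ = crossings φ + crossings (φ.symm.trans χ) then
        relabel (φ.symm.trans χ) (f ⟨S, T, φ⟩) * g ⟨T, V, φ.symm.trans χ⟩
      else 0 := rfl

theorem diff_apply (f : AllStrands F n k) (S T : KSubset n k) (φ : S.1 ≃ T.1) :
    diff f ⟨S, T, φ⟩ = ∑ p : T.1 × T.1,
      if p ∈ inversions (resolve φ p.1 p.2) ∧
          crossings (resolve φ p.1 p.2) = crossings φ + 1 then
        (dot p.1 - dot p.2) * f ⟨S, T, resolve φ p.1 p.2⟩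
      else 0 := rfl

theorem one_apply_refl (S : KSubset n k) :
    (1 : AllStrands F n k) ⟨S, S, Equiv.refl _⟩ = 1 := if_pos fun _ => rfl

theorem one_apply_of_ne {S T : KSubset n k} (φ : S.1 ≃ T.1) (h : S ≠ T) :
    (1 : AllStrands F n k) ⟨S, T, φ⟩ = 0 := by
  refine if_neg fun h' => h (Subtype.ext (Finset.eq_of_subset_of_card_le ?_ ?_))
  · intro s hs
    have := (φ ⟨s, hs⟩).2
    rwa [h' ⟨s, hs⟩] at this
  · rw [S.2, T.2]

theorem one_apply_of_ne_refl {S : KSubset n k} (φ : S.1 ≃ S.1) (h : φ ≠ Equiv.refl _) :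
    (1 : AllStrands F n k) ⟨S, S, φ⟩ = 0 :=
  if_neg fun h' => h (Equiv.ext fun s => Subtype.ext (h' s))

protected theorem add_mul' (f g h : AllStrands F n k) : (f + g) * h = f * h + g * h := by
  ext S V χ
  simp only [mul_apply, add_apply, map_add, add_mul, ← Finset.sum_add_distrib]
  refine Finset.sum_congr rfl fun T _ => Finset.sum_congr rfl fun φ _ => ?_
  split_ifs <;> simp

protected theorem mul_add' (f g h : AllStrands F n k) : f * (g + h) = f * g + f * h := by
  ext S V χ
  simp only [mul_apply, add_apply, mul_add, ← Finset.sum_add_distrib]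
  refine Finset.sum_congr rfl fun T _ => Finset.sum_congr rfl fun φ _ => ?_
  split_ifs <;> simp

protected theorem smul_mul' (r : F) (f g : AllStrands F n k) : r • f * g = r • (f * g) := by
  ext S V χ
  simp only [mul_apply, smul_apply, map_smul, smul_mul_assoc, Finset.smul_sum, smul_ite, smul_zero]

protected theorem mul_smul' (r : F) (f g : AllStrands F n k) : f * r • g = r • (f * g) := by
  ext S V χ
  simp only [mul_apply, smul_apply, mul_smul_comm, Finset.smul_sum, smul_ite, smul_zero]

protected theorem one_mul' (g : AllStrands F n k) : 1 * g = g := by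
  ext S V χ
  rw [mul_apply, Finset.sum_eq_single S, Finset.sum_eq_single (Equiv.refl _)]
  · rw [one_apply_refl, map_one, one_mul, crossings_refl, zero_add]
    exact if_pos rfl
  · intro φ _ h
    rw [one_apply_of_ne_refl φ h]; simp
  · simp
  · intro T _ h
    refine Finset.sum_eq_zero fun φ _ => ?_
    rw [one_apply_of_ne φ h.symm]; simp
  · simp

protected theorem mul_one' (g : AllStrands F n k) : g * 1 = g := by
  ext S V χ
  rw [mul_apply, Finset.sum_eq_single V, Finset.sum_eq_single χ]
  · rw [Equiv.symm_trans_self, one_apply_refl, mul_one, crossings_refl, add_zero, relabel_refl]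
    exact if_pos rfl
  · intro φ _ h
    rw [one_apply_of_ne_refl]
    · simp
    · intro e
      apply h
      rw [← Equiv.trans_refl φ, ← e, ← Equiv.trans_assoc]; simp
  · simp
  · intro T _ h
    refine Finset.sum_eq_zero fun φ _ => ?_
    rw [one_apply_of_ne _ h]; simp
  · simp

protected theorem mul_assoc' (f g h : AllStrands F n k) : f * g * h = f * (g * h) := by
  ext S W χ
  simp only [mul_apply]
  have hL : ∀ U : KSubset n k, (∑ ρ : S.1 ≃ U.1,
      if crossings χ = crossings ρ + crossings (ρ.symm.trans χ) then
        relabel (ρ.symm.trans χ) (∑ T : KSubset n k, ∑ φ : S.1 ≃ T.1,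
          if crossings ρ = crossings φ + crossings (φ.symm.trans ρ) then
            relabel (φ.symm.trans ρ) (f ⟨S, T, φ⟩) * g ⟨T, U, φ.symm.trans ρ⟩ else 0) *
          h ⟨U, W, ρ.symm.trans χ⟩
      else 0) = ∑ T : KSubset n k, ∑ φ : S.1 ≃ T.1, ∑ ρ : S.1 ≃ U.1,
        if crossings χ = crossings ρ + crossings (ρ.symm.trans χ) ∧
            crossings ρ = crossings φ + crossings (φ.symm.trans ρ) then
          relabel (φ.symm.trans χ) (f ⟨S, T, φ⟩) *
            (relabel (ρ.symm.trans χ) (g ⟨T, U, φ.symm.trans ρ⟩) * h ⟨U, W, ρ.symm.trans χ⟩)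
        else 0 := by
    intro U
    rw [Finset.sum_congr rfl fun T _ => Finset.sum_comm, Finset.sum_comm]
    refine Finset.sum_congr rfl fun ρ _ => ?_
    split_ifs with hc
    · rw [map_sum, Finset.sum_mul]
      refine Finset.sum_congr rfl fun T _ => ?_
      rw [map_sum, Finset.sum_mul]
      refine Finset.sum_congr rfl fun φ _ => ?_
      by_cases hc' : crossings ρ = crossings φ + crossings (φ.symm.trans ρ)
      · rw [if_pos hc', if_pos ⟨hc, hc'⟩, map_mul, relabel_relabel, mul_assoc]
        congr 3
        ext x; simp
      · rw [if_neg hc', if_neg (fun e => hc' e.2)]; simp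
    · symm
      refine Finset.sum_eq_zero fun T _ => Finset.sum_eq_zero fun φ _ => ?_
      rw [if_neg (fun e => hc e.1)]
  rw [Finset.sum_congr rfl fun U _ => hL U, Finset.sum_comm]
  refine Finset.sum_congr rfl fun T _ => ?_
  rw [Finset.sum_comm]
  refine Finset.sum_congr rfl fun φ _ => ?_
  have hR : ∀ U : KSubset n k, (∑ ρ : S.1 ≃ U.1,
        if crossings χ = crossings ρ + crossings (ρ.symm.trans χ) ∧
            crossings ρ = crossings φ + crossings (φ.symm.trans ρ) then
          relabel (φ.symm.trans χ) (f ⟨S, T, φ⟩) *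
            (relabel (ρ.symm.trans χ) (g ⟨T, U, φ.symm.trans ρ⟩) * h ⟨U, W, ρ.symm.trans χ⟩)
        else 0) = ∑ σ : T.1 ≃ U.1,
        if crossings χ = crossings φ + crossings (φ.symm.trans χ) ∧
            crossings (φ.symm.trans χ) = crossings σ + crossings (σ.symm.trans (φ.symm.trans χ)) then
          relabel (φ.symm.trans χ) (f ⟨S, T, φ⟩) *
            (relabel (σ.symm.trans (φ.symm.trans χ)) (g ⟨T, U, σ⟩) *
              h ⟨U, W, σ.symm.trans (φ.symm.trans χ)⟩)
        else 0 := by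
    intro U
    symm
    refine Fintype.sum_equiv ⟨fun σ => φ.trans σ, fun ρ => φ.symm.trans ρ, fun σ => ?_, fun ρ => ?_⟩
      _ _ fun σ => ?_
    · ext x; simp
    · ext x; simp
    · simp only [Equiv.coe_fn_mk]
      have e1 : (φ.trans σ).symm.trans χ = σ.symm.trans (φ.symm.trans χ) := by ext x; simp
      have e2 : φ.symm.trans (φ.trans σ) = σ := by ext x; simp
      have e3 : φ.trans (φ.symm.trans χ) = χ := by ext x; simp
      have e4 : σ.trans (σ.symm.trans (φ.symm.trans χ)) = φ.symm.trans χ := by ext x; simp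
      have e5 : (φ.trans σ).trans (σ.symm.trans (φ.symm.trans χ)) = χ := by ext x; simp
      rw [e1, e2]
      refine if_congr ?_ rfl rfl
      have h1 := crossings_trans_le φ (φ.symm.trans χ)
      have h2 := crossings_trans_le σ (σ.symm.trans (φ.symm.trans χ))
      have h3 := crossings_trans_le (φ.trans σ) (σ.symm.trans (φ.symm.trans χ))
      have h4 := crossings_trans_le φ σ
      rw [e3] at h1
      rw [e4] at h2
      rw [e5] at h3
      omega
  rw [Finset.sum_congr rfl fun U _ => hR U]
  by_cases hc : crossings χ = crossings φ + crossings (φ.symm.trans χ)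
  · rw [if_pos hc, Finset.mul_sum]
    refine Finset.sum_congr rfl fun U _ => ?_
    rw [Finset.mul_sum]
    refine Finset.sum_congr rfl fun σ _ => ?_
    by_cases hc' : crossings (φ.symm.trans χ) =
        crossings σ + crossings (σ.symm.trans (φ.symm.trans χ))
    · rw [if_pos hc', if_pos ⟨hc, hc'⟩]
    · rw [if_neg hc', if_neg (fun e => hc' e.2), mul_zero]
  · rw [if_neg hc]
    refine Finset.sum_eq_zero fun U _ => Finset.sum_eq_zero fun σ _ => ?_
    rw [if_neg (fun e => hc e.1)]

noncomputable instance : Ring (AllStrands F n k) where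
  __ := (inferInstance : AddCommGroup (AllStrands F n k))
  mul := (· * ·)
  one := 1
  left_distrib := AllStrands.mul_add'
  right_distrib := AllStrands.add_mul'
  zero_mul f := by
    have := AllStrands.add_mul' (0 : AllStrands F n k) 0 f
    rw [add_zero] at this
    exact left_eq_add.1 this
  mul_zero f := by
    have := AllStrands.mul_add' f (0 : AllStrands F n k) 0
    rw [add_zero] at this
    exact left_eq_add.1 this
  mul_assoc := AllStrands.mul_assoc'
  one_mul := AllStrands.one_mul'
  mul_one := AllStrands.mul_one'

noncomputable instance : Algebra F (AllStrands F n k) :=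
  Algebra.ofModule AllStrands.smul_mul' AllStrands.mul_smul'

end AllStrands

end NilStrands

namespace NilStrands

namespace AllStrands

variable {F : Type u} [Field F] {n k : ℕ}

/-- The sign automorphism of the underlying vector space, `(-1)^{|D|}` on `(S, T, φ, D)`. -/
noncomputable def sgn (f : AllStrands F n k) : AllStrands F n k := fun c => signAut c.2.1 (f c)

theorem sgn_apply (f : AllStrands F n k) (c) : sgn f c = signAut c.2.1 (f c) := rfl

/-- `ξ_i - ξ_j` for `i < j` and `ξ_j - ξ_i` for `j < i`. -/
noncomputable def edge {T : KSubset n k} (i j : T.1) : Dots F T :=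
  if i < j then dot i - dot j else dot j - dot i

theorem edge_comm {T : KSubset n k} (i j : T.1) : (edge i j : Dots F T) = edge j i := by
  unfold edge
  rcases lt_trichotomy i j with h | h | h
  · rw [if_pos h, if_neg h.not_gt]
  · rw [h]
  · rw [if_pos h, if_neg h.not_gt]

open scoped Classical in
theorem diff_apply' (f : AllStrands F n k) (S T : KSubset n k) (φ : S.1 ≃ T.1) :
    diff f ⟨S, T, φ⟩ = ∑ p : T.1 × T.1, if p.1 < p.2 then
      (if Crosses (resolve φ p.1 p.2) p.1 p.2 ∧
          crossings (resolve φ p.1 p.2) = crossings φ + 1 then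
        edge p.1 p.2 * f ⟨S, T, resolve φ p.1 p.2⟩
      else 0) else 0 := by
  rw [diff_apply]
  refine Finset.sum_congr rfl fun p _ => ?_
  by_cases h : p.1 < p.2
  · simp only [if_pos h, crosses_iff _ h, edge, Prod.mk.eta]
  · rw [if_neg h, if_neg]
    rintro ⟨h', -⟩
    exact h ((mem_inversions _ _ _).1 h').1

theorem relabel_edge_of_lt {T V : KSubset n k} (ψ : T.1 ≃ V.1) {i j : V.1}
    (h : ψ.symm i < ψ.symm j) :
    relabel ψ (edge (ψ.symm i) (ψ.symm j) : Dots F T) = dot i - dot j := by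
  rw [edge, if_pos h, map_sub, relabel_dot, relabel_dot]; simp

theorem relabel_edge_of_gt {T V : KSubset n k} (ψ : T.1 ≃ V.1) {i j : V.1}
    (h : ψ.symm j < ψ.symm i) :
    relabel ψ (edge (ψ.symm i) (ψ.symm j) : Dots F T) = -(dot i - dot j) := by
  rw [edge_comm, relabel_edge_of_lt ψ h, neg_sub]

theorem ite_ite_of_not {M : Type*} [Zero M] {P Q : Prop} [Decidable P] [Decidable Q] {x : M}
    (h : ¬Q) : (if P then (if Q then x else 0) else 0) = 0 := by
  rw [if_neg h, ite_self]

theorem cancel_aux {M : Type*} [AddCommGroup M] {I J X : Prop} [Decidable I] [Decidable J]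
    [Decidable X] {p p' f f' s s' : ℕ} (v : M)
    (n1 : p ≤ f + s) (n2 : p' ≤ f' + s) (n3 : p' ≤ f + s') (n4 : I → p' < p) (n5 : J → s' < s)
    (n6 : X → f' < f) (n7 : X ↔ ¬(I ↔ J)) :
    (if I ∧ p = p' + 1 ∧ p = f + s then v else 0) =
      (if X ∧ f = f' + 1 ∧ p' = f' + s then (if J then -v else v) else 0) +
      (if J ∧ s = s' + 1 ∧ p' = f + s' then v else 0) := by
  by_cases hI : I <;> by_cases hJ : J <;> simp only [hI, hJ, n7, true_and, false_and,
    iff_true, iff_false, not_true, not_false_iff, if_true, if_false, zero_add, add_zero,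
    true_imp_iff, false_imp_iff, iff_self] at *
  · refine if_congr ?_ rfl rfl
    omega
  · refine if_congr ?_ rfl rfl
    omega
  · by_cases hc : s = s' + 1 ∧ p' = f + s'
    · rw [if_pos hc, if_pos (by omega), neg_add_cancel]
    · rw [if_neg hc, if_neg (by omega), add_zero]

open scoped Classical in
/-- The three kinds of terms in the Leibniz rule cancel. -/
theorem leibniz_term {S T V : KSubset n k} (φ : S.1 ≃ T.1) (ψ : T.1 ≃ V.1) {i j : V.1}
    (hij : i < j) (x : Dots F T) (y : Dots F V) :
    (if (i, j) ∈ inversions (φ.trans ψ) ∧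
          crossings (φ.trans ψ) = crossings (resolve (φ.trans ψ) i j) + 1 ∧
          crossings (φ.trans ψ) = crossings φ + crossings ψ then
        (dot i - dot j) * (relabel ψ x * y) else 0) =
      (if Crosses φ (ψ.symm i) (ψ.symm j) ∧
          crossings φ = crossings (resolve φ (ψ.symm i) (ψ.symm j)) + 1 ∧
          crossings (resolve (φ.trans ψ) i j) =
            crossings (resolve φ (ψ.symm i) (ψ.symm j)) + crossings ψ then
        relabel ψ (edge (ψ.symm i) (ψ.symm j) * x) * y else 0) +
      (if (i, j) ∈ inversions ψ ∧ crossings ψ = crossings (resolve ψ i j) + 1 ∧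
          crossings (resolve (φ.trans ψ) i j) = crossings φ + crossings (resolve ψ i j) then
        relabel (resolve ψ i j) (signAut T x) * ((dot i - dot j) * y) else 0) := by
  have n1 := crossings_trans_le φ ψ
  have n2 := crossings_trans_le (resolve φ (ψ.symm i) (ψ.symm j)) ψ
  rw [resolve_trans] at n2
  have n3 : crossings (resolve (φ.trans ψ) i j) ≤ crossings φ + crossings (resolve ψ i j) :=
    crossings_trans_le φ (resolve ψ i j)
  have n4 : (i, j) ∈ inversions (φ.trans ψ) → _ := crossings_resolve_lt (φ.trans ψ)
  have n5 : (i, j) ∈ inversions ψ → _ := crossings_resolve_lt ψ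
  have n6 : Crosses φ (ψ.symm i) (ψ.symm j) → _ := crossings_resolve_lt' φ
  have n7 := crosses_symm_iff φ ψ hij
  have hC : relabel (resolve ψ i j) (signAut T x) * ((dot i - dot j) * y) =
      (dot i - dot j) * (relabel ψ x * y) := by
    rw [← mul_assoc, ← signAut_relabel, dot_sub_dot, mul_ι, ← dot_sub_dot, dot_sub_mul_relabel,
      mul_assoc]
  have hB : relabel ψ (edge (ψ.symm i) (ψ.symm j) * x) * y =
      if (i, j) ∈ inversions ψ then -((dot i - dot j) * (relabel ψ x * y))
      else (dot i - dot j) * (relabel ψ x * y) := by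
    split_ifs with hψ
    · rw [map_mul, relabel_edge_of_gt ψ ((mem_inversions _ _ _).1 hψ).2, mul_assoc, neg_mul]
    · have hlt : ψ.symm i < ψ.symm j := by
        refine lt_of_le_of_ne (not_lt.1 fun h => hψ ((mem_inversions _ _ _).2 ⟨hij, h⟩))
          fun e => ?_
        exact hij.ne (ψ.symm.injective e)
      rw [map_mul, relabel_edge_of_lt ψ hlt, mul_assoc]
  rw [hC, hB]
  exact cancel_aux (M := Dots F V) _ n1 n2 n3 n4 n5 n6 n7

theorem diff_mul_aux₁ (f g : AllStrands F n k) {S V : KSubset n k} (χ : S.1 ≃ V.1) :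
    (∑ p : V.1 × V.1,
      if p ∈ inversions (resolve χ p.1 p.2) ∧
          crossings (resolve χ p.1 p.2) = crossings χ + 1 then
        (dot p.1 - dot p.2) * ∑ T : KSubset n k, ∑ φ : S.1 ≃ T.1,
          (if crossings (resolve χ p.1 p.2) =
              crossings φ + crossings (φ.symm.trans (resolve χ p.1 p.2)) then
            relabel (φ.symm.trans (resolve χ p.1 p.2)) (f ⟨S, T, φ⟩) *
              g ⟨T, V, φ.symm.trans (resolve χ p.1 p.2)⟩
          else 0)
      else 0) = ∑ T : KSubset n k, ∑ φ : S.1 ≃ T.1, ∑ p : V.1 × V.1, if p.1 < p.2 then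
        (if p ∈ inversions (resolve χ p.1 p.2) ∧
            crossings (resolve χ p.1 p.2) = crossings χ + 1 ∧
            crossings (resolve χ p.1 p.2) =
              crossings φ + crossings (φ.symm.trans (resolve χ p.1 p.2)) then
          (dot p.1 - dot p.2) * (relabel (φ.symm.trans (resolve χ p.1 p.2)) (f ⟨S, T, φ⟩) *
              g ⟨T, V, φ.symm.trans (resolve χ p.1 p.2)⟩) else 0) else 0 := by
  rw [Finset.sum_congr rfl fun T _ => Finset.sum_comm, Finset.sum_comm]
  refine Finset.sum_congr rfl fun p _ => ?_
  by_cases hc : p ∈ inversions (resolve χ p.1 p.2) ∧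
        crossings (resolve χ p.1 p.2) = crossings χ + 1
  · have hp : p.1 < p.2 := ((mem_inversions _ _ _).1 hc.1).1
    rw [if_pos hc, Finset.mul_sum]
    refine Finset.sum_congr rfl fun T _ => ?_
    rw [Finset.mul_sum]
    refine Finset.sum_congr rfl fun φ _ => ?_
    rw [if_pos hp, mul_ite, mul_zero]
    refine if_congr ?_ rfl rfl
    exact ⟨fun h => ⟨hc.1, hc.2, h⟩, fun h => h.2.2⟩
  · rw [if_neg hc]
    symm
    refine Finset.sum_eq_zero fun T _ => Finset.sum_eq_zero fun φ _ => ?_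
    exact ite_ite_of_not fun h => hc ⟨h.1, h.2.1⟩

open scoped Classical in
theorem diff_mul_aux₃ {S T V : KSubset n k} (χ : S.1 ≃ V.1) (f : (S.1 ≃ T.1) → Dots F T)
    (g : (T.1 ≃ V.1) → Dots F V) :
    (∑ φ : S.1 ≃ T.1, ∑ p : T.1 × T.1, if p.1 < p.2 then
        (if Crosses (resolve φ p.1 p.2) p.1 p.2 ∧
            crossings (resolve φ p.1 p.2) = crossings φ + 1 ∧
            crossings χ = crossings φ + crossings (φ.symm.trans χ) then
          relabel (φ.symm.trans χ) (edge p.1 p.2 * f (resolve φ p.1 p.2)) *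
            g (φ.symm.trans χ) else 0) else 0) =
      ∑ φ : S.1 ≃ T.1, ∑ q : V.1 × V.1, if q.1 < q.2 then
        (if Crosses φ ((φ.symm.trans χ).symm q.1) ((φ.symm.trans χ).symm q.2) ∧
            crossings φ = crossings (resolve φ ((φ.symm.trans χ).symm q.1)
              ((φ.symm.trans χ).symm q.2)) + 1 ∧
            crossings χ = crossings (resolve φ ((φ.symm.trans χ).symm q.1)
              ((φ.symm.trans χ).symm q.2)) + crossings (resolve (φ.symm.trans χ) q.1 q.2) then
          relabel (resolve (φ.symm.trans χ) q.1 q.2)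
            (edge ((φ.symm.trans χ).symm q.1) ((φ.symm.trans χ).symm q.2) * f φ) *
            g (resolve (φ.symm.trans χ) q.1 q.2) else 0) else 0 := by
  rw [Finset.sum_comm]
  have step2 : ∀ p : T.1 × T.1, (∑ φ : S.1 ≃ T.1, if p.1 < p.2 then
        (if Crosses (resolve φ p.1 p.2) p.1 p.2 ∧
            crossings (resolve φ p.1 p.2) = crossings φ + 1 ∧
            crossings χ = crossings φ + crossings (φ.symm.trans χ) then
          relabel (φ.symm.trans χ) (edge p.1 p.2 * f (resolve φ p.1 p.2)) *
            g (φ.symm.trans χ) else 0) else 0) =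
      ∑ φ : S.1 ≃ T.1, if p.1 < p.2 then
        (if Crosses φ p.1 p.2 ∧ crossings φ = crossings (resolve φ p.1 p.2) + 1 ∧
            crossings χ = crossings (resolve φ p.1 p.2) +
              crossings ((resolve φ p.1 p.2).symm.trans χ) then
          relabel ((resolve φ p.1 p.2).symm.trans χ) (edge p.1 p.2 * f φ) *
            g ((resolve φ p.1 p.2).symm.trans χ) else 0) else 0 := by
    intro p
    refine Fintype.sum_equiv ⟨fun φ => resolve φ p.1 p.2, fun φ => resolve φ p.1 p.2,
      fun φ => resolve_resolve φ _ _, fun φ => resolve_resolve φ _ _⟩ _ _ fun φ => ?_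
    simp only [Equiv.coe_fn_mk, resolve_resolve]
  rw [Finset.sum_congr rfl fun p _ => step2 p, Finset.sum_comm]
  refine Finset.sum_congr rfl fun φ _ => ?_
  set θ := φ.symm.trans χ with hθ
  rw [← sum_lt_reindex θ (fun i j => if Crosses φ (θ.symm i) (θ.symm j) ∧
      crossings φ = crossings (resolve φ (θ.symm i) (θ.symm j)) + 1 ∧
      crossings χ = crossings (resolve φ (θ.symm i) (θ.symm j)) + crossings (resolve θ i j) then
    relabel (resolve θ i j) (edge (θ.symm i) (θ.symm j) * f φ) * g (resolve θ i j) else 0)]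
  · refine Finset.sum_congr rfl fun p _ => ?_
    have e : (resolve φ p.1 p.2).symm.trans χ = resolve θ (θ p.1) (θ p.2) := by
      have hχ : χ = φ.trans θ := by ext x; simp [hθ]
      have h := resolve_symm_trans φ θ p.1 p.2
      rwa [← hχ] at h
    simp only [Equiv.symm_apply_apply, e]
  · intro i j
    refine if_congr (and_congr (crosses_comm _ _ _) ?_) ?_ rfl
    · rw [resolve_comm φ (θ.symm i) (θ.symm j), resolve_comm θ i j]
    · rw [resolve_comm θ i j, edge_comm (θ.symm i) (θ.symm j)]


open scoped Classical in
theorem diff_mul_aux₂ (f g : AllStrands F n k) {S T V : KSubset n k} (χ : S.1 ≃ V.1) :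
    (∑ φ : S.1 ≃ T.1,
      if crossings χ = crossings φ + crossings (φ.symm.trans χ) then
        relabel (φ.symm.trans χ) (diff f ⟨S, T, φ⟩) * g ⟨T, V, φ.symm.trans χ⟩ else 0) =
      ∑ φ : S.1 ≃ T.1, ∑ q : V.1 × V.1, if q.1 < q.2 then
        (if Crosses φ ((φ.symm.trans χ).symm q.1) ((φ.symm.trans χ).symm q.2) ∧
            crossings φ = crossings (resolve φ ((φ.symm.trans χ).symm q.1)
              ((φ.symm.trans χ).symm q.2)) + 1 ∧
            crossings χ = crossings (resolve φ ((φ.symm.trans χ).symm q.1)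
              ((φ.symm.trans χ).symm q.2)) + crossings (resolve (φ.symm.trans χ) q.1 q.2) then
          relabel (resolve (φ.symm.trans χ) q.1 q.2)
            (edge ((φ.symm.trans χ).symm q.1) ((φ.symm.trans χ).symm q.2) * f ⟨S, T, φ⟩) *
            g ⟨T, V, resolve (φ.symm.trans χ) q.1 q.2⟩ else 0) else 0 := by
  have step1 : ∀ φ : S.1 ≃ T.1, (if crossings χ = crossings φ + crossings (φ.symm.trans χ) then
      relabel (φ.symm.trans χ) (diff f ⟨S, T, φ⟩) * g ⟨T, V, φ.symm.trans χ⟩ else 0) =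
      ∑ p : T.1 × T.1, if p.1 < p.2 then
        (if Crosses (resolve φ p.1 p.2) p.1 p.2 ∧
            crossings (resolve φ p.1 p.2) = crossings φ + 1 ∧
            crossings χ = crossings φ + crossings (φ.symm.trans χ) then
          relabel (φ.symm.trans χ) (edge p.1 p.2 * f ⟨S, T, resolve φ p.1 p.2⟩) *
            g ⟨T, V, φ.symm.trans χ⟩ else 0) else 0 := by
    intro φ
    by_cases hc : crossings χ = crossings φ + crossings (φ.symm.trans χ)
    · rw [if_pos hc, diff_apply', map_sum, Finset.sum_mul]
      refine Finset.sum_congr rfl fun p _ => ?_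
      split_ifs <;> simp_all
    · rw [if_neg hc]
      symm
      refine Finset.sum_eq_zero fun p _ => ?_
      exact ite_ite_of_not fun h => hc h.2.2
  rw [Finset.sum_congr rfl fun φ _ => step1 φ]
  exact diff_mul_aux₃ χ (fun φ => f ⟨S, T, φ⟩) (fun ψ => g ⟨T, V, ψ⟩)

theorem diff_mul (f g : AllStrands F n k) :
    diff (f * g) = diff f * g + sgn f * diff g := by
  classical
  ext S V χ
  rw [add_apply, diff_apply, mul_apply, mul_apply]
  simp only [mul_apply]
  rw [diff_mul_aux₁, ← Finset.sum_add_distrib]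
  refine Finset.sum_congr rfl fun T _ => ?_
  rw [diff_mul_aux₂, ← Finset.sum_add_distrib]
  refine Finset.sum_congr rfl fun φ _ => ?_
  -- expand `sgn f * diff g`
  set θ := φ.symm.trans χ with hθ
  have hC : (if crossings χ = crossings φ + crossings θ then
        relabel θ (sgn f ⟨S, T, φ⟩) * diff g ⟨T, V, θ⟩ else 0) =
      ∑ q : V.1 × V.1, if q.1 < q.2 then
        (if q ∈ inversions (resolve θ q.1 q.2) ∧
            crossings (resolve θ q.1 q.2) = crossings θ + 1 ∧
            crossings χ = crossings φ + crossings θ then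
          relabel θ (signAut T (f ⟨S, T, φ⟩)) *
            ((dot q.1 - dot q.2) * g ⟨T, V, resolve θ q.1 q.2⟩) else 0) else 0 := by
    by_cases hc : crossings χ = crossings φ + crossings θ
    · rw [if_pos hc, diff_apply, Finset.mul_sum]
      refine Finset.sum_congr rfl fun q _ => ?_
      rw [mul_ite, mul_zero]
      by_cases hq : q.1 < q.2
      · rw [if_pos hq]
        refine if_congr ?_ rfl rfl
        exact ⟨fun h => ⟨h.1, h.2, hc⟩, fun h => ⟨h.1, h.2.1⟩⟩
      · rw [if_neg hq, if_neg fun h => hq ((mem_inversions _ _ _).1 h.1).1]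
    · rw [if_neg hc]
      symm
      refine Finset.sum_eq_zero fun q _ => ?_
      exact ite_ite_of_not fun h => hc h.2.2
  rw [hC, ← Finset.sum_add_distrib]
  refine Finset.sum_congr rfl fun q _ => ?_
  by_cases hq : q.1 < q.2
  · rw [if_pos hq, if_pos hq, if_pos hq]
    have hχ : χ = φ.trans θ := by ext x; simp [hθ]
    have key := leibniz_term φ (resolve θ q.1 q.2) hq (f ⟨S, T, φ⟩)
      (g ⟨T, V, resolve θ q.1 q.2⟩)
    have e0 : φ.symm.trans (resolve χ q.1 q.2) = resolve θ q.1 q.2 := rfl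
    have e1 : φ.trans (resolve θ q.1 q.2) = resolve χ q.1 q.2 := by rw [hχ]; rfl
    have e2 : (resolve θ q.1 q.2).symm q.1 = θ.symm q.2 := by simp [resolve]
    have e3 : (resolve θ q.1 q.2).symm q.2 = θ.symm q.1 := by simp [resolve]
    rw [e1, e2, e3, resolve_resolve, resolve_resolve, crosses_comm, resolve_comm φ,
      edge_comm] at key
    rw [e0]
    exact key
  · rw [if_neg hq, if_neg hq, if_neg hq, add_zero]

theorem sgn_sgn (f : AllStrands F n k) : sgn (sgn f) = f := by
  ext S T φ
  rw [sgn_apply, sgn_apply, signAut_signAut]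

theorem sgn_diff (f : AllStrands F n k) : sgn (diff f) = -diff (sgn f) := by
  ext S T φ
  rw [sgn_apply, neg_apply, diff_apply, diff_apply, map_sum, ← Finset.sum_neg_distrib]
  refine Finset.sum_congr rfl fun p _ => ?_
  split_ifs
  · rw [map_mul, dot_sub_dot, signAut_ι, sgn_apply, neg_mul]
  · simp

open scoped Classical in
/-- The combination with coefficient `x` at the diagram `c` and `0` elsewhere. -/
noncomputable def single (c : Diagram n k) (x : Dots F c.2.1) : AllStrands F n k :=
  Pi.single (M := fun c : Diagram n k => Dots F c.2.1) c x

theorem single_same (c : Diagram n k) (x : Dots F c.2.1) : single c x c = x := by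
  classical
  exact Pi.single_eq_same (M := fun c : Diagram n k => Dots F c.2.1) c x

theorem single_of_ne {c c' : Diagram n k} (h : c' ≠ c) (x : Dots F c.2.1) :
    single c x c' = 0 := by
  classical
  exact Pi.single_eq_of_ne (M := fun c : Diagram n k => Dots F c.2.1) h x

theorem sum_single (f : AllStrands F n k) : ∑ c, single c (f c) = f := by
  classical
  exact Finset.univ_sum_single (M := fun c : Diagram n k => Dots F c.2.1) f

/-- The product of two dotted diagrams. -/
theorem single_mul_single {S T V : KSubset n k} (φ : S.1 ≃ T.1) (ψ : T.1 ≃ V.1)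
    (x : Dots F T) (y : Dots F V) :
    (single ⟨S, T, φ⟩ x * single ⟨T, V, ψ⟩ y : AllStrands F n k) =
      if crossings (φ.trans ψ) = crossings φ + crossings ψ then
        single ⟨S, V, φ.trans ψ⟩ (relabel ψ x * y) else 0 := by
  have zero : ∀ (S' T' V' : KSubset n k) (χ : S'.1 ≃ V'.1) (φ' : S'.1 ≃ T'.1),
      ¬((⟨S', T', φ'⟩ : Diagram n k) = ⟨S, T, φ⟩ ∧
        (⟨T', V', φ'.symm.trans χ⟩ : Diagram n k) = ⟨T, V, ψ⟩) →
      (if crossings χ = crossings φ' + crossings (φ'.symm.trans χ) then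
        relabel (φ'.symm.trans χ) ((single ⟨S, T, φ⟩ x : AllStrands F n k) ⟨S', T', φ'⟩) *
          (single ⟨T, V, ψ⟩ y : AllStrands F n k) ⟨T', V', φ'.symm.trans χ⟩ else 0) = 0 := by
    intro S' T' V' χ φ' h
    rcases not_and_or.1 h with h | h
    · rw [single_of_ne h]; simp
    · rw [single_of_ne h]; simp
  ext S' V' χ
  rw [mul_apply]
  by_cases hc : (⟨S', V', χ⟩ : Diagram n k) = ⟨S, V, φ.trans ψ⟩
  · cases hc
    rw [Finset.sum_eq_single T, Finset.sum_eq_single φ]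
    · have e : φ.symm.trans (φ.trans ψ) = ψ := by ext; simp
      rw [e]
      split_ifs with h
      · rw [single_same, single_same, single_same]
      · rfl
    · intro φ' _ h
      exact zero _ _ _ _ _ fun e => h (by cases e.1; rfl)
    · simp
    · intro T' _ h
      exact Finset.sum_eq_zero fun φ' _ => zero _ _ _ _ _ fun e => h (by cases e.1; rfl)
    · simp
  · have : (if crossings (φ.trans ψ) = crossings φ + crossings ψ then
        single ⟨S, V, φ.trans ψ⟩ (relabel ψ x * y) else 0 : AllStrands F n k) ⟨S', V', χ⟩ = 0 := by
      split_ifs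
      · exact single_of_ne hc _
      · rfl
    rw [this]
    refine Finset.sum_eq_zero fun T' _ => Finset.sum_eq_zero fun φ' _ => zero _ _ _ _ _ ?_
    rintro ⟨e1, e2⟩
    cases e1
    have hV : V' = V := by cases e2; rfl
    subst hV
    have hψ : φ.symm.trans χ = ψ := by simpa using e2
    apply hc
    rw [← hψ]
    congr 2
    ext; simp

theorem diff_eq_zero_of_crossings {f : AllStrands F n k}
    (h : ∀ c : Diagram n k, crossings c.2.2 ≠ 0 → f c = 0) : diff f = 0 := by
  ext S T φ
  rw [diff_apply]
  refine Finset.sum_eq_zero fun p _ => ?_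
  split_ifs with hc
  · rw [h ⟨S, T, resolve φ p.1 p.2⟩ (by dsimp only; omega), mul_zero]
  · rfl

theorem diff_diff (f : AllStrands F n k) : diff (diff f) = 0 := by
  suffices H : ∀ (m : ℕ) (S T : KSubset n k) (φ : S.1 ≃ T.1) (x : Dots F T), crossings φ = m →
      diff (diff (single ⟨S, T, φ⟩ x)) = 0 by
    rw [← sum_single f, map_sum, map_sum]
    exact Finset.sum_eq_zero fun c _ => H _ c.1 c.2.1 c.2.2 _ rfl
  intro m
  induction m with
  | zero =>
    intro S T φ x h
    rw [diff_eq_zero_of_crossings (f := single ⟨S, T, φ⟩ x), map_zero]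
    intro c hc
    refine single_of_ne (fun e => hc ?_) _
    rw [e]; exact h
  | succ m ih =>
    intro S T φ x h
    obtain ⟨σ, hσ, hφ⟩ := exists_simple_factor φ (by omega)
    have e : σ.trans (σ.symm.trans φ) = φ := by ext; simp
    have hprod : (single ⟨S, T, φ⟩ x : AllStrands F n k) =
        single ⟨S, S, σ⟩ 1 * single ⟨S, T, σ.symm.trans φ⟩ x := by
      rw [single_mul_single, e, if_pos (by omega), map_one, one_mul]
    have hdd : diff (diff (single ⟨S, S, σ⟩ 1 : AllStrands F n k)) = 0 := by
      apply diff_eq_zero_of_crossings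
      rintro ⟨S', T', φ'⟩ hc
      rw [diff_apply]
      refine Finset.sum_eq_zero fun p _ => ?_
      split_ifs with hc'
      · rw [single_of_ne, mul_zero]
        intro e'
        have : crossings (resolve φ' p.1 p.2) = crossings σ := by
          have := congrArg (fun c : Diagram n k => crossings c.2.2) e'
          exact this
        dsimp only at hc
        omega
      · rfl
    rw [hprod, diff_mul, map_add, diff_mul, diff_mul, hdd, ih _ _ _ _ (by omega), sgn_diff,
      zero_mul, mul_zero]
    simp

theorem idem_apply_same (S : KSubset n k) :
    (idem S : AllStrands F n k) ⟨S, S, Equiv.refl _⟩ = 1 := if_pos ⟨rfl, fun _ => rfl⟩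

theorem idem_eq_single (S : KSubset n k) :
    (idem S : AllStrands F n k) = single ⟨S, S, Equiv.refl _⟩ 1 := by
  ext S' T' φ'
  by_cases h : (⟨S', T', φ'⟩ : Diagram n k) = ⟨S, S, Equiv.refl _⟩
  · cases h
    rw [idem_apply_same, single_same]
  · rw [single_of_ne h]
    refine if_neg ?_
    rintro ⟨h1, h2⟩
    dsimp only at h1
    subst h1
    have hT : T' = S' := by
      refine Subtype.ext (Finset.eq_of_subset_of_card_le ?_ (by rw [S'.2, T'.2])).symm
      intro s hs
      have := (φ' ⟨s, hs⟩).2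
      rwa [h2 ⟨s, hs⟩] at this
    subst hT
    apply h
    congr 2
    exact Equiv.ext fun s => Subtype.ext (h2 s)

theorem idem_mul_idem (S : KSubset n k) : (idem S * idem S : AllStrands F n k) = idem S := by
  rw [idem_eq_single, single_mul_single, if_pos]
  · rw [map_one, one_mul, Equiv.refl_trans]
  · rw [Equiv.refl_trans, crossings_refl]

theorem diff_idem (S : KSubset n k) : diff (idem S : AllStrands F n k) = 0 := by
  apply diff_eq_zero_of_crossings
  intro c hc
  rw [idem_eq_single]
  refine single_of_ne (fun e => hc ?_) _
  rw [e]; exact crossings_refl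

end AllStrands

end NilStrands

/-- A `q`-graded dg algebra over `F`: an algebra `A = ⨁ A^i_j`, with `i` the cohomological
and `j` the `q`-grading, and a differential of bidegree `(1, 0)`. -/
class QDGAlgebra (F : Type u) [Field F] (A : Type u) [Ring A] [Algebra F A] where
  /-- `gr i j` is `A^i_j`. -/
  gr : ℤ → ℤ → Submodule F A
  isInternal : DirectSum.IsInternal fun p : ℤ × ℤ => gr p.1 p.2
  one_mem : (1 : A) ∈ gr 0 0
  mul_mem : ∀ {i j i' j' : ℤ} {a b : A}, a ∈ gr i j → b ∈ gr i' j' → a * b ∈ gr (i + i') (j + j')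
  /-- the differential -/
  d : A →ₗ[F] A
  d_mem : ∀ {i j : ℤ} {a : A}, a ∈ gr i j → d a ∈ gr (i + 1) j
  d_d : ∀ a : A, d (d a) = 0
  leibniz : ∀ {i j : ℤ} {a : A} (b : A), a ∈ gr i j →
    d (a * b) = d a * b + i.negOnePow • (a * d b)

theorem isInternal_of_detect {F M N ι : Type*} [Field F] [AddCommGroup M] [Module F M]
    [AddCommGroup N] [Module F N] [DecidableEq ι] (G : ι → Submodule F M) (π : ι → M →ₗ[F] N)
    (h1 : ∀ i, ∀ x ∈ G i, π i x = 0 → x = 0) (h2 : ∀ i j, i ≠ j → ∀ x ∈ G i, π j x = 0)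
    (h3 : ⨆ i, G i = ⊤) : DirectSum.IsInternal G := by
  refine DirectSum.isInternal_submodule_of_iSupIndep_of_iSup_eq_top ?_ h3
  rw [iSupIndep_def]
  intro i
  rw [Submodule.disjoint_def]
  intro x hx hx'
  refine h1 i x hx ?_
  have : ⨆ j, ⨆ (_ : j ≠ i), G j ≤ LinearMap.ker (π i) :=
    iSup_le fun j => iSup_le fun hj => fun y hy => h2 j i hj y hy
  exact this hx'

namespace NilStrands

/-- `φ` is nondecreasing: no strand goes down. -/
def Nondecreasing {n : ℕ} {S T : Finset (Fin n)} (φ : S ≃ T) : Prop :=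
  ∀ s : S, (s : Fin n) ≤ φ s

/-- The endpoint `t` lies in `I(φ)`, that is, `t` is the right endpoint of an increasing
strand. -/
def IsIncreasingEnd {n : ℕ} {S T : Finset (Fin n)} (φ : S ≃ T) (t : T) : Prop :=
  (φ.symm t : Fin n) < t

/-- `‖S‖ = ∑_{s ∈ S} s`, where the element `s : Fin n` stands for `s + 1 ∈ {1, …, n}`. -/
def total {n k : ℕ} (S : KSubset n k) : ℤ := ∑ s ∈ S.1, ((s : ℤ) + 1)

section

variable (F : Type u) [Field F] {n k : ℕ}

/-- The span of the `D` whose underlying set lies in `I(φ)`: dots sit on increasing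
strands only. -/
def allowedDots {S T : KSubset n k} (φ : S.1 ≃ T.1) : Subalgebra F (Dots F T) :=
  Algebra.adjoin F {x | ∃ t : T.1, IsIncreasingEnd φ t ∧ x = dot t}

variable (n k) in
/-- The underlying algebra of `R(n;k)^nil`, spanned by the `(S, T, φ, D)` with `φ` nondecreasing
and `D` an ordered subset of `I(φ)`. -/
noncomputable def nilSubalgebra : Subalgebra F (AllStrands F n k) where
  carrier := {f | ∀ (S T : KSubset n k) (φ : S.1 ≃ T.1),
    (¬Nondecreasing φ → f ⟨S, T, φ⟩ = 0) ∧ f ⟨S, T, φ⟩ ∈ allowedDots F φ}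
  zero_mem' := fun S T φ => ⟨fun _ => rfl, zero_mem _⟩
  add_mem' := by
    intro f g hf hg S T φ
    refine ⟨fun h => ?_, add_mem (hf S T φ).2 (hg S T φ).2⟩
    rw [AllStrands.add_apply, (hf S T φ).1 h, (hg S T φ).1 h, add_zero]
  algebraMap_mem' := by
    intro r S T φ
    rw [Algebra.algebraMap_eq_smul_one, AllStrands.smul_apply]
    by_cases h : ∀ s : S.1, (φ s : Fin n) = s
    · refine ⟨fun h' => absurd (fun s => (h s).ge) h', Subalgebra.smul_mem _ ?_ r⟩
      have : (1 : AllStrands F n k) ⟨S, T, φ⟩ = 1 := if_pos h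
      rw [this]; exact one_mem _
    · have : (1 : AllStrands F n k) ⟨S, T, φ⟩ = 0 := if_neg h
      rw [this, smul_zero]
      exact ⟨fun _ => rfl, zero_mem _⟩
  mul_mem' := by
    intro f g hf hg S V χ
    have key : ∀ (T : KSubset n k) (φ : S.1 ≃ T.1),
        (¬Nondecreasing χ → relabel (φ.symm.trans χ) (f ⟨S, T, φ⟩) *
          g ⟨T, V, φ.symm.trans χ⟩ = 0) ∧
        relabel (φ.symm.trans χ) (f ⟨S, T, φ⟩) * g ⟨T, V, φ.symm.trans χ⟩ ∈
          allowedDots F χ := by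
      intro T φ
      by_cases h1 : Nondecreasing φ
      · by_cases h2 : Nondecreasing (φ.symm.trans χ)
        · have h12 : ∀ s, φ s ≤ (χ s : Fin n) := fun s => by simpa using h2 (φ s)
          have hχ : Nondecreasing χ := fun s => (h1 s).trans (h12 s)
          refine ⟨fun h => absurd hχ h, mul_mem ?_ ?_⟩
          · have hle : allowedDots F φ ≤ (allowedDots F χ).comap (relabel (φ.symm.trans χ)) := by
              refine Algebra.adjoin_le ?_
              rintro _ ⟨t, ht, rfl⟩
              change relabel (φ.symm.trans χ) (dot t) ∈ allowedDots F χ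
              rw [relabel_dot]
              refine Algebra.subset_adjoin ⟨_, ?_, rfl⟩
              have := h12 (φ.symm t)
              unfold IsIncreasingEnd at ht ⊢
              simp only [Equiv.apply_symm_apply, Equiv.trans_apply,
                Equiv.symm_apply_apply] at this ⊢
              exact ht.trans_le this
            exact hle (hf S T φ).2
          · have hle : allowedDots F (φ.symm.trans χ) ≤ allowedDots F χ := by
              refine Algebra.adjoin_mono ?_
              rintro _ ⟨t, ht, rfl⟩
              refine ⟨t, ?_, rfl⟩
              have := h1 (χ.symm t)
              unfold IsIncreasingEnd at ht ⊢
              simp only [Equiv.symm_trans_apply, Equiv.symm_symm] at ht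
              exact this.trans_lt ht
            exact hle (hg T V _).2
        · rw [(hg T V _).1 h2, mul_zero]
          exact ⟨fun _ => rfl, zero_mem _⟩
      · rw [(hf S T φ).1 h1, map_zero, zero_mul]
        exact ⟨fun _ => rfl, zero_mem _⟩
    rw [AllStrands.mul_apply]
    refine ⟨fun h => Finset.sum_eq_zero fun T _ => Finset.sum_eq_zero fun φ _ => ?_,
      sum_mem fun T _ => sum_mem fun φ _ => ?_⟩
    · split_ifs
      · exact (key T φ).1 h
      · rfl
    · split_ifs
      · exact (key T φ).2
      · exact zero_mem _

/-- The elements of `⋀ (T → F)` at the diagram `(S, T, φ)` that have cohomological degree `i`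
and `q`-degree `j`, where `(S, T, φ, D)` has cohomological degree `|D|` and `q`-degree
`-2 (|D| + |Inv φ|) + (‖T‖ - ‖S‖)`. -/
noncomputable def piece (i j : ℤ) (c : Diagram n k) : Submodule F (Dots F c.2.1) :=
  if 0 ≤ i ∧ j = -2 * (i + crossings c.2.2) + (total c.2.1 - total c.1) then
    ⋀[F]^i.toNat (c.2.1.1 → F)
  else ⊥

variable (n k) in
/-- The bigrading of `AllStrands F n k`. -/
noncomputable def AllStrands.gr (i j : ℤ) : Submodule F (AllStrands F n k) where
  carrier := {f | ∀ c, f c ∈ piece F i j c}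
  zero_mem' := fun _ => zero_mem _
  add_mem' := fun hf hg c => add_mem (hf c) (hg c)
  smul_mem' := fun r _ hf c => Submodule.smul_mem _ r (hf c)

end

section

variable {F : Type u} [Field F] {n k : ℕ}

theorem mem_piece_iff {i j : ℤ} {c : Diagram n k} {x : Dots F c.2.1} :
    x ∈ piece F i j c ↔ x = 0 ∨ ∃ p : ℕ, i = p ∧
      j = -2 * (i + crossings c.2.2) + (total c.2.1 - total c.1) ∧
      x ∈ ⋀[F]^p (c.2.1.1 → F) := by
  unfold piece
  split_ifs with h
  · constructor
    · intro hx
      exact Or.inr ⟨i.toNat, (Int.toNat_of_nonneg h.1).symm, h.2, hx⟩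
    · rintro (rfl | ⟨p, hp, -, hx⟩)
      · exact zero_mem _
      · subst hp; exact hx
  · rw [Submodule.mem_bot]
    constructor
    · exact Or.inl
    · rintro (rfl | ⟨p, hp, hj, -⟩)
      · rfl
      · exact absurd ⟨by omega, hj⟩ h

theorem relabel_mem {T V : KSubset n k} (ψ : T.1 ≃ V.1) {p : ℕ} {x : Dots F T}
    (hx : x ∈ ⋀[F]^p (T.1 → F)) : relabel ψ x ∈ ⋀[F]^p (V.1 → F) := by
  rw [← ExteriorAlgebra.ιMulti_span_fixedDegree] at hx ⊢
  induction hx using Submodule.span_induction with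
  | mem x hx =>
    obtain ⟨v, rfl⟩ := hx
    rw [relabel, ExteriorAlgebra.map_apply_ιMulti]
    exact Submodule.subset_span ⟨_, rfl⟩
  | zero => rw [map_zero]; exact zero_mem _
  | add x y _ _ hx hy => rw [map_add]; exact add_mem hx hy
  | smul c x _ hx => rw [map_smul]; exact Submodule.smul_mem _ _ hx

theorem ι_mem {T : KSubset n k} (v : T.1 → F) :
    ExteriorAlgebra.ι F v ∈ ⋀[F]^1 (T.1 → F) := by
  exact (pow_one (LinearMap.range (ExteriorAlgebra.ι F : (T.1 → F) →ₗ[F] Dots F T))).ge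
    (LinearMap.mem_range_self _ _)

theorem wedge_mul_mem {T : KSubset n k} {p p' : ℕ} {x y : Dots F T}
    (hx : x ∈ ⋀[F]^p (T.1 → F)) (hy : y ∈ ⋀[F]^p' (T.1 → F)) :
    x * y ∈ ⋀[F]^(p + p') (T.1 → F) := by
  exact (pow_add (LinearMap.range (ExteriorAlgebra.ι F : (T.1 → F) →ₗ[F] Dots F T)) p p').ge
    (Submodule.mul_mem_mul hx hy)

theorem wedge_one_mem {T : KSubset n k} : (1 : Dots F T) ∈ ⋀[F]^0 (T.1 → F) := by
  exact (pow_zero (LinearMap.range (ExteriorAlgebra.ι F : (T.1 → F) →ₗ[F] Dots F T))).ge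
    (Submodule.one_le.1 le_rfl)

namespace AllStrands

theorem gr_one_mem : (1 : AllStrands F n k) ∈ gr F n k 0 0 := by
  rintro ⟨S, T, φ⟩
  rw [mem_piece_iff]
  by_cases h : ∀ s : S.1, (φ s : Fin n) = s
  · right
    have h1 : (1 : AllStrands F n k) ⟨S, T, φ⟩ = 1 := if_pos h
    have hST : T = S := by
      by_contra hne
      have h0 := one_apply_of_ne (F := F) φ (fun e => hne e.symm)
      rw [h1] at h0
      exact one_ne_zero h0
    subst hST
    have hφ : φ = Equiv.refl _ := Equiv.ext fun s => Subtype.ext (h s)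
    subst hφ
    refine ⟨0, rfl, ?_, ?_⟩
    · simp [crossings_refl]
    · rw [h1]; exact wedge_one_mem
  · exact Or.inl (if_neg h)

theorem gr_mul_mem {i j i' j' : ℤ} {f g : AllStrands F n k} (hf : f ∈ gr F n k i j)
    (hg : g ∈ gr F n k i' j') : f * g ∈ gr F n k (i + i') (j + j') := by
  rintro ⟨S, V, χ⟩
  rw [mul_apply]
  refine sum_mem fun T _ => sum_mem fun φ _ => ?_
  split_ifs with hc
  · rw [mem_piece_iff]
    rcases mem_piece_iff.1 (hf ⟨S, T, φ⟩) with h | ⟨p, hp, hj, hx⟩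
    · left; rw [h, map_zero, zero_mul]
    · rcases mem_piece_iff.1 (hg ⟨T, V, φ.symm.trans χ⟩) with h | ⟨p', hp', hj', hx'⟩
      · left; rw [h, mul_zero]
      · refine Or.inr ⟨p + p', by push_cast; omega, ?_, wedge_mul_mem (relabel_mem _ hx) hx'⟩
        dsimp only at hj hj' hc ⊢
        rw [hc]
        push_cast
        linarith
  · exact zero_mem _

theorem gr_diff_mem {i j : ℤ} {f : AllStrands F n k} (hf : f ∈ gr F n k i j) :
    diff f ∈ gr F n k (i + 1) j := by
  rintro ⟨S, T, φ⟩
  rw [diff_apply]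
  refine sum_mem fun p _ => ?_
  split_ifs with hc
  · rw [mem_piece_iff]
    rcases mem_piece_iff.1 (hf ⟨S, T, resolve φ p.1 p.2⟩) with h | ⟨m, hm, hj, hx⟩
    · left; rw [h, mul_zero]
    · refine Or.inr ⟨1 + m, by push_cast; omega, ?_, ?_⟩
      · dsimp only at hj ⊢
        rw [hc.2] at hj
        push_cast at hj
        linarith
      · rw [dot_sub_dot]
        exact wedge_mul_mem (ι_mem _) hx
  · exact zero_mem _

theorem sgn_eq {i j : ℤ} {f : AllStrands F n k} (hf : f ∈ gr F n k i j) :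
    sgn f = i.negOnePow • f := by
  ext S T φ
  rw [sgn_apply]
  change _ = i.negOnePow • f ⟨S, T, φ⟩
  rcases mem_piece_iff.1 (hf ⟨S, T, φ⟩) with h | ⟨p, rfl, -, hx⟩
  · rw [h, map_zero, smul_zero]
  · rw [signAut_mem hx, Units.smul_def]
    simp [Int.negOnePow_def]

theorem leibniz {i j : ℤ} {f : AllStrands F n k} (g : AllStrands F n k)
    (hf : f ∈ gr F n k i j) : diff (f * g) = diff f * g + i.negOnePow • (f * diff g) := by
  rw [diff_mul, sgn_eq hf, Units.smul_def, Units.smul_def, smul_mul_assoc]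

theorem diff_mem {f : AllStrands F n k} (hf : f ∈ nilSubalgebra F n k) :
    diff f ∈ nilSubalgebra F n k := by
  intro S T φ
  rw [diff_apply]
  have key : ∀ p : T.1 × T.1, p ∈ inversions (resolve φ p.1 p.2) →
      (¬Nondecreasing φ → (dot p.1 - dot p.2 : Dots F T) * f ⟨S, T, resolve φ p.1 p.2⟩ = 0) ∧
      (dot p.1 - dot p.2 : Dots F T) * f ⟨S, T, resolve φ p.1 p.2⟩ ∈ allowedDots F φ := by
    rintro ⟨i, j⟩ hp
    dsimp only at hp ⊢
    obtain ⟨hij, hs⟩ := (mem_inversions _ _ _).1 hp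
    have e1 : (resolve φ i j).symm i = φ.symm j := by simp [resolve]
    have e2 : (resolve φ i j).symm j = φ.symm i := by simp [resolve]
    have e3 : ∀ t, t ≠ i → t ≠ j → (resolve φ i j).symm t = φ.symm t := by
      intro t h1 h2
      simp only [resolve, Equiv.symm_trans_apply, Equiv.symm_swap]
      exact congrArg φ.symm (Equiv.swap_apply_of_ne_of_ne h1 h2)
    rw [e1, e2] at hs
    by_cases h1 : Nondecreasing (resolve φ i j)
    · have hle : ∀ t : T.1, ((resolve φ i j).symm t : Fin n) ≤ t := fun t => by
        simpa using h1 ((resolve φ i j).symm t)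
      have hi := hle i
      have hj := hle j
      rw [e1] at hi
      rw [e2] at hj
      have hs' : (φ.symm i : Fin n) < φ.symm j := hs
      have hij' : (i : Fin n) < j := hij
      have Ii : IsIncreasingEnd φ i := hs'.trans_le hi
      have Ij : IsIncreasingEnd φ j := hi.trans_lt hij'
      have hφ : Nondecreasing φ := by
        have : ∀ t : T.1, (φ.symm t : Fin n) ≤ t := by
          intro t
          by_cases ht : t = i
          · rw [ht]; exact le_of_lt Ii
          · by_cases ht' : t = j
            · rw [ht']; exact le_of_lt Ij
            · rw [← e3 t ht ht']; exact hle t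
        intro s
        simpa using this (φ s)
      refine ⟨fun h => absurd hφ h, mul_mem (sub_mem ?_ ?_) ?_⟩
      · exact Algebra.subset_adjoin ⟨i, Ii, rfl⟩
      · exact Algebra.subset_adjoin ⟨j, Ij, rfl⟩
      · have hsub : allowedDots F (resolve φ i j) ≤ allowedDots F φ := by
          refine Algebra.adjoin_mono ?_
          rintro _ ⟨t, ht, rfl⟩
          refine ⟨t, ?_, rfl⟩
          by_cases hti : t = i
          · rw [hti]; exact Ii
          · by_cases htj : t = j
            · rw [htj]; exact Ij
            · unfold IsIncreasingEnd at ht ⊢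
              rwa [e3 t hti htj] at ht
        exact hsub (hf S T _).2
    · rw [(hf S T _).1 h1, mul_zero]
      exact ⟨fun _ => rfl, zero_mem _⟩
  refine ⟨fun h => Finset.sum_eq_zero fun p _ => ?_, sum_mem fun p _ => ?_⟩
  · split_ifs with hc
    · exact (key p hc.1).1 h
    · rfl
  · split_ifs with hc
    · exact (key p hc.1).2
    · exact zero_mem _

open scoped Classical in
/-- The component of bidegree `(i, j)` at the diagram `c`. -/
noncomputable def pieceProj (i j : ℤ) (c : Diagram n k) : Dots F c.2.1 →ₗ[F] Dots F c.2.1 :=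
  if 0 ≤ i ∧ j = -2 * (i + crossings c.2.2) + (total c.2.1 - total c.1) then
    GradedAlgebra.proj (fun m : ℕ => ⋀[F]^m (c.2.1.1 → F)) i.toNat else 0

/-- The component of bidegree `(i, j)`. -/
noncomputable def proj (i j : ℤ) : AllStrands F n k →ₗ[F] AllStrands F n k where
  toFun f := fun c => pieceProj i j c (f c)
  map_add' _ _ := funext fun _ => map_add _ _ _
  map_smul' r f := funext fun c => (pieceProj i j c).map_smul r (f c)

theorem proj_same {i j : ℤ} {f : AllStrands F n k} (hf : f ∈ gr F n k i j) :
    proj i j f = f := by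
  funext c
  change pieceProj i j c (f c) = _
  rcases mem_piece_iff.1 (hf c) with h | ⟨p, rfl, hj, hx⟩
  · rw [h, map_zero]
  · rw [pieceProj, if_pos ⟨by omega, hj⟩, GradedAlgebra.proj_apply, Int.toNat_natCast]
    exact DirectSum.decompose_of_mem_same (fun m : ℕ => ⋀[F]^m (c.2.1.1 → F)) hx

theorem proj_ne {i j i' j' : ℤ} (h : (i, j) ≠ (i', j')) {f : AllStrands F n k}
    (hf : f ∈ gr F n k i j) : proj i' j' f = 0 := by
  funext c
  change pieceProj i' j' c (f c) = _
  rcases mem_piece_iff.1 (hf c) with h0 | ⟨p, rfl, hj, hx⟩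
  · rw [h0, map_zero]; rfl
  · unfold pieceProj
    split_ifs with hc
    · rw [GradedAlgebra.proj_apply]
      refine DirectSum.decompose_of_mem_ne (fun m : ℕ => ⋀[F]^m (c.2.1.1 → F)) hx ?_
      rintro rfl
      apply h
      have : (i'.toNat : ℤ) = i' := Int.toNat_of_nonneg hc.1
      rw [hj, hc.2, this]
    · rfl

theorem single_add (c : Diagram n k) (x y : Dots F c.2.1) :
    single c (x + y) = single c x + single c y := by
  classical
  exact Pi.single_add (f := fun c : Diagram n k => Dots F c.2.1) c x y

theorem single_zero (c : Diagram n k) : single c (0 : Dots F c.2.1) = 0 := by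
  classical
  exact Pi.single_zero (M := fun c : Diagram n k => Dots F c.2.1) c

theorem single_smul (c : Diagram n k) (r : F) (x : Dots F c.2.1) :
    single c (r • x) = r • single c x := by
  classical
  exact Pi.single_smul (f := fun c : Diagram n k => Dots F c.2.1) c r x

theorem single_mem {c : Diagram n k} {x : Dots F c.2.1} (h1 : Nondecreasing c.2.2)
    (hx : x ∈ allowedDots F c.2.2) : single c x ∈ nilSubalgebra F n k := by
  intro S T φ
  by_cases h : (⟨S, T, φ⟩ : Diagram n k) = c
  · subst h
    rw [single_same]
    exact ⟨fun h => absurd h1 h, hx⟩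
  · rw [single_of_ne h]
    exact ⟨fun _ => rfl, zero_mem _⟩

theorem single_mem_gr {c : Diagram n k} {p : ℕ} {x : Dots F c.2.1}
    (hx : x ∈ ⋀[F]^p (c.2.1.1 → F)) :
    single c x ∈ gr F n k p (-2 * (p + crossings c.2.2) + (total c.2.1 - total c.1)) := by
  intro c'
  by_cases h : c' = c
  · subst h
    rw [single_same]
    exact mem_piece_iff.2 (Or.inr ⟨p, rfl, rfl, hx⟩)
  · rw [single_of_ne h]; exact zero_mem _

variable (F n k) in
theorem iSup_gr : (⨆ p : ℤ × ℤ, (gr F n k p.1 p.2).comap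
    (nilSubalgebra F n k).val.toLinearMap) = ⊤ := by
  set U : Submodule F (nilSubalgebra F n k) := ⨆ p : ℤ × ℤ, (gr F n k p.1 p.2).comap
    (nilSubalgebra F n k).val.toLinearMap with hU
  have key : ∀ c : Diagram n k, Nondecreasing c.2.2 → ∀ x ∈ allowedDots F c.2.2,
      ∃ r ∈ U, (r : AllStrands F n k) = single c x := by
    intro c hc x hx
    have hx' : x ∈ Submodule.span F (Submonoid.closure
        {x : Dots F c.2.1 | ∃ t : c.2.1.1, IsIncreasingEnd c.2.2 t ∧ x = dot t} :
          Set (Dots F c.2.1)) := by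
      rw [← Algebra.adjoin_eq_span]; exact hx
    clear hx
    induction hx' using Submodule.span_induction with
    | mem y hy =>
      have hdeg : ∃ p : ℕ, y ∈ ⋀[F]^p (c.2.1.1 → F) := by
        induction hy using Submonoid.closure_induction with
        | mem z hz =>
          obtain ⟨t, -, rfl⟩ := hz
          exact ⟨1, ι_mem _⟩
        | one => exact ⟨0, wedge_one_mem⟩
        | mul a b _ _ ha hb =>
          obtain ⟨p, ha⟩ := ha
          obtain ⟨q, hb⟩ := hb
          exact ⟨p + q, wedge_mul_mem ha hb⟩
      obtain ⟨p, hp⟩ := hdeg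
      have hall : y ∈ allowedDots F c.2.2 := by
        have : y ∈ Submodule.span F (Submonoid.closure
          {x : Dots F c.2.1 | ∃ t : c.2.1.1, IsIncreasingEnd c.2.2 t ∧ x = dot t} :
            Set (Dots F c.2.1)) := Submodule.subset_span hy
        rw [← Algebra.adjoin_eq_span] at this
        exact this
      refine ⟨⟨single c y, single_mem hc hall⟩, ?_, rfl⟩
      exact Submodule.mem_iSup_of_mem
        (p := fun p : ℤ × ℤ => (gr F n k p.1 p.2).comap (nilSubalgebra F n k).val.toLinearMap)
        ((p : ℤ), -2 * ((p : ℤ) + crossings c.2.2) + (total c.2.1 - total c.1))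
        (single_mem_gr hp)
    | zero => exact ⟨0, zero_mem _, (single_zero c).symm⟩
    | add a b _ _ ha hb =>
      obtain ⟨r, hr, er⟩ := ha
      obtain ⟨s, hs, es⟩ := hb
      exact ⟨r + s, add_mem hr hs, by rw [single_add, ← er, ← es]; rfl⟩
    | smul a b _ hb =>
      obtain ⟨r, hr, er⟩ := hb
      exact ⟨a • r, Submodule.smul_mem _ _ hr, by rw [single_smul, ← er]; rfl⟩
  rw [eq_top_iff]
  intro f _
  have hsum : ∀ c : Diagram n k, ∃ r ∈ U, (r : AllStrands F n k) = single c (f.1 c) := by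
    intro c
    by_cases hc : Nondecreasing c.2.2
    · exact key c hc _ (f.2 c.1 c.2.1 c.2.2).2
    · refine ⟨0, zero_mem _, ?_⟩
      have h0 : f.1 c = 0 := (f.2 c.1 c.2.1 c.2.2).1 hc
      rw [h0, single_zero]; rfl
  choose r hr er using hsum
  have : f = ∑ c, r c := by
    apply Subtype.ext
    rw [AddSubmonoidClass.coe_finsetSum, Finset.sum_congr rfl fun c _ => er c, sum_single]
  rw [this]
  exact sum_mem fun c _ => hr c

end AllStrands

end

section

variable (F : Type u) [Field F] (n k : ℕ)

/-- The algebra `R(n;k)^nil` over the field `F`. -/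
def RNil : Type u := nilSubalgebra F n k

noncomputable instance : Ring (RNil F n k) := inferInstanceAs (Ring (nilSubalgebra F n k))

noncomputable instance : Algebra F (RNil F n k) :=
  inferInstanceAs (Algebra F (nilSubalgebra F n k))

/-- The inclusion of `R(n;k)^nil` in `AllStrands F n k`. -/
noncomputable def RNil.incl : RNil F n k →ₐ[F] AllStrands F n k := (nilSubalgebra F n k).val

/-- `R(n;k)^nil` as a `q`-graded dg algebra. -/
noncomputable instance : QDGAlgebra F (RNil F n k) where
  gr i j := (AllStrands.gr F n k i j).comap (RNil.incl F n k).toLinearMap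
  isInternal := by
    refine isInternal_of_detect _
      (fun p => (AllStrands.proj p.1 p.2).comp (RNil.incl F n k).toLinearMap) ?_ ?_
      (AllStrands.iSup_gr F n k)
    · intro p x hx h
      apply Subtype.ext
      exact (AllStrands.proj_same hx).symm.trans h
    · intro p p' hne x hx
      exact AllStrands.proj_ne hne hx
  one_mem := AllStrands.gr_one_mem
  mul_mem {_ _ _ _ a b} ha hb := AllStrands.gr_mul_mem (f := RNil.incl F n k a)
    (g := RNil.incl F n k b) ha hb
  d := LinearMap.codRestrict (Subalgebra.toSubmodule (nilSubalgebra F n k))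
    (AllStrands.diff.comp (RNil.incl F n k).toLinearMap) fun f => AllStrands.diff_mem f.2
  d_mem {_ _ a} ha := AllStrands.gr_diff_mem (f := RNil.incl F n k a) ha
  d_d f := Subtype.ext (AllStrands.diff_diff (RNil.incl F n k f))
  leibniz {i j a} b ha := Subtype.ext (AllStrands.leibniz (f := RNil.incl F n k a)
    (RNil.incl F n k b) ha)

variable {n k}

theorem idem_mem (S : KSubset n k) : (AllStrands.idem S) ∈ nilSubalgebra F n k := by
  rw [AllStrands.idem_eq_single]
  exact AllStrands.single_mem (fun s => le_rfl) (one_mem _)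

/-- The idempotent `1_S = (S, S, id, ∅)` of `R(n;k)^nil`. -/
noncomputable def oneAt (S : KSubset n k) : RNil F n k := ⟨AllStrands.idem S, idem_mem F S⟩

theorem oneAt_mul_self (S : KSubset n k) : oneAt F S * oneAt F S = oneAt F S :=
  Subtype.ext (AllStrands.idem_mul_idem S)

theorem oneAt_mem (S : KSubset n k) : oneAt F S ∈ QDGAlgebra.gr (F := F) (A := RNil F n k) 0 0 := by
  change AllStrands.idem S ∈ AllStrands.gr F n k 0 0
  rw [AllStrands.idem_eq_single]
  have := AllStrands.single_mem_gr (c := (⟨S, S, Equiv.refl _⟩ : Diagram n k))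
    (wedge_one_mem (F := F) (T := S))
  simpa [crossings_refl] using this

theorem d_oneAt (S : KSubset n k) : QDGAlgebra.d (F := F) (oneAt F S) = 0 :=
  Subtype.ext (AllStrands.diff_idem S)

end

end NilStrands

theorem isInternal_reindex {F M ι : Type*} [Field F] [AddCommGroup M] [Module F M]
    [DecidableEq ι] {G : ι → Submodule F M} (h : DirectSum.IsInternal G) (e : ι ≃ ι) :
    DirectSum.IsInternal fun i => G (e i) := by
  rw [DirectSum.isInternal_submodule_iff_iSupIndep_and_iSup_eq_top] at h ⊢
  exact ⟨h.1.comp e.injective, by rw [← h.2]; exact e.iSup_comp (g := G)⟩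

theorem isInternal_prod {F M N ι : Type*} [Field F] [AddCommGroup M] [Module F M]
    [AddCommGroup N] [Module F N] [DecidableEq ι] {G : ι → Submodule F M} {H : ι → Submodule F N}
    (hG : DirectSum.IsInternal G) (hH : DirectSum.IsInternal H) :
    DirectSum.IsInternal fun i => (G i).prod (H i) := by
  rw [DirectSum.isInternal_submodule_iff_iSupIndep_and_iSup_eq_top] at hG hH ⊢
  constructor
  · rw [iSupIndep_def]
    intro i
    rw [Submodule.disjoint_def]
    rintro ⟨x, y⟩ hxy h'
    have hle : ⨆ j, ⨆ (_ : j ≠ i), (G j).prod (H j) ≤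
        (⨆ j, ⨆ (_ : j ≠ i), G j).prod (⨆ j, ⨆ (_ : j ≠ i), H j) := by
      refine iSup_le fun j => iSup_le fun hj => Submodule.prod_mono ?_ ?_
      · exact le_iSup₂_of_le j hj le_rfl
      · exact le_iSup₂_of_le j hj le_rfl
    have h2 := hle h'
    have hx := (Submodule.disjoint_def.1 (iSupIndep_def.1 hG.1 i)) x hxy.1 h2.1
    have hy := (Submodule.disjoint_def.1 (iSupIndep_def.1 hH.1 i)) y hxy.2 h2.2
    rw [hx, hy]; rfl
  · rw [eq_top_iff]
    rintro ⟨x, y⟩ -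
    have hx : LinearMap.inl F M N x ∈ ⨆ i, (G i).prod (H i) := by
      have : (⨆ i, G i) ≤ (⨆ i, (G i).prod (H i)).comap (LinearMap.inl F M N) :=
        iSup_le fun i z hz => Submodule.mem_iSup_of_mem i ⟨hz, zero_mem _⟩
      exact this (hG.2 ▸ Submodule.mem_top)
    have hy : LinearMap.inr F M N y ∈ ⨆ i, (G i).prod (H i) := by
      have : (⨆ i, H i) ≤ (⨆ i, (G i).prod (H i)).comap (LinearMap.inr F M N) :=
        iSup_le fun i z hz => Submodule.mem_iSup_of_mem i ⟨zero_mem _, hz⟩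
      exact this (hH.2 ▸ Submodule.mem_top)
    have := add_mem hx hy
    simpa using this

section Modules

variable (F : Type u) [Field F] (A : Type u) [Ring A] [Algebra F A] [QDGAlgebra F A]

/-- A finitely generated `q`-graded right dg module `M = ⨁ M^i_j` over the `q`-graded dg
algebra `A`. Right multiplication by `a` is the action of `op a : Aᵐᵒᵖ`. -/
structure FinDGModule : Type (u + 1) where
  carrier : Type u
  [addCommGroup : AddCommGroup carrier]
  [module : Module F carrier]
  [rightModule : Module Aᵐᵒᵖ carrier]
  [isScalarTower : IsScalarTower F Aᵐᵒᵖ carrier]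
  /-- `gr i j` is `M^i_j`. -/
  gr : ℤ → ℤ → Submodule F carrier
  isInternal : DirectSum.IsInternal fun p : ℤ × ℤ => gr p.1 p.2
  smul_mem : ∀ {i j i' j' : ℤ} {x : carrier} {a : A}, x ∈ gr i j →
    a ∈ QDGAlgebra.gr (F := F) i' j' → MulOpposite.op a • x ∈ gr (i + i') (j + j')
  /-- the differential -/
  d : carrier →ₗ[F] carrier
  d_mem : ∀ {i j : ℤ} {x : carrier}, x ∈ gr i j → d x ∈ gr (i + 1) j
  d_d : ∀ x : carrier, d (d x) = 0
  leibniz : ∀ {i j : ℤ} {x : carrier} (a : A), x ∈ gr i j →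
    d (MulOpposite.op a • x) = MulOpposite.op a • d x +
      i.negOnePow • (MulOpposite.op (QDGAlgebra.d (F := F) a) • x)
  finite : Module.Finite Aᵐᵒᵖ carrier

namespace FinDGModule

attribute [instance] addCommGroup module rightModule isScalarTower finite

variable {F A}

/-- Morphisms of dg modules: `A`-linear maps that preserve both gradings and commute with the
differentials. -/
@[ext]
structure Hom (M N : FinDGModule F A) where
  toLin : M.carrier →ₗ[Aᵐᵒᵖ] N.carrier
  map_mem : ∀ {i j : ℤ} {x : M.carrier}, x ∈ M.gr i j → toLin x ∈ N.gr i j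
  map_d : ∀ x : M.carrier, toLin (M.d x) = N.d (toLin x)

instance : Category (FinDGModule F A) where
  Hom := Hom
  id M := ⟨LinearMap.id, fun h => h, fun _ => rfl⟩
  comp f g := ⟨g.toLin.comp f.toLin, fun h => g.map_mem (f.map_mem h), fun x => by
    rw [LinearMap.comp_apply, LinearMap.comp_apply, f.map_d, g.map_d]⟩

theorem hom_ext {M N : FinDGModule F A} {f g : M ⟶ N}
    (h : ∀ x : M.carrier, Hom.toLin f x = Hom.toLin g x) : f = g :=
  Hom.ext (LinearMap.ext h)

@[simp] theorem comp_toLin {M N P : FinDGModule F A} (f : M ⟶ N) (g : N ⟶ P) (x : M.carrier) :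
    Hom.toLin (f ≫ g) x = Hom.toLin g (Hom.toLin f x) := rfl

@[simp] theorem id_toLin (M : FinDGModule F A) (x : M.carrier) : Hom.toLin (𝟙 M) x = x := rfl

/-- The cohomology `ker d / im d` of a dg module. -/
abbrev cohomology (M : FinDGModule F A) : Type u :=
  LinearMap.ker M.d ⧸ (LinearMap.range M.d).submoduleOf (LinearMap.ker M.d)

/-- A morphism restricted to cocycles. -/
def Hom.onCocycles {M N : FinDGModule F A} (f : Hom M N) :
    LinearMap.ker M.d →ₗ[F] LinearMap.ker N.d :=
  (f.toLin.restrictScalars F).restrict fun x hx => by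
    rw [LinearMap.mem_ker] at hx ⊢
    change N.d (f.toLin x) = 0
    rw [← f.map_d, hx, map_zero]

/-- The map induced on cohomology. -/
def Hom.onCohomology {M N : FinDGModule F A} (f : Hom M N) : M.cohomology →ₗ[F] N.cohomology :=
  Submodule.mapQ _ _ f.onCocycles (by
    rintro x ⟨y, hy⟩
    exact ⟨f.toLin y, by rw [← f.map_d, hy]; rfl⟩)

variable (F A) in
/-- The quasi-isomorphisms: morphisms that are bijective on cohomology. -/
def quasiIso : MorphismProperty (FinDGModule F A) :=
  fun _ _ f => Function.Bijective (Hom.onCohomology f)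

theorem quasiIso_iff {M N : FinDGModule F A} (f : M ⟶ N) :
    quasiIso F A f ↔
      (∀ x, M.d x = 0 → Hom.toLin f x ∈ LinearMap.range N.d → x ∈ LinearMap.range M.d) ∧
      (∀ y, N.d y = 0 → ∃ x, M.d x = 0 ∧ y - Hom.toLin f x ∈ LinearMap.range N.d) := by
  have mk0 : ∀ (P : FinDGModule F A) (z : LinearMap.ker P.d),
      (Submodule.Quotient.mk z : P.cohomology) = 0 ↔ (z : P.carrier) ∈ LinearMap.range P.d :=
    fun P z => Submodule.Quotient.mk_eq_zero _
  have mkeq : ∀ (P : FinDGModule F A) (z w : LinearMap.ker P.d),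
      (Submodule.Quotient.mk z : P.cohomology) = Submodule.Quotient.mk w ↔
        (z : P.carrier) - w ∈ LinearMap.range P.d :=
    fun P z w => Submodule.Quotient.eq _
  have hmk : ∀ z : LinearMap.ker M.d, Hom.onCohomology f (Submodule.Quotient.mk z) =
      Submodule.Quotient.mk (Hom.onCocycles f z) := fun z => rfl
  have hval : ∀ z : LinearMap.ker M.d, (Hom.onCocycles f z : N.carrier) = Hom.toLin f z :=
    fun z => rfl
  refine and_congr ?_ ?_
  · rw [← LinearMap.ker_eq_bot, LinearMap.ker_eq_bot']
    constructor
    · intro h x hx hfx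
      exact (mk0 M ⟨x, hx⟩).1 (h _ (by rw [hmk, mk0, hval]; exact hfx))
    · intro h z hz
      obtain ⟨z, rfl⟩ := Submodule.Quotient.mk_surjective _ z
      rw [hmk, mk0, hval] at hz
      exact (mk0 M z).2 (h z.1 z.2 hz)
  · constructor
    · intro h y hy
      obtain ⟨z, hz⟩ := h (Submodule.Quotient.mk ⟨y, hy⟩)
      obtain ⟨z, rfl⟩ := Submodule.Quotient.mk_surjective _ z
      rw [hmk] at hz
      exact ⟨z.1, z.2, (mkeq N ⟨y, hy⟩ _).1 hz.symm⟩
    · intro h z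
      obtain ⟨z, rfl⟩ := Submodule.Quotient.mk_surjective _ z
      obtain ⟨x, hx, hxz⟩ := h z.1 z.2
      refine ⟨Submodule.Quotient.mk ⟨x, hx⟩, ?_⟩
      rw [hmk]
      exact ((mkeq N z _).2 hxz).symm

/-- The cohomological shift `M[a]`, with `M[a]^i_j = M^{i+a}_j` and differential `(-1)^a d`. -/
def shift (M : FinDGModule F A) (a : ℤ) : FinDGModule F A where
  carrier := M.carrier
  gr i j := M.gr (i + a) j
  isInternal := isInternal_reindex M.isInternal ((Equiv.addRight a).prodCongr (Equiv.refl ℤ))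
  smul_mem {i j i' j' x b} hx hb := by
    have := M.smul_mem hx hb
    rwa [add_right_comm] at this
  d := a.negOnePow • M.d
  d_mem {i j x} hx := by
    have h := M.d_mem hx
    rw [add_right_comm] at h
    rw [LinearMap.smul_apply, Units.smul_def]
    exact zsmul_mem h _
  d_d x := by simp [M.d_d]
  leibniz {i j x} b hx := by
    rw [LinearMap.smul_apply, M.leibniz b hx, smul_add, LinearMap.smul_apply, smul_smul,
      smul_comm (MulOpposite.op b)]
    congr 2
    rw [Int.negOnePow_add, mul_comm, mul_assoc, ← Int.negOnePow_add, ← two_mul,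
      Int.negOnePow_two_mul, mul_one]
  finite := M.finite

/-- The `q`-grading shift `M{b}`, with `M{b}^i_j = M^i_{j-b}`. -/
def qshift (M : FinDGModule F A) (b : ℤ) : FinDGModule F A where
  carrier := M.carrier
  gr i j := M.gr i (j - b)
  isInternal := isInternal_reindex M.isInternal ((Equiv.refl ℤ).prodCongr (Equiv.subRight b))
  smul_mem {i j i' j' x c} hx hc := by
    have := M.smul_mem hx hc
    rwa [sub_add_eq_add_sub] at this
  d := M.d
  d_mem hx := M.d_mem hx
  d_d := M.d_d
  leibniz b hx := M.leibniz b hx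
  finite := M.finite

/-- The functor `M ↦ M[a]`. -/
def shiftFun (a : ℤ) : FinDGModule F A ⥤ FinDGModule F A where
  obj M := M.shift a
  map {M N} f := Hom.mk (M := M.shift a) (N := N.shift a) (Hom.toLin (M := M) (N := N) f)
    (fun h => Hom.map_mem (M := M) (N := N) f h)
    (fun (x : M.carrier) => by
      change Hom.toLin (M := M) (N := N) f (a.negOnePow • M.d x) =
        a.negOnePow • N.d (Hom.toLin (M := M) (N := N) f x)
      rw [Units.smul_def, Units.smul_def, map_zsmul, Hom.map_d (M := M) (N := N) f])

/-- The functor `M ↦ M{b}`. -/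
def qshiftFun (b : ℤ) : FinDGModule F A ⥤ FinDGModule F A where
  obj M := M.qshift b
  map {M N} f := Hom.mk (M := M.qshift b) (N := N.qshift b) (Hom.toLin (M := M) (N := N) f)
    (fun h => Hom.map_mem (M := M) (N := N) f h) (Hom.map_d (M := M) (N := N) f)

/-- An isomorphism between dg modules with the same underlying module. -/
def isoOfLinearEquiv {M N : FinDGModule F A} (e : M.carrier ≃ₗ[Aᵐᵒᵖ] N.carrier)
    (hgr : ∀ {i j x}, x ∈ M.gr i j ↔ e x ∈ N.gr i j) (hd : ∀ x, e (M.d x) = N.d (e x)) :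
    M ≅ N where
  hom := ⟨e.toLinearMap, fun h => hgr.1 h, hd⟩
  inv := ⟨e.symm.toLinearMap, fun {i j x} h => hgr.2 (by
      change e (e.symm x) ∈ _
      rwa [e.apply_symm_apply]), fun x => by
    change e.symm (N.d x) = M.d (e.symm x)
    rw [LinearEquiv.symm_apply_eq, hd, e.apply_symm_apply]⟩
  hom_inv_id := hom_ext fun x => e.symm_apply_apply x
  inv_hom_id := hom_ext fun x => e.apply_symm_apply x

/-- `M[0] ≅ M`. -/
def shiftZero (M : FinDGModule F A) : M.shift 0 ≅ M :=
  isoOfLinearEquiv (M := M.shift 0) (N := M) (LinearEquiv.refl Aᵐᵒᵖ M.carrier)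
    (fun {i j x} => by
      change x ∈ M.gr (i + 0) j ↔ x ∈ M.gr i j
      rw [add_zero])
    (fun x => by
      change Int.negOnePow 0 • M.d x = M.d x
      rw [Int.negOnePow_zero, one_smul])

/-- `M[a + b] ≅ M[a][b]`. -/
def shiftAdd (M : FinDGModule F A) (a b : ℤ) : M.shift (a + b) ≅ (M.shift a).shift b :=
  isoOfLinearEquiv (M := M.shift (a + b)) (N := (M.shift a).shift b)
    (LinearEquiv.refl Aᵐᵒᵖ M.carrier)
    (fun {i j x} => by
      change x ∈ M.gr (i + (a + b)) j ↔ x ∈ M.gr (i + b + a) j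
      rw [add_comm a b, add_assoc])
    (fun x => by
      change (a + b).negOnePow • M.d x = b.negOnePow • (a.negOnePow • M.d x)
      rw [smul_smul, Int.negOnePow_add, mul_comm])

theorem eqToHom_shift (M : FinDGModule F A) {a b : ℤ} (h : a = b)
    (h' : M.shift a = M.shift b) (x : M.carrier) : Hom.toLin (eqToHom h') x = x := by
  subst h; rfl

noncomputable instance : HasShift (FinDGModule F A) ℤ :=
  hasShiftMk (FinDGModule F A) ℤ
    { F := shiftFun
      zero := NatIso.ofComponents (fun M => M.shiftZero) fun _ => rfl
      add := fun a b => NatIso.ofComponents (fun M => M.shiftAdd a b) fun _ => rfl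
      assoc_hom_app := fun a b c M => hom_ext fun x =>
        (eqToHom_shift M (add_assoc a b c) _ x).symm
      zero_add_hom_app := fun a M => hom_ext fun x =>
        (eqToHom_shift M (zero_add a) _ x).symm
      add_zero_hom_app := fun a M => hom_ext fun x =>
        (eqToHom_shift M (add_zero a) _ x).symm }

instance : (quasiIso F A).IsCompatibleWithShift ℤ where
  condition a := by
    ext M N f
    change quasiIso F A ((shiftFun a).map f) ↔ quasiIso F A f
    rw [quasiIso_iff, quasiIso_iff]
    have hd : ∀ (P : FinDGModule F A) (x : P.carrier), (P.shift a).d x = 0 ↔ P.d x = 0 := by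
      intro P x
      change a.negOnePow • P.d x = 0 ↔ _
      rw [smul_eq_zero_iff_eq]
    have hr : ∀ (P : FinDGModule F A) (x : P.carrier),
        x ∈ LinearMap.range (P.shift a).d ↔ x ∈ LinearMap.range P.d := by
      intro P x
      constructor
      · rintro ⟨y, hy⟩
        change P.carrier at y
        refine ⟨a.negOnePow • y, ?_⟩
        rw [Units.smul_def, map_zsmul]
        exact hy
      · rintro ⟨y, hy⟩
        refine ⟨a.negOnePow • y, ?_⟩
        change a.negOnePow • P.d (a.negOnePow • y) = x
        rw [Units.smul_def, Units.smul_def, map_zsmul, hy, ← Units.smul_def, ← Units.smul_def,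
          smul_smul, Int.units_mul_self, one_smul]
    refine and_congr ?_ ?_
    · refine forall_congr' fun x => ?_
      exact imp_congr (hd M x) (imp_congr (hr N _) (hr M x))
    · refine forall_congr' fun y => imp_congr (hd N y) (exists_congr fun x => ?_)
      exact and_congr (hd M x) (hr N _)

/-- The mapping cone `M[1] ⊕ N` of `f : M ⟶ N`, with differential
`(x, y) ↦ (-d x, f x + d y)`. -/
def cone {M N : FinDGModule F A} (f : M ⟶ N) : FinDGModule F A where
  carrier := M.carrier × N.carrier
  gr i j := (M.gr (i + 1) j).prod (N.gr i j)
  isInternal := isInternal_prod (M.shift 1).isInternal N.isInternal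
  smul_mem {i j i' j' x a} hx ha := ⟨(M.shift 1).smul_mem hx.1 ha, N.smul_mem hx.2 ha⟩
  d := LinearMap.prod (-(M.d ∘ₗ LinearMap.fst F M.carrier N.carrier))
    ((Hom.toLin f).restrictScalars F ∘ₗ LinearMap.fst F M.carrier N.carrier +
      N.d ∘ₗ LinearMap.snd F M.carrier N.carrier)
  d_mem {i j x} hx := ⟨neg_mem (M.d_mem hx.1),
    add_mem (Hom.map_mem f hx.1) (N.d_mem hx.2)⟩
  d_d x := by
    refine Prod.ext ?_ ?_
    · change -(M.d (-(M.d x.1))) = 0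
      rw [map_neg, M.d_d, neg_zero, neg_zero]
    · change Hom.toLin f (-(M.d x.1)) + N.d (Hom.toLin f x.1 + N.d x.2) = 0
      rw [map_neg, Hom.map_d f, map_add, N.d_d, add_zero, neg_add_cancel]
  leibniz {i j x} a hx := by
    refine Prod.ext ?_ ?_
    · change -(M.d (MulOpposite.op a • x.1)) = MulOpposite.op a • (-(M.d x.1)) +
        i.negOnePow • (MulOpposite.op (QDGAlgebra.d (F := F) a) • x.1)
      rw [M.leibniz a hx.1, Int.negOnePow_succ, neg_add, smul_neg, Units.neg_smul, neg_neg]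
    · change Hom.toLin f (MulOpposite.op a • x.1) + N.d (MulOpposite.op a • x.2) =
        MulOpposite.op a • (Hom.toLin f x.1 + N.d x.2) +
        i.negOnePow • (MulOpposite.op (QDGAlgebra.d (F := F) a) • x.2)
      rw [N.leibniz a hx.2, map_smul, smul_add, add_assoc]
  finite := inferInstanceAs (Module.Finite Aᵐᵒᵖ (M.carrier × N.carrier))

/-- The inclusion `N ⟶ cone f`. -/
def coneInr {M N : FinDGModule F A} (f : M ⟶ N) : N ⟶ cone f :=
  Hom.mk (N := cone f) (LinearMap.inr Aᵐᵒᵖ M.carrier N.carrier)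
    (fun h => ⟨zero_mem _, h⟩)
    (fun x => by
      refine Prod.ext ?_ ?_
      · change 0 = -(M.d 0)
        rw [map_zero, neg_zero]
      · change N.d x = Hom.toLin f 0 + N.d x
        rw [map_zero, zero_add])

/-- The projection `cone f ⟶ M[1]`. -/
def coneFst {M N : FinDGModule F A} (f : M ⟶ N) : cone f ⟶ M⟦(1 : ℤ)⟧ :=
  show Hom (cone f) (M.shift 1) from
  Hom.mk (M := cone f) (N := M.shift 1) (LinearMap.fst Aᵐᵒᵖ M.carrier N.carrier)
    (fun h => h.1)
    (fun x => by
      change -(M.d x.1) = Int.negOnePow 1 • M.d x.1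
      rw [Int.negOnePow_one, Units.neg_smul, one_smul])

/-- The standard triangle `M ⟶ N ⟶ cone f ⟶ M[1]`. -/
noncomputable def coneTriangle {M N : FinDGModule F A} (f : M ⟶ N) :
    Pretriangulated.Triangle (FinDGModule F A) :=
  Pretriangulated.Triangle.mk f (coneInr f) (coneFst f)

/-- The dg module `P = e A` for a closed idempotent `e` of bidegree `(0, 0)`. -/
noncomputable def ofIdempotent (e : A) (he : e * e = e) (hgr : e ∈ QDGAlgebra.gr (F := F) 0 0)
    (hd : QDGAlgebra.d (F := F) e = 0) : FinDGModule F A where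
  carrier := Submodule.span Aᵐᵒᵖ {e}
  gr i j := (QDGAlgebra.gr i j).comap ((Submodule.span Aᵐᵒᵖ {e}).subtype.restrictScalars F)
  isInternal := by
    have hmem : ∀ b : A, e * b ∈ Submodule.span Aᵐᵒᵖ {e} := fun b =>
      Submodule.mem_span_singleton.2 ⟨MulOpposite.op b, rfl⟩
    have h := QDGAlgebra.isInternal (F := F) (A := A)
    rw [DirectSum.isInternal_submodule_iff_iSupIndep_and_iSup_eq_top] at h ⊢
    constructor
    · rw [iSupIndep_def]
      intro p
      rw [Submodule.disjoint_def]
      intro x hx hx'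
      refine Subtype.ext (Submodule.disjoint_def.1 (iSupIndep_def.1 h.1 p) x.1 hx ?_)
      have hle : ⨆ q, ⨆ (_ : q ≠ p), (QDGAlgebra.gr (F := F) q.1 q.2).comap
          ((Submodule.span Aᵐᵒᵖ {e}).subtype.restrictScalars F) ≤
          (⨆ q, ⨆ (_ : q ≠ p), QDGAlgebra.gr (F := F) q.1 q.2).comap
          ((Submodule.span Aᵐᵒᵖ {e}).subtype.restrictScalars F) :=
        iSup_le fun q => iSup_le fun hq => Submodule.comap_mono (le_iSup₂_of_le q hq le_rfl)
      exact hle hx'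
    · rw [eq_top_iff]
      rintro ⟨x, hx⟩ -
      have hex : e * x = x := by
        obtain ⟨b, rfl⟩ := Submodule.mem_span_singleton.1 hx
        change e * (e * b.unop) = e * b.unop
        rw [← mul_assoc, he]
      have key : ∀ y : A, (⟨e * y, hmem y⟩ : Submodule.span Aᵐᵒᵖ {e}) ∈
          ⨆ p : ℤ × ℤ, (QDGAlgebra.gr (F := F) p.1 p.2).comap
            ((Submodule.span Aᵐᵒᵖ {e}).subtype.restrictScalars F) := by
        intro y
        have hy : y ∈ ⨆ p : ℤ × ℤ, QDGAlgebra.gr (F := F) (A := A) p.1 p.2 :=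
          h.2 ▸ Submodule.mem_top
        induction hy using Submodule.iSup_induction' with
        | mem p z hz =>
          refine Submodule.mem_iSup_of_mem (p := fun p : ℤ × ℤ =>
            (QDGAlgebra.gr (F := F) p.1 p.2).comap
              ((Submodule.span Aᵐᵒᵖ {e}).subtype.restrictScalars F)) p ?_
          have := QDGAlgebra.mul_mem hgr hz
          rwa [zero_add, zero_add] at this
        | zero =>
          have h0 : (⟨e * 0, hmem 0⟩ : Submodule.span Aᵐᵒᵖ {e}) = 0 :=
            Subtype.ext (mul_zero e)
          rw [h0]
          exact zero_mem _
        | add z w _ _ hz hw =>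
          convert add_mem hz hw using 1
          exact Subtype.ext (mul_add e z w)
      convert key x using 1
      exact Subtype.ext hex.symm
  smul_mem hx ha := QDGAlgebra.mul_mem hx ha
  d := LinearMap.restrict (p := (Submodule.span Aᵐᵒᵖ {e}).restrictScalars F)
    (q := (Submodule.span Aᵐᵒᵖ {e}).restrictScalars F) QDGAlgebra.d (by
      intro x hx
      obtain ⟨b, rfl⟩ := Submodule.mem_span_singleton.1 hx
      refine Submodule.mem_span_singleton.2
        ⟨MulOpposite.op (QDGAlgebra.d (F := F) b.unop), ?_⟩
      change e * _ = QDGAlgebra.d (F := F) (e * b.unop)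
      rw [QDGAlgebra.leibniz _ hgr, hd, zero_mul, zero_add, Int.negOnePow_zero, one_smul]
      rfl)
  d_mem hx := QDGAlgebra.d_mem hx
  d_d x := Subtype.ext (QDGAlgebra.d_d x.1)
  leibniz a hx := Subtype.ext (QDGAlgebra.leibniz a hx)
  finite := Module.Finite.iff_fg.2 (Submodule.fg_span_singleton e)

end FinDGModule

end Modules

section KZero

variable (F : Type u) [Field F] (A : Type u) [Ring A] [Algebra F A] [QDGAlgebra F A]

/-- The derived category of finitely generated `q`-graded right dg `A`-modules: the
localization of the category of such dg modules at the quasi-isomorphisms. -/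
abbrev DerivedCat := (FinDGModule.quasiIso F A).Localization

namespace DerivedCat

/-- The localization functor. -/
abbrev Q : FinDGModule F A ⥤ DerivedCat F A := (FinDGModule.quasiIso F A).Q

/-- The distinguished triangles of the derived category: those isomorphic to the image of
a standard triangle `M ⟶ N ⟶ cone f ⟶ M[1]`. -/
def distinguished : Set (Pretriangulated.Triangle (DerivedCat F A)) :=
  {T | ∃ (M N : FinDGModule F A) (f : M ⟶ N),
    Nonempty (T ≅ (Q F A).mapTriangle.obj (FinDGModule.coneTriangle f))}

end DerivedCat

/-- The relations `[Y] = [X] + [Z]` for all distinguished triangles `X ⟶ Y ⟶ Z ⟶ X[1]`. -/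
def KRelations : AddSubgroup (FreeAbelianGroup (DerivedCat F A)) :=
  AddSubgroup.closure {x | ∃ T ∈ DerivedCat.distinguished F A,
    x = FreeAbelianGroup.of T.obj₂ - (FreeAbelianGroup.of T.obj₁ + FreeAbelianGroup.of T.obj₃)}

/-- The Grothendieck group `K₀` of the derived category of finitely generated `q`-graded right
dg `A`-modules. -/
def KZero : Type (u + 1) := FreeAbelianGroup (DerivedCat F A) ⧸ KRelations F A

noncomputable instance : AddCommGroup (KZero F A) :=
  inferInstanceAs (AddCommGroup (FreeAbelianGroup (DerivedCat F A) ⧸ KRelations F A))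

namespace KZero

variable {F A}

/-- The class `[X]` of an object of the derived category. -/
def cls (X : DerivedCat F A) : KZero F A :=
  QuotientAddGroup.mk' (KRelations F A) (FreeAbelianGroup.of X)

theorem cls_triangle {T : Pretriangulated.Triangle (DerivedCat F A)}
    (hT : T ∈ DerivedCat.distinguished F A) : cls T.obj₂ = cls T.obj₁ + cls T.obj₃ := by
  have h : QuotientAddGroup.mk' (KRelations F A) (FreeAbelianGroup.of T.obj₂ -
      (FreeAbelianGroup.of T.obj₁ + FreeAbelianGroup.of T.obj₃)) = 0 :=
    (QuotientAddGroup.eq_zero_iff _).2 (AddSubgroup.subset_closure ⟨T, hT, rfl⟩)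
  rw [map_sub, map_add] at h
  exact sub_eq_zero.1 h

theorem cls_cone {M N : FinDGModule F A} (f : M ⟶ N) :
    cls ((DerivedCat.Q F A).obj N) = cls ((DerivedCat.Q F A).obj M) +
      cls ((DerivedCat.Q F A).obj (FinDGModule.cone f)) :=
  cls_triangle (T := (DerivedCat.Q F A).mapTriangle.obj (FinDGModule.coneTriangle f))
    ⟨M, N, f, ⟨Iso.refl _⟩⟩

theorem distinguished_iso₂ {T : Pretriangulated.Triangle (DerivedCat F A)}
    (hT : T ∈ DerivedCat.distinguished F A) {Y : DerivedCat F A} (e : T.obj₂ ≅ Y) :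
    Pretriangulated.Triangle.mk (T.mor₁ ≫ e.hom) (e.inv ≫ T.mor₂) T.mor₃ ∈
      DerivedCat.distinguished F A := by
  obtain ⟨M, N, f, ⟨i⟩⟩ := hT
  refine ⟨M, N, f, ⟨Pretriangulated.Triangle.isoMk _ T (Iso.refl T.obj₁) e.symm
    (Iso.refl T.obj₃) ?_ ?_ ?_ ≪≫ i⟩⟩
  · change (T.mor₁ ≫ e.hom) ≫ e.inv = 𝟙 T.obj₁ ≫ T.mor₁
    rw [Category.assoc, e.hom_inv_id, Category.comp_id, Category.id_comp]
  · change (e.inv ≫ T.mor₂) ≫ 𝟙 T.obj₃ = e.inv ≫ T.mor₂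
    rw [Category.comp_id]
  · change T.mor₃ ≫ (shiftFunctor _ (1 : ℤ)).map (𝟙 T.obj₁) = 𝟙 T.obj₃ ≫ T.mor₃
    rw [CategoryTheory.Functor.map_id, Category.comp_id, Category.id_comp]

theorem cls_iso {X Y : DerivedCat F A} (e : X ≅ Y) : cls X = cls Y := by
  obtain ⟨M, rfl⟩ : ∃ M : FinDGModule F A, X = (DerivedCat.Q F A).obj M :=
    ⟨X.as.obj, rfl⟩
  have h0 := cls_cone (𝟙 M)
  have hY := cls_triangle (distinguished_iso₂
    (T := (DerivedCat.Q F A).mapTriangle.obj (FinDGModule.coneTriangle (𝟙 M)))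
    ⟨M, M, 𝟙 M, ⟨Iso.refl _⟩⟩ e)
  exact h0.trans hY.symm

/-- `M ↦ M{b}` on the derived category. -/
noncomputable def qFun (b : ℤ) : DerivedCat F A ⥤ DerivedCat F A :=
  Localization.Construction.lift (FinDGModule.qshiftFun b ⋙ DerivedCat.Q F A)
    fun _ _ f hf => (FinDGModule.quasiIso F A).Q_inverts _
      (((FinDGModule.quasiIso_iff _).2 ((FinDGModule.quasiIso_iff f).1 hf)))

theorem qFun_obj (b : ℤ) (M : FinDGModule F A) :
    (qFun b).obj ((DerivedCat.Q F A).obj M) = (DerivedCat.Q F A).obj (M.qshift b) := rfl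

/-- `cone(f){b}` is the cone of `f{b}`. -/
def coneQshift {M N : FinDGModule F A} (f : M ⟶ N) (b : ℤ) :
    (FinDGModule.cone f).qshift b ≅ FinDGModule.cone ((FinDGModule.qshiftFun b).map f) :=
  FinDGModule.isoOfLinearEquiv (M := (FinDGModule.cone f).qshift b)
    (N := FinDGModule.cone ((FinDGModule.qshiftFun b).map f))
    (LinearEquiv.refl Aᵐᵒᵖ (M.carrier × N.carrier)) Iff.rfl fun _ => rfl

/-- The endomorphism `[M] ↦ [M{b}]` of `K₀`. -/
noncomputable def qEnd (b : ℤ) : AddMonoid.End (KZero F A) :=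
  QuotientAddGroup.lift (KRelations F A)
    (FreeAbelianGroup.lift fun X => cls ((qFun b).obj X)) (by
      rw [KRelations, AddSubgroup.closure_le]
      rintro _ ⟨T, ⟨M, N, f, ⟨e⟩⟩, rfl⟩
      change FreeAbelianGroup.lift _ _ = 0
      rw [map_sub, map_add, FreeAbelianGroup.lift_apply_of, FreeAbelianGroup.lift_apply_of,
        FreeAbelianGroup.lift_apply_of, sub_eq_zero]
      have e1 := cls_iso ((qFun b).mapIso (Pretriangulated.Triangle.π₁.mapIso e))
      have e2 := cls_iso ((qFun b).mapIso (Pretriangulated.Triangle.π₂.mapIso e))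
      have e3 := cls_iso ((qFun b).mapIso (Pretriangulated.Triangle.π₃.mapIso e))
      refine e2.trans (Eq.trans ?_ (congrArg₂ (· + ·) e1 e3).symm)
      refine (cls_cone ((FinDGModule.qshiftFun b).map f)).trans ?_
      rw [← cls_iso ((DerivedCat.Q F A).mapIso (coneQshift f b))]
      rfl)

theorem qEnd_cls (b : ℤ) (M : FinDGModule F A) :
    qEnd b (cls ((DerivedCat.Q F A).obj M)) = cls ((DerivedCat.Q F A).obj (M.qshift b)) :=
  FreeAbelianGroup.lift_apply_of _ _

theorem hom_ext {f g : AddMonoid.End (KZero F A)}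
    (h : ∀ M : FinDGModule F A, f (cls ((DerivedCat.Q F A).obj M)) =
      g (cls ((DerivedCat.Q F A).obj M))) : f = g :=
  QuotientAddGroup.addMonoidHom_ext _ (FreeAbelianGroup.lift_ext _ _ fun X => h X.as.obj)

/-- `b ↦ ([M] ↦ [M{b}])` as an action of `ℤ` on `K₀`. -/
noncomputable def qHom : Multiplicative ℤ →* AddMonoid.End (KZero F A) where
  toFun b := qEnd b.toAdd
  map_one' := hom_ext fun M => by
    rw [toAdd_one, qEnd_cls]
    exact cls_iso ((DerivedCat.Q F A).mapIso (FinDGModule.isoOfLinearEquiv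
      (M := M.qshift 0) (N := M) (LinearEquiv.refl Aᵐᵒᵖ M.carrier)
      (fun {i j x} => by
        change x ∈ M.gr i (j - 0) ↔ x ∈ M.gr i j
        rw [sub_zero]) fun _ => rfl))
  map_mul' b c := hom_ext fun M => by
    rw [toAdd_mul, qEnd_cls, AddMonoid.End.coe_mul, Function.comp_apply, qEnd_cls, qEnd_cls]
    exact cls_iso ((DerivedCat.Q F A).mapIso (FinDGModule.isoOfLinearEquiv
      (M := M.qshift (b.toAdd + c.toAdd)) (N := (M.qshift c.toAdd).qshift b.toAdd)
      (LinearEquiv.refl Aᵐᵒᵖ M.carrier)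
      (fun {i j x} => by
        change x ∈ M.gr i (j - (b.toAdd + c.toAdd)) ↔ x ∈ M.gr i (j - b.toAdd - c.toAdd)
        rw [sub_sub]) fun _ => rfl))

/-- `K₀` as a `ℤ[q, q⁻¹]`-module, with `q ^ b • [M] = [M{b}]`. -/
noncomputable instance : Module ℤ[T;T⁻¹] (KZero F A) :=
  Module.compHom (KZero F A)
    ((AddMonoidAlgebra.lift ℤ (AddMonoid.End (KZero F A)) ℤ qHom : ℤ[T;T⁻¹] →ₐ[ℤ] _) :
      ℤ[T;T⁻¹] →+* AddMonoid.End (KZero F A))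

theorem T_smul_cls (b : ℤ) (M : FinDGModule F A) :
    (LaurentPolynomial.T b : ℤ[T;T⁻¹]) • cls ((DerivedCat.Q F A).obj M) =
      cls ((DerivedCat.Q F A).obj (M.qshift b)) := by
  change (AddMonoidAlgebra.lift ℤ (AddMonoid.End (KZero F A)) ℤ qHom (.single b 1)) _ = _
  rw [AddMonoidAlgebra.lift_single, one_smul]
  exact qEnd_cls b M

end KZero

end KZero

namespace NilStrands

/-- The right dg module `P(S) = 1_S R(n;k)^nil`. -/
noncomputable def P (F : Type u) [Field F] {n k : ℕ} (S : KSubset n k) :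
    FinDGModule F (RNil F n k) :=
  FinDGModule.ofIdempotent (oneAt F S) (oneAt_mul_self F S) (oneAt_mem F S) (d_oneAt F S)

/-- The class `[P(S)]` in `K₀`. -/
noncomputable def clsP (F : Type u) [Field F] {n k : ℕ} (S : KSubset n k) :
    KZero F (RNil F n k) :=
  KZero.cls ((DerivedCat.Q F (RNil F n k)).obj (P F S))

/-- The free `ℤ[q, q⁻¹]`-module `V` with basis `v₋₁ = vec false`, `v₁ = vec true`. -/
abbrev V : Type := Bool → ℤ[T;T⁻¹]

/-- The basis vectors `v₋₁ = vec false` and `v₁ = vec true` of `V`. -/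
noncomputable def vec (b : Bool) : V := Pi.single b 1

/-- `V^{⊗ n}` -/
abbrev VTensor (n : ℕ) : Type := ⨂[ℤ[T;T⁻¹]] _ : Fin n, V

/-- `v(S)`, the tensor product of the `v₁` at the positions in `S` and the `v₋₁` at the other
positions. -/
noncomputable def vecOf {n k : ℕ} (S : KSubset n k) : VTensor n :=
  PiTensorProduct.tprod ℤ[T;T⁻¹] fun i => vec (decide (i ∈ S.1))

end NilStrands

/-! Only three features of the algebra matter: it is finite-dimensional, its unit is a sum of closed
idempotents `e_s` of bidegree (0, 0), and it is directed. The last means that `e_s A e_s` is the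
line spanned by `e_s`, and that for `s ≠ t` the corner `e_s A e_t` vanishes unless `h s < h t` for a
height function `h`. For such an `A` the classes of the right dg modules `e_s A` form a basis of
`K₀` over `ℤ[q, q⁻¹]` (`IsDirectedFamily.basis`).

They span. Let `M` be a dg module whose cohomology vanishes in the weights `t` (the parts `M e_t`)
outside a set `U` closed under passing to larger height. Take `s` in `U` of minimal height. A
homogeneous cocycle `x` in `M e_s` that is not a boundary gives a morphism from a shift of `e_s A`
to `M`, and `[M]` is the class of that shift plus the class of the cone. Since `e_s A` has weights
only at `s` and strictly above `s`, the cone still has no cohomology outside `U`; since `e_s A e_s`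
is a line, its generator kills exactly the class of `x`, and the cohomology in weight `s` loses
dimension (`finrank_cone_lt`). Once that cohomology is gone, `s` is removed from `U`. When `U` is
empty, `M` is acyclic and its class is 0 (`cls_mem_span_of_support`).

They are independent. For each `s` the Euler characteristic `∑ (-1)^i dim (M^i_j e_s) q^j` can be
computed from cohomology (`euler_eq`), hence depends only on the object of the derived category; it
is additive on cones (`euler_cone`) and so defines a linear form on `K₀`. On the modules `e_t A`
these forms give a unitriangular matrix.

The strand algebra is directed for `h = total` (`isDirectedFamily_oneAt`): a nondecreasing bijection
`S → T` raises the sum of the elements unless it is the identity of `S = T`, and the identity has no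
increasing strand that could carry a dot. Matching subsets with their indicator functions then
matches the basis `[P(S)]` with the basis of pure tensors of basis vectors. -/

/-! ### Projections onto the summands of a grading -/

section GradedProjection

variable {F M N ι κ : Type*} [Field F] [AddCommGroup M] [Module F M] [AddCommGroup N] [Module F N]
  [DecidableEq ι] [DecidableEq κ] {G : ι → Submodule F M} {H : κ → Submodule F N}

/-- The projection on the summand of index `i` of an internal direct sum. -/
noncomputable def DirectSum.IsInternal.proj (h : DirectSum.IsInternal G) (i : ι) : M →ₗ[F] M :=
  (G i).subtype ∘ₗ DirectSum.component F ι (fun i => G i) i ∘ₗ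
    (LinearEquiv.ofBijective (DirectSum.coeLinearMap G) h).symm.toLinearMap

namespace DirectSum.IsInternal

theorem proj_mem (h : DirectSum.IsInternal G) (i : ι) (x : M) : h.proj i x ∈ G i :=
  SetLike.coe_mem (DirectSum.component F ι (fun i => G i) i _)

theorem symm_of_mem (h : DirectSum.IsInternal G) {i : ι} {x : M} (hx : x ∈ G i) :
    (LinearEquiv.ofBijective (DirectSum.coeLinearMap G) h).symm x =
      DirectSum.lof F ι (fun i => G i) i ⟨x, hx⟩ := by
  rw [LinearEquiv.symm_apply_eq]
  exact (DirectSum.coeLinearMap_lof G i ⟨x, hx⟩).symm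

theorem proj_of_mem (h : DirectSum.IsInternal G) {i : ι} {x : M} (hx : x ∈ G i) :
    h.proj i x = x := by
  change ((DirectSum.component F ι (fun i => G i) i
    ((LinearEquiv.ofBijective (DirectSum.coeLinearMap G) h).symm x) : G i) : M) = x
  rw [symm_of_mem h hx, DirectSum.component.lof_self]

theorem proj_of_mem_ne (h : DirectSum.IsInternal G) {i j : ι} (hij : i ≠ j) {x : M}
    (hx : x ∈ G i) : h.proj j x = 0 := by
  change ((DirectSum.component F ι (fun i => G i) j
    ((LinearEquiv.ofBijective (DirectSum.coeLinearMap G) h).symm x) : G j) : M) = 0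
  rw [symm_of_mem h hx, DirectSum.component.of, dif_neg hij, ZeroMemClass.coe_zero]

theorem induction (h : DirectSum.IsInternal G) {p : M → Prop}
    (mem : ∀ i, ∀ x ∈ G i, p x) (zero : p 0) (add : ∀ x y, p x → p y → p (x + y)) (x : M) : p x := by
  have hx : x ∈ ⨆ i, G i := h.submodule_iSup_eq_top ▸ Submodule.mem_top
  exact Submodule.iSup_induction G (motive := p) hx mem zero add

/-- An element is a finite sum of its components. This lets a property such as being a boundary be
tested one degree at a time. -/
theorem mem_of_proj_mem (h : DirectSum.IsInternal G) {U : Submodule F M} {x : M}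
    (hx : ∀ i, h.proj i x ∈ U) : x ∈ U := by
  have key : x ∈ Submodule.span F (Set.range fun i => h.proj i x) := by
    clear hx
    classical
    obtain ⟨y, rfl⟩ := h.2 x
    change DirectSum.coeLinearMap G y ∈ _
    rw [DirectSum.coeLinearMap_eq_dfinsuppSum, DFinsupp.sum]
    refine Submodule.sum_mem _ fun i _ => Submodule.subset_span ⟨i, ?_⟩
    change ((DirectSum.component F ι (fun i => G i) i
      ((LinearEquiv.ofBijective (DirectSum.coeLinearMap G) h).symm
        (LinearEquiv.ofBijective (DirectSum.coeLinearMap G) h y)) : G i) : M) = _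
    rw [LinearEquiv.symm_apply_apply]
    rfl
  refine Submodule.span_le.2 ?_ key
  rintro _ ⟨i, rfl⟩
  exact hx i

/-- The map `σ` records how `f` moves degrees: `(i, j) ↦ (i + 1, j)` for a differential, the
identity for a morphism or for the action of an idempotent of bidegree (0, 0). Injectivity of `σ`
prevents two components of `x` from landing in the same degree. -/
theorem proj_map (hG : DirectSum.IsInternal G) (hH : DirectSum.IsInternal H) (f : M →ₗ[F] N)
    {σ : ι → κ} (hσ : Function.Injective σ) (hf : ∀ i, ∀ x ∈ G i, f x ∈ H (σ i)) (i : ι) (x : M) :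
    hH.proj (σ i) (f x) = f (hG.proj i x) := by
  induction x using hG.induction with
  | mem j x hx =>
    by_cases hij : j = i
    · subst hij
      rw [hH.proj_of_mem (hf j x hx), hG.proj_of_mem hx]
    · rw [hH.proj_of_mem_ne (fun e => hij (hσ e)) (hf j x hx), hG.proj_of_mem_ne hij hx, map_zero]
  | zero => simp
  | add x y hx hy => rw [map_add, map_add, hx, hy, map_add, map_add]

end DirectSum.IsInternal

end GradedProjection

/-! ### Closed idempotents, weights and their cohomology -/

section ClosedElements

variable {F : Type u} [Field F] {A : Type u} [Ring A] [Algebra F A] [QDGAlgebra F A]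

variable (F) in
/-- A closed idempotent of bidegree `(0, 0)` of a `q`-graded dg algebra. -/
structure IsClosedIdempotent (e : A) : Prop where
  mul_self : e * e = e
  mem : e ∈ QDGAlgebra.gr (F := F) 0 0
  closed : QDGAlgebra.d (F := F) e = 0

namespace FinDGModule

/-- Right multiplication by an element of `A` as an `F`-linear map. -/
noncomputable def act (M : FinDGModule F A) (a : A) : M.carrier →ₗ[F] M.carrier :=
  Algebra.lsmul F F M.carrier (MulOpposite.op a)

theorem act_apply (M : FinDGModule F A) (a : A) (x : M.carrier) :
    M.act a x = MulOpposite.op a • x := rfl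

theorem act_act (M : FinDGModule F A) (a b : A) (x : M.carrier) :
    M.act b (M.act a x) = M.act (a * b) x := by
  rw [act_apply, act_apply, act_apply, smul_smul]; rfl

theorem Hom.map_act {M N : FinDGModule F A} (f : M ⟶ N) (a : A) (x : M.carrier) :
    Hom.toLin f (M.act a x) = N.act a (Hom.toLin f x) :=
  map_smul _ _ _

/-- A morphism of dg modules as an `F`-linear map. -/
def Hom.lin {M N : FinDGModule F A} (f : M ⟶ N) : M.carrier →ₗ[F] N.carrier :=
  (Hom.toLin f).restrictScalars F

theorem act_mem (M : FinDGModule F A) {e : A} (he : IsClosedIdempotent F e) {i j : ℤ}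
    {x : M.carrier} (hx : x ∈ M.gr i j) : M.act e x ∈ M.gr i j := by
  have := M.smul_mem hx he.mem
  rwa [add_zero, add_zero] at this

/-- In the Leibniz rule the second term contains `d e = 0`. Hence each `M e` is a subcomplex and a
direct summand of `M`. -/
theorem d_act (M : FinDGModule F A) {e : A} (he : IsClosedIdempotent F e) (x : M.carrier) :
    M.d (M.act e x) = M.act e (M.d x) := by
  induction x using M.isInternal.induction with
  | mem p x hx =>
    rw [act_apply, M.leibniz e hx, he.closed, MulOpposite.op_zero, zero_smul, smul_zero, add_zero]
    rfl
  | zero => simp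
  | add x y hx hy => rw [map_add, map_add, hx, hy, map_add, map_add]

/-- The part `M e` of a dg module `M`. -/
noncomputable def weight (M : FinDGModule F A) (e : A) : Submodule F M.carrier :=
  LinearMap.ker (M.act e - LinearMap.id)

theorem mem_weight {M : FinDGModule F A} {e : A} {x : M.carrier} :
    x ∈ M.weight e ↔ M.act e x = x := by
  rw [weight, LinearMap.mem_ker, LinearMap.sub_apply, sub_eq_zero, LinearMap.id_apply]

/-- The part `M^i_j e` of a dg module `M`. -/
noncomputable def comp (M : FinDGModule F A) (e : A) (p : ℤ × ℤ) : Submodule F M.carrier :=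
  M.gr p.1 p.2 ⊓ M.weight e

/-- The projection on `M^i_j e`. -/
noncomputable def compProj (M : FinDGModule F A) (e : A) (p : ℤ × ℤ) :
    M.carrier →ₗ[F] M.carrier :=
  M.act e ∘ₗ M.isInternal.proj p

theorem compProj_apply (M : FinDGModule F A) (e : A) (p : ℤ × ℤ) (x : M.carrier) :
    M.compProj e p x = M.act e (M.isInternal.proj p x) := rfl

theorem compProj_mem (M : FinDGModule F A) {e : A} (he : IsClosedIdempotent F e) (p : ℤ × ℤ)
    (x : M.carrier) : M.compProj e p x ∈ M.comp e p :=
  ⟨M.act_mem he (M.isInternal.proj_mem p x), mem_weight.2 (by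
    rw [compProj_apply, act_act, he.mul_self])⟩

theorem compProj_of_mem (M : FinDGModule F A) {e : A} {p : ℤ × ℤ}
    {x : M.carrier} (hx : x ∈ M.comp e p) : M.compProj e p x = x := by
  rw [compProj_apply, M.isInternal.proj_of_mem hx.1, mem_weight.1 hx.2]

theorem compProj_d (M : FinDGModule F A) {e : A} (he : IsClosedIdempotent F e) (p : ℤ × ℤ)
    (x : M.carrier) : M.compProj e (p.1 + 1, p.2) (M.d x) = M.d (M.compProj e p x) := by
  have := M.isInternal.proj_map M.isInternal M.d (σ := fun p : ℤ × ℤ => (p.1 + 1, p.2))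
    (fun p q h => by simpa [Prod.ext_iff] using h) (fun p x hx => M.d_mem hx) p x
  rw [compProj_apply, compProj_apply, d_act M he, ← this]

theorem compProj_map {M N : FinDGModule F A} (f : M ⟶ N) (e : A) (p : ℤ × ℤ)
    (x : M.carrier) : N.compProj e p (Hom.toLin f x) = Hom.toLin f (M.compProj e p x) := by
  have := M.isInternal.proj_map N.isInternal (Hom.lin f) (σ := id)
    Function.injective_id (fun p x hx => Hom.map_mem f hx) p x
  rw [compProj_apply, compProj_apply, Hom.map_act]
  exact congrArg _ this

theorem d_mem_comp (M : FinDGModule F A) {e : A} (he : IsClosedIdempotent F e) {p : ℤ × ℤ}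
    {x : M.carrier} (hx : x ∈ M.comp e p) : M.d x ∈ M.comp e (p.1 + 1, p.2) :=
  ⟨M.d_mem hx.1, mem_weight.2 (by rw [← d_act M he, mem_weight.1 hx.2])⟩

theorem map_mem_comp {M N : FinDGModule F A} (f : M ⟶ N) {e : A} {p : ℤ × ℤ}
    {x : M.carrier} (hx : x ∈ M.comp e p) : Hom.toLin f x ∈ N.comp e p :=
  ⟨Hom.map_mem f hx.1, mem_weight.2 (by rw [← Hom.map_act, mem_weight.1 hx.2])⟩

/-- The cocycles that lie in a subspace `U`. -/
noncomputable abbrev cocyclesIn (M : FinDGModule F A) (U : Submodule F M.carrier) :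
    Submodule F M.carrier :=
  LinearMap.ker M.d ⊓ U

/-- The cohomology classes that are represented by cocycles in a subspace `U`. -/
abbrev cohomologyIn (M : FinDGModule F A) (U : Submodule F M.carrier) : Type u :=
  M.cocyclesIn U ⧸ (LinearMap.range M.d).submoduleOf (M.cocyclesIn U)

section MapIn

variable {M N P : FinDGModule F A} {U : Submodule F M.carrier} {V : Submodule F N.carrier}
  {W : Submodule F P.carrier}

/-- The restriction of a morphism to cocycles. -/
noncomputable def cocyclesInMap (f : M ⟶ N) (h : ∀ x ∈ U, Hom.toLin f x ∈ V) :
    M.cocyclesIn U →ₗ[F] N.cocyclesIn V :=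
  (Hom.lin f).restrict fun x hx => ⟨by
    change N.d (Hom.toLin f x) = 0
    rw [← Hom.map_d f, LinearMap.mem_ker.1 hx.1, map_zero], h x hx.2⟩

/-- The map induced on cohomology classes. -/
noncomputable def cohomologyInMap (f : M ⟶ N) (h : ∀ x ∈ U, Hom.toLin f x ∈ V) :
    M.cohomologyIn U →ₗ[F] N.cohomologyIn V :=
  Submodule.mapQ _ _ (cocyclesInMap f h) (by
    rintro x ⟨y, hy⟩
    exact ⟨Hom.toLin f y, by rw [← Hom.map_d f, hy]; rfl⟩)

/-- Boundaries are those of all of `M`: a primitive need not lie near `U`. For `U = M e` or `U =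
M^i_j e` nothing is lost, because a primitive can be projected to the matching component. -/
theorem cohomologyIn_mk_eq_zero {x : M.cocyclesIn U} :
    (Submodule.Quotient.mk x : M.cohomologyIn U) = 0 ↔ (x : M.carrier) ∈ LinearMap.range M.d :=
  Submodule.Quotient.mk_eq_zero _

theorem cohomologyInMap_mk (f : M ⟶ N) (h : ∀ x ∈ U, Hom.toLin f x ∈ V) (x : M.cocyclesIn U) :
    cohomologyInMap f h (Submodule.Quotient.mk x) =
      Submodule.Quotient.mk (cocyclesInMap f h x) := rfl

theorem cohomologyInMap_surjective_iff (f : M ⟶ N) (h : ∀ x ∈ U, Hom.toLin f x ∈ V) :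
    Function.Surjective (cohomologyInMap f h) ↔ ∀ y, N.d y = 0 → y ∈ V →
      ∃ x, M.d x = 0 ∧ x ∈ U ∧ Hom.toLin f x - y ∈ LinearMap.range N.d := by
  constructor
  · intro H y hy hV
    obtain ⟨z, hz⟩ := H (Submodule.Quotient.mk ⟨y, hy, hV⟩)
    obtain ⟨z, rfl⟩ := Submodule.Quotient.mk_surjective _ z
    rw [cohomologyInMap_mk] at hz
    exact ⟨z.1, z.2.1, z.2.2, (Submodule.Quotient.eq ((LinearMap.range N.d).submoduleOf
      (N.cocyclesIn V))).1 hz⟩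
  · intro H z
    obtain ⟨z, rfl⟩ := Submodule.Quotient.mk_surjective _ z
    obtain ⟨x, hx, hU, hxz⟩ := H z.1 z.2.1 z.2.2
    exact ⟨Submodule.Quotient.mk ⟨x, hx, hU⟩, (Submodule.Quotient.eq _).2 hxz⟩

/-- A quasi-isomorphism is bijective on total cohomology, and everything in sight commutes with the
projection on a component. Injectivity needs no projection, since primitives are unrestricted; for
surjectivity both the preimage and the primitive are projected. -/
theorem cohomologyInMap_bijective {f : M ⟶ N} (hf : quasiIso F A f) {e : A}
    (he : IsClosedIdempotent F e) (p : ℤ × ℤ) :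
    Function.Bijective (cohomologyInMap f (U := M.comp e p) (V := N.comp e p)
      fun _ => map_mem_comp f) := by
  rw [quasiIso_iff] at hf
  constructor
  · rw [← LinearMap.ker_eq_bot, LinearMap.ker_eq_bot']
    intro z hz
    obtain ⟨z, rfl⟩ := Submodule.Quotient.mk_surjective _ z
    rw [cohomologyInMap_mk, cohomologyIn_mk_eq_zero] at hz
    exact cohomologyIn_mk_eq_zero.2 (hf.1 z.1 z.2.1 hz)
  · rw [cohomologyInMap_surjective_iff]
    intro y hy hV
    obtain ⟨x, hx, w, hw⟩ := hf.2 y hy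
    -- The primitive of an element of cohomological degree `p.1` sits in degree `p.1 - 1`.
    have hp : ∀ (L : FinDGModule F A) (v : L.carrier), L.compProj e p (L.d v) =
        L.d (L.compProj e (p.1 - 1, p.2) v) := fun L v => by
      rw [← compProj_d L he, sub_add_cancel]
    have hp0 : M.d (M.compProj e p x) = 0 := by
      rw [← compProj_d M he, hx, map_zero]
    -- The sign of the primitive appears because the goal asks for `f x - y` while `hw` describes `y
    -- - f x`.
    refine ⟨M.compProj e p x, hp0, compProj_mem M he p x, -N.compProj e (p.1 - 1, p.2) w, ?_⟩
    rw [map_neg, ← hp, hw, map_sub, compProj_map, compProj_of_mem N hV, neg_sub]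

end MapIn

end FinDGModule

end ClosedElements

/-! ### Alternating sums with values in Laurent polynomials -/

section EulerSum

/-- The alternating sum of a finitely supported family of multiplicities. -/
noncomputable def eulerSum (f : ℤ × ℤ → ℕ) : ℤ[T;T⁻¹] :=
  ∑ᶠ p : ℤ × ℤ, ((p.1.negOnePow : ℤ) * (f p : ℤ)) • LaurentPolynomial.T p.2

theorem eulerSum_support {f : ℤ × ℤ → ℕ} (hf : f.support.Finite) :
    (Function.support fun p : ℤ × ℤ => ((p.1.negOnePow : ℤ) * (f p : ℤ)) •
      (LaurentPolynomial.T p.2 : ℤ[T;T⁻¹])).Finite := by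
  refine hf.subset fun p hp h0 => hp ?_
  dsimp only
  rw [h0, Nat.cast_zero, mul_zero, zero_smul]

/-- Finite supports are essential: a `finsum` over an infinite support takes the default value 0. -/
theorem eulerSum_add {f g : ℤ × ℤ → ℕ} (hf : f.support.Finite) (hg : g.support.Finite) :
    eulerSum (f + g) = eulerSum f + eulerSum g := by
  rw [eulerSum, eulerSum, eulerSum,
    ← finsum_add_distrib (eulerSum_support hf) (eulerSum_support hg)]
  refine finsum_congr fun p => ?_
  rw [← add_smul, ← mul_add, Pi.add_apply, Nat.cast_add]

/-- Shifting the cohomological degree by one reverses every sign. This gives both the cancellation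
of boundaries in `euler_eq` and the minus sign of `M[1]` in a cone. -/
theorem eulerSum_succ (f : ℤ × ℤ → ℕ) :
    eulerSum (fun p => f (p.1 + 1, p.2)) = -eulerSum f := by
  rw [eulerSum, eulerSum, ← finsum_neg_distrib]
  refine finsum_eq_of_bijective (fun p : ℤ × ℤ => (p.1 + 1, p.2))
    ((Equiv.addRight (1 : ℤ)).prodCongr (Equiv.refl ℤ)).bijective fun p => ?_
  dsimp only
  rw [Int.negOnePow_succ, Units.val_neg, neg_mul, neg_smul, neg_neg]

theorem eulerSum_sub (f : ℤ × ℤ → ℕ) (b : ℤ) :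
    eulerSum (fun p => f (p.1, p.2 - b)) = LaurentPolynomial.T b * eulerSum f := by
  rw [eulerSum, eulerSum, mul_finsum]
  refine finsum_eq_of_bijective (fun p : ℤ × ℤ => (p.1, p.2 - b))
      ((Equiv.refl ℤ).prodCongr (Equiv.subRight b)).bijective fun p => ?_
  dsimp only
  rw [mul_smul_comm, ← LaurentPolynomial.T_add, add_sub_cancel]

theorem eulerSum_zero : eulerSum (fun _ => 0) = 0 := by
  rw [eulerSum]
  simp

theorem eulerSum_single {f : ℤ × ℤ → ℕ} (h1 : f (0, 0) = 1) (h0 : ∀ p, p ≠ (0, 0) → f p = 0) :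
    eulerSum f = 1 := by
  rw [eulerSum, finsum_eq_single _ (0, 0)]
  · simp [h1]
  · intro p hp
    simp [h0 p hp]

end EulerSum

theorem Submodule.finrank_comap_subtype_eq {K M : Type*} [Field K] [AddCommGroup M] [Module K M]
    (U W : Submodule K M) :
    Module.finrank K (U.comap W.subtype) = Module.finrank K ↥(U ⊓ W) := by
  rw [(Submodule.equivSubtypeMap W (U.comap W.subtype)).finrank_eq, Submodule.map_comap_subtype,
    inf_comm]

/-! ### The Euler characteristic of a weight as a linear form on `K₀` -/

section EulerCharacteristic

variable {F : Type u} [Field F] {A : Type u} [Ring A] [Algebra F A] [QDGAlgebra F A]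

namespace FinDGModule

variable (F A) in
/-- The zero dg module. -/
noncomputable def zeroModule : FinDGModule F A where
  carrier := PUnit.{u + 1}
  gr _ _ := ⊥
  isInternal := DirectSum.isInternal_submodule_of_iSupIndep_of_iSup_eq_top
    (fun _ => disjoint_bot_left) (Subsingleton.elim _ _)
  smul_mem _ _ := Subsingleton.elim _ _
  d := 0
  d_mem _ := Subsingleton.elim _ _
  d_d _ := rfl
  leibniz _ _ := Subsingleton.elim _ _
  finite := inferInstance

theorem mem_weight_cone {M N : FinDGModule F A} (f : M ⟶ N) (e : A) (x : (cone f).carrier) :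
    x ∈ (cone f).weight e ↔ x.1 ∈ M.weight e ∧ x.2 ∈ N.weight e :=
  mem_weight.trans (Prod.ext_iff.trans (and_congr mem_weight.symm mem_weight.symm))

theorem mem_comp_cone {M N : FinDGModule F A} (f : M ⟶ N) (e : A) (p : ℤ × ℤ)
    (x : (cone f).carrier) : x ∈ (cone f).comp e p ↔
      x.1 ∈ M.comp e (p.1 + 1, p.2) ∧ x.2 ∈ N.comp e p := by
  have hw := mem_weight_cone f e x
  constructor
  · rintro ⟨h1, h2⟩
    exact ⟨⟨h1.1, (hw.1 h2).1⟩, h1.2, (hw.1 h2).2⟩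
  · rintro ⟨h1, h2⟩
    exact ⟨⟨h1.1, h2.1⟩, hw.2 ⟨h1.2, h2.2⟩⟩

variable [Module.Finite F A]

/-- Finite generation over `A` and finite dimension of `A` over `F` combine. Without this, `finrank`
could be the default 0 and the dimension counts below would fail. -/
instance finite_carrier (M : FinDGModule F A) : Module.Finite F M.carrier := by
  have : Module.Finite F Aᵐᵒᵖ := Module.Finite.equiv (MulOpposite.opLinearEquiv F)
  exact Module.Finite.trans Aᵐᵒᵖ M.carrier

/-- Independent nonzero subspaces of a finite-dimensional space are finite in number. -/
theorem finite_support_gr (M : FinDGModule F A) : {p : ℤ × ℤ | M.gr p.1 p.2 ≠ ⊥}.Finite :=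
  WellFoundedGT.finite_ne_bot_of_iSupIndep M.isInternal.submodule_iSupIndep

theorem finite_support_finrank (M : FinDGModule F A) (U : ℤ × ℤ → Submodule F M.carrier)
    (hU : ∀ p, U p ≤ M.gr p.1 p.2) :
    (Function.support fun p => Module.finrank F (U p)).Finite := by
  refine M.finite_support_gr.subset fun p hp h0 => hp ?_
  have : U p = ⊥ := eq_bot_iff.2 (h0 ▸ hU p)
  dsimp only
  rw [this, finrank_bot]

/-- The Euler characteristic `∑ (-1)^i dim (M^i_j e) q^j`. -/
noncomputable def euler (M : FinDGModule F A) (e : A) : ℤ[T;T⁻¹] :=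
  eulerSum fun p => Module.finrank F (M.comp e p)

/-- This is rank-nullity for the differential on `M^i_j e`. -/
theorem finrank_comp (M : FinDGModule F A) {e : A} (he : IsClosedIdempotent F e) (p : ℤ × ℤ) :
    Module.finrank F (M.comp e p) = Module.finrank F (M.cocyclesIn (M.comp e p)) +
      Module.finrank F ↥(LinearMap.range M.d ⊓ M.comp e (p.1 + 1, p.2)) := by
  have h := LinearMap.finrank_range_add_finrank_ker (M.d.domRestrict (M.comp e p))
  -- Every boundary in the next component already has a primitive in this one: the projection of any
  -- primitive.
  have hr : LinearMap.range (M.d.domRestrict (M.comp e p)) =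
      LinearMap.range M.d ⊓ M.comp e (p.1 + 1, p.2) := by
    ext y
    constructor
    · rintro ⟨x, rfl⟩
      exact ⟨⟨x, rfl⟩, d_mem_comp M he x.2⟩
    · rintro ⟨⟨x, rfl⟩, hy⟩
      refine ⟨⟨M.compProj e p x, compProj_mem M he p x⟩, ?_⟩
      change M.d (M.compProj e p x) = M.d x
      rw [← compProj_d M he, compProj_of_mem M hy]
  have hk : Module.finrank F (LinearMap.ker (M.d.domRestrict (M.comp e p))) =
      Module.finrank F (M.cocyclesIn (M.comp e p)) := by
    rw [LinearMap.ker_domRestrict, cocyclesIn]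
    exact Submodule.finrank_comap_subtype_eq _ _
  rw [← h, hr, hk, add_comm]

theorem finrank_cocycles (M : FinDGModule F A) (e : A) (p : ℤ × ℤ) :
    Module.finrank F (M.cocyclesIn (M.comp e p)) =
      Module.finrank F (M.cohomologyIn (M.comp e p)) +
        Module.finrank F ↥(LinearMap.range M.d ⊓ M.comp e p) := by
  have h := Submodule.finrank_quotient_add_finrank
    ((LinearMap.range M.d).submoduleOf (M.cocyclesIn (M.comp e p)))
  have hr : Module.finrank F ((LinearMap.range M.d).submoduleOf (M.cocyclesIn (M.comp e p))) =
      Module.finrank F ↥(LinearMap.range M.d ⊓ M.comp e p) := by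
    have hle : LinearMap.range M.d ≤ LinearMap.ker M.d := by
      rintro _ ⟨y, rfl⟩
      exact M.d_d y
    rw [Submodule.submoduleOf, Submodule.finrank_comap_subtype_eq, cocyclesIn, ← inf_assoc,
      inf_eq_left.2 hle]
  rw [← h, hr]

/-- The Euler characteristic is that of the cohomology. -/
theorem euler_eq (M : FinDGModule F A) {e : A} (he : IsClosedIdempotent F e) :
    M.euler e = eulerSum fun p => Module.finrank F (M.cohomologyIn (M.comp e p)) := by
  set z : ℤ × ℤ → ℕ := fun p => Module.finrank F (M.cocyclesIn (M.comp e p)) with hz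
  set b : ℤ × ℤ → ℕ := fun p => Module.finrank F ↥(LinearMap.range M.d ⊓ M.comp e p) with hb
  set h : ℤ × ℤ → ℕ := fun p => Module.finrank F (M.cohomologyIn (M.comp e p)) with hh
  have fz : z.support.Finite := M.finite_support_finrank _ fun p x hx => hx.2.1
  have fb : b.support.Finite := M.finite_support_finrank _ fun p x hx => hx.2.1
  have hzh : z = h + b := funext fun p => finrank_cocycles M e p
  -- From `z = h + b` it follows that `h ≤ z`, so the support of `h` lies in that of `z`.
  have fh : h.support.Finite := fz.subset fun p hp h0 => hp (by
    have := congrFun hzh p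
    rw [h0, Pi.add_apply] at this
    omega)
  have fb' : (fun p : ℤ × ℤ => b (p.1 + 1, p.2)).support.Finite :=
    fb.preimage (f := fun p : ℤ × ℤ => (p.1 + 1, p.2))
      ((Equiv.addRight (1 : ℤ)).prodCongr (Equiv.refl ℤ)).injective.injOn
  have hc : (fun p => Module.finrank F (M.comp e p)) = z + fun p => b (p.1 + 1, p.2) :=
    funext fun p => finrank_comp M he p
  -- The boundaries are counted twice, once in their own degree and once as the image of the degree
  -- below, with opposite signs.
  rw [euler, hc, eulerSum_add fz fb', eulerSum_succ b, hzh, eulerSum_add fh fb, add_neg_cancel_right]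

theorem euler_qshift (M : FinDGModule F A) (e : A) (b : ℤ) :
    (M.qshift b).euler e = LaurentPolynomial.T b * M.euler e :=
  eulerSum_sub (fun p => Module.finrank F (M.comp e p)) b

/-- As a graded space the cone is `M[1] ⊕ N`, compatibly with weights; its differential plays no
role in the dimension count. -/
theorem euler_cone {M N : FinDGModule F A} (f : M ⟶ N) (e : A) :
    (cone f).euler e = N.euler e - M.euler e := by
  have hc : (fun p => Module.finrank F ((cone f).comp e p)) =
      (fun p => Module.finrank F (M.comp e (p.1 + 1, p.2))) +
        fun p => Module.finrank F (N.comp e p) := by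
    funext p
    rw [Pi.add_apply, ← Module.finrank_prod]
    exact LinearEquiv.finrank_eq
      { toFun := fun x => (⟨x.1.1, ((mem_comp_cone f e p x.1).1 x.2).1⟩,
          ⟨x.1.2, ((mem_comp_cone f e p x.1).1 x.2).2⟩)
        invFun := fun y => ⟨(y.1.1, y.2.1), (mem_comp_cone f e p _).2 ⟨y.1.2, y.2.2⟩⟩
        map_add' := fun _ _ => rfl
        map_smul' := fun _ _ => rfl
        left_inv := fun _ => rfl
        right_inv := fun _ => rfl }
  have fM := M.finite_support_finrank (M.comp e) fun p x hx => hx.1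
  have fN := N.finite_support_finrank (N.comp e) fun p x hx => hx.1
  have fM' := fM.preimage (f := fun p : ℤ × ℤ => (p.1 + 1, p.2))
      ((Equiv.addRight (1 : ℤ)).prodCongr (Equiv.refl ℤ)).injective.injOn
  rw [euler, hc, eulerSum_add fM' fN, eulerSum_succ fun p => Module.finrank F (M.comp e p),
    neg_add_eq_sub]
  rfl

end FinDGModule

namespace DerivedCat

open FinDGModule

/-- The cohomology in bidegree `(i, j)` of `M e`, as a functor. -/
noncomputable def compCohomology {e : A} (he : IsClosedIdempotent F e) (p : ℤ × ℤ) :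
    DerivedCat F A ⥤ ModuleCat.{u} F :=
  Localization.Construction.lift
    { obj := fun M => ModuleCat.of F (M.cohomologyIn (M.comp e p))
      map := fun f => ModuleCat.ofHom (cohomologyInMap f fun _ => map_mem_comp f)
      map_id := fun M => by
        ext x
        rfl
      map_comp := fun f g => by
        ext x
        rfl }
    fun _ _ _ hf => (ConcreteCategory.isIso_iff_bijective _).2 (cohomologyInMap_bijective hf he p)

variable [Module.Finite F A]

/-- An isomorphism of the localization is not a morphism of dg modules, but cohomology in each
component is a functor on the localization, so its dimension is invariant; `euler_eq` recovers the
Euler characteristic from these dimensions. Here `X.as.obj` is the dg module underlying `X`. -/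
theorem euler_congr {e : A} (he : IsClosedIdempotent F e) {X Y : DerivedCat F A} (i : X ≅ Y) :
    FinDGModule.euler X.as.obj e = FinDGModule.euler Y.as.obj e := by
  rw [euler_eq _ he, euler_eq _ he]
  congr 1
  funext p
  exact (((compCohomology he p).mapIso i).toLinearEquiv).finrank_eq

end DerivedCat

namespace KZero

variable [Module.Finite F A]

/-- The Euler characteristic `[M] ↦ ∑ (-1)^i dim (M^i_j e) q^j` on `K₀`, as an additive map. -/
noncomputable def eulerAddHom {e : A} (he : IsClosedIdempotent F e) : KZero F A →+ ℤ[T;T⁻¹] :=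
  QuotientAddGroup.lift (KRelations F A)
    (FreeAbelianGroup.lift fun X => FinDGModule.euler X.as.obj e) (by
      rw [KRelations, AddSubgroup.closure_le]
      rintro _ ⟨T, ⟨M, N, f, ⟨i⟩⟩, rfl⟩
      change FreeAbelianGroup.lift _ _ = 0
      rw [map_sub, map_add, FreeAbelianGroup.lift_apply_of, FreeAbelianGroup.lift_apply_of,
        FreeAbelianGroup.lift_apply_of, sub_eq_zero]
      have e1 := DerivedCat.euler_congr he (Pretriangulated.Triangle.π₁.mapIso i)
      have e2 := DerivedCat.euler_congr he (Pretriangulated.Triangle.π₂.mapIso i)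
      have e3 := DerivedCat.euler_congr he (Pretriangulated.Triangle.π₃.mapIso i)
      refine e2.trans (Eq.trans ?_ (congrArg₂ (· + ·) e1 e3).symm)
      -- After replacing the triangle by a standard one, the relation is additivity on the cone.
      exact eq_add_of_sub_eq' (FinDGModule.euler_cone f e).symm)

theorem eulerAddHom_cls {e : A} (he : IsClosedIdempotent F e) (M : FinDGModule F A) :
    eulerAddHom he (cls ((DerivedCat.Q F A).obj M)) = M.euler e :=
  FreeAbelianGroup.lift_apply_of _ _

/-- Localization adds no objects, so the classes of dg modules generate `K₀` as a group. -/
theorem induction_on {p : KZero F A → Prop} (x : KZero F A)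
    (cls : ∀ M : FinDGModule F A, p (cls ((DerivedCat.Q F A).obj M)))
    (neg : ∀ x, p x → p (-x)) (add : ∀ x y, p x → p y → p (x + y)) : p x := by
  obtain ⟨x, rfl⟩ := QuotientAddGroup.mk'_surjective (KRelations F A) x
  induction x using FreeAbelianGroup.induction_on with
  | zero =>
    -- The value 0 is reached as `[M] + (-[M])`, here with the zero module for `M`.
    have h := add _ _ (cls (FinDGModule.zeroModule F A)) (neg _ (cls (FinDGModule.zeroModule F A)))
    rw [add_neg_cancel] at h
    exact h
  | of X => exact cls X.as.obj
  | neg X h => exact neg _ h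
  | add x y hx hy => exact add _ _ hx hy

/-- The Euler characteristic as a `ℤ[q, q⁻¹]`-linear map. -/
noncomputable def eulerHom {e : A} (he : IsClosedIdempotent F e) :
    KZero F A →ₗ[ℤ[T;T⁻¹]] ℤ[T;T⁻¹] where
  toFun := eulerAddHom he
  map_add' := map_add _
  map_smul' a x := by
    rw [RingHom.id_apply, smul_eq_mul]
    induction a using LaurentPolynomial.induction_on' with
    | add a b ha hb => rw [add_smul, map_add, ha, hb, add_mul]
    | C_mul_T n c =>
      -- Written as an integer cast, the constant acts through the additive group, so additivity
      -- handles it and only a power of `q` remains.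
      have hC : (LaurentPolynomial.C c : ℤ[T;T⁻¹]) = (c : ℤ[T;T⁻¹]) := by simp
      rw [hC, mul_smul, mul_assoc, Int.cast_smul_eq_zsmul, map_zsmul, ← zsmul_eq_mul]
      congr 1
      induction x using induction_on with
      | cls M =>
        rw [T_smul_cls, eulerAddHom_cls, eulerAddHom_cls, FinDGModule.euler_qshift]
      | neg x h => rw [smul_neg, map_neg, h, map_neg, mul_neg]
      | add x y hx hy => rw [smul_add, map_add, hx, hy, map_add, mul_add]

theorem eulerHom_cls {e : A} (he : IsClosedIdempotent F e) (M : FinDGModule F A) :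
    eulerHom he (cls ((DerivedCat.Q F A).obj M)) = M.euler e :=
  eulerAddHom_cls he M

end KZero

end EulerCharacteristic

/-! ### Classes of acyclic modules and of shifts -/

section Acyclic

variable {F : Type u} [Field F] {A : Type u} [Ring A] [Algebra F A] [QDGAlgebra F A]

namespace KZero

open FinDGModule

theorem cls_eq_of_quasiIso {M N : FinDGModule F A} {f : M ⟶ N} (hf : quasiIso F A f) :
    cls ((DerivedCat.Q F A).obj M) = cls ((DerivedCat.Q F A).obj N) := by
  have : IsIso ((DerivedCat.Q F A).map f) := (quasiIso F A).Q_inverts f hf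
  exact cls_iso (asIso ((DerivedCat.Q F A).map f))

/-- The zero morphism to `zeroModule`. -/
noncomputable def toZero (M : FinDGModule F A) : M ⟶ zeroModule F A :=
  Hom.mk (N := zeroModule F A) 0 (fun _ => Subsingleton.elim _ _) fun _ => rfl

/-- The cone of `0 ⟶ 0` is quasi-isomorphic to 0, so its triangle reads `[0] = [0] + [0]`. -/
theorem cls_zeroModule : cls ((DerivedCat.Q F A).obj (zeroModule F A)) = 0 := by
  have h := cls_cone (toZero (zeroModule F A))
  have hq : quasiIso F A (toZero (cone (toZero (zeroModule F A)))) := by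
    rw [FinDGModule.quasiIso_iff]
    exact ⟨fun x _ _ => ⟨0, Subsingleton.elim (α := PUnit.{u + 1} × PUnit.{u + 1}) _ _⟩,
      fun y _ => ⟨0, map_zero _, 0, Subsingleton.elim (α := PUnit.{u + 1}) _ _⟩⟩
  rw [cls_eq_of_quasiIso hq] at h
  exact left_eq_add.1 h

/-- For acyclic `M` the morphism `M ⟶ 0` is a quasi-isomorphism. -/
theorem cls_eq_zero_of_acyclic {M : FinDGModule F A}
    (h : ∀ x, M.d x = 0 → x ∈ LinearMap.range M.d) : cls ((DerivedCat.Q F A).obj M) = 0 := by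
  rw [← cls_zeroModule]
  refine cls_eq_of_quasiIso (f := toZero M) ((FinDGModule.quasiIso_iff _).2 ⟨fun x hx _ => h x hx, ?_⟩)
  exact fun y _ => ⟨0, map_zero _, 0, Subsingleton.elim (α := PUnit.{u + 1}) _ _⟩

/-- The cone of `M ⟶ 0` is `M[1]`, whence `[0] = [M] + [M[1]]`. -/
theorem cls_shift_one (M : FinDGModule F A) :
    cls ((DerivedCat.Q F A).obj (M.shift 1)) = -cls ((DerivedCat.Q F A).obj M) := by
  have h := cls_cone (toZero M)
  have e : cone (toZero M) ≅ M.shift 1 :=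
    isoOfLinearEquiv (M := cone (toZero M)) (N := M.shift 1)
      (LinearEquiv.prodUnique (R := Aᵐᵒᵖ) (M := M.carrier) (M₂ := PUnit.{u + 1}))
      (fun {i j x} => ⟨fun h => h.1, fun h => ⟨h, Subsingleton.elim (α := PUnit.{u + 1}) _ _⟩⟩)
      (fun (x : M.carrier × PUnit.{u + 1}) => by
        change -(M.d x.1) = Int.negOnePow 1 • M.d x.1
        rw [Int.negOnePow_one, Units.neg_smul, one_smul])
  rw [cls_zeroModule, cls_iso ((DerivedCat.Q F A).mapIso e)] at h
  exact (neg_eq_of_add_eq_zero_right h.symm).symm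

theorem cls_shift (M : FinDGModule F A) (a : ℤ) :
    cls ((DerivedCat.Q F A).obj (M.shift a)) =
      (a.negOnePow : ℤ) • cls ((DerivedCat.Q F A).obj M) := by
  have succ : ∀ a : ℤ, cls ((DerivedCat.Q F A).obj (M.shift (a + 1))) =
      -cls ((DerivedCat.Q F A).obj (M.shift a)) := fun a => by
    rw [cls_iso ((DerivedCat.Q F A).mapIso (M.shiftAdd a 1)), cls_shift_one]
  induction a using Int.induction_on with
  | zero =>
    rw [cls_iso ((DerivedCat.Q F A).mapIso M.shiftZero), Int.negOnePow_zero, Units.val_one,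
      one_smul]
  | succ i h => rw [succ, h, Int.negOnePow_succ, Units.val_neg, neg_smul]
  | pred i h =>
    -- For negative shifts the recursion is read backwards, from `-i` to `-i - 1`.
    have := succ (-i - 1)
    rw [sub_add_cancel, h] at this
    rw [Int.negOnePow_sub, Int.negOnePow_one, mul_neg, mul_one, Units.val_neg, neg_smul, this,
      neg_neg]

end KZero

end Acyclic

/-! ### `K₀` of a directed dg algebra -/

section Directed

variable {F : Type u} [Field F] {A : Type u} [Ring A] [Algebra F A] [QDGAlgebra F A]
  {ι : Type*} [Fintype ι]

variable (F) in
/-- A family of closed idempotents with sum `1` for which `A` is triangular with respect to a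
height function `h`, with the ground field on the diagonal. -/
structure IsDirectedFamily (e : ι → A) (h : ι → ℤ) : Prop where
  idem : ∀ s, IsClosedIdempotent F (e s)
  sum_eq_one : ∑ s, e s = 1
  ne_zero : ∀ s, e s ≠ 0
  triangular : ∀ s t, s ≠ t → ¬h s < h t → ∀ a, e s * a * e t = 0
  diagonal : ∀ s a, ∃ c : F, e s * a * e s = c • e s

namespace FinDGModule

/-- The dg module `e A`. -/
noncomputable abbrev proj {e : A} (he : IsClosedIdempotent F e) : FinDGModule F A :=
  ofIdempotent e he.mul_self he.mem he.closed

/-- The generator `e` of `e A`. -/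
def gen {e : A} (he : IsClosedIdempotent F e) : (proj he).carrier :=
  ⟨e, Submodule.mem_span_singleton_self e⟩

theorem proj_val_eq {e : A} (he : IsClosedIdempotent F e) (y : (proj he).carrier) :
    e * y.1 = y.1 := by
  obtain ⟨y, hy⟩ := y
  obtain ⟨b, rfl⟩ := Submodule.mem_span_singleton.1 hy
  change e * (e * b.unop) = e * b.unop
  rw [← mul_assoc, he.mul_self]

theorem proj_act_val {e : A} (he : IsClosedIdempotent F e) (a : A) (y : (proj he).carrier) :
    ((proj he).act a y).1 = y.1 * a := rfl

theorem d_gen {e : A} (he : IsClosedIdempotent F e) : (proj he).d (gen he) = 0 :=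
  Subtype.ext he.closed

/-- The morphism `e A[-i]{j} ⟶ M` with `e ↦ x`, for a cocycle `x` in `M^i_j`. -/
noncomputable def ofCocycle {e : A} (he : IsClosedIdempotent F e) (M : FinDGModule F A) {i j : ℤ}
    {x : M.carrier} (hx : x ∈ M.gr i j) (hd : M.d x = 0) :
    ((proj he).shift (-i)).qshift j ⟶ M :=
  Hom.mk (M := ((proj he).shift (-i)).qshift j) (N := M)
    { toFun := fun y => M.act y.1 x
      map_add' := fun y z => add_smul (MulOpposite.op y.1) (MulOpposite.op z.1) x
      map_smul' := fun a y => (act_act M y.1 a.unop x).symm }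
    -- In the shifted module, degree `(i', j')` means degree `(i' - i, j' - j)` in `e A`; acting on
    -- `x` adds `(i, j)` back.
    (fun {i' j' y} hy => by
      have := M.smul_mem hx hy
      have e1 : i + (i' + -i) = i' := by ring
      have e2 : j + (j' - j) = j' := by ring
      rwa [e1, e2] at this)
    (fun (y : (proj he).carrier) => by
      change M.act ((-i).negOnePow • (proj he).d y).1 x = M.d (M.act y.1 x)
      rw [act_apply, act_apply, M.leibniz _ hx, hd, smul_zero, zero_add, Int.negOnePow_neg]
      -- As `d x = 0`, the Leibniz rule gives `d (x y) = (-1)^i x d y`, and `(-1)^i` is also the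
      -- sign in the differential of the shift by `-i`.
      rcases Int.even_or_odd i with hi | hi
      · rw [Int.negOnePow_even i hi, one_smul, one_smul]; rfl
      · rw [Int.negOnePow_odd i hi, Units.neg_smul, Units.neg_smul, one_smul, one_smul,
          ← neg_smul]; rfl)

end FinDGModule

namespace IsDirectedFamily

open FinDGModule

variable {e : ι → A} {h : ι → ℤ}


/-- An element of `(e_s A) e_s` lies in the corner `e_s A e_s`, which is a line. -/
theorem val_of_mem_weight (H : IsDirectedFamily F e h) {s : ι} {y : (proj (H.idem s)).carrier}
    (hy : y ∈ (proj (H.idem s)).weight (e s)) : ∃ c : F, y.1 = c • e s := by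
  obtain ⟨c, hc⟩ := H.diagonal s y.1
  refine ⟨c, ?_⟩
  rw [← hc, proj_val_eq]
  exact (congrArg Subtype.val (mem_weight.1 hy)).symm

/-- The weight `t` part of `e_s A` is the corner `e_s A e_t`, which vanishes by triangularity. -/
theorem eq_zero_of_mem_weight (H : IsDirectedFamily F e h) {s t : ι} (hst : s ≠ t) (hlt : ¬h s < h t)
    {y : (proj (H.idem s)).carrier} (hy : y ∈ (proj (H.idem s)).weight (e t)) : y = 0 := by
  refine Subtype.ext ?_
  have := congrArg Subtype.val (mem_weight.1 hy)
  rw [proj_act_val, ← proj_val_eq, H.triangular s t hst hlt] at this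
  rw [← proj_val_eq, ← this]
  rfl

/-- The components of a cocycle in `M e_s` are again cocycles in `M e_s`; if all of them were
boundaries, so would be their sum. A homogeneous cocycle is what `ofCocycle` requires. -/
theorem exists_cocycle (H : IsDirectedFamily F e h) {M : FinDGModule F A} {s : ι}
    (hs : ¬∀ x, M.d x = 0 → x ∈ M.weight (e s) → x ∈ LinearMap.range M.d) :
    ∃ (p : ℤ × ℤ) (x : M.carrier), M.d x = 0 ∧ x ∈ M.comp (e s) p ∧ x ∉ LinearMap.range M.d := by
  by_contra! hc
  refine hs fun x hd hw => M.isInternal.mem_of_proj_mem fun p => ?_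
  -- Since `e_s` has bidegree (0, 0), taking a component commutes with its action, so the component
  -- of `x` stays in `M e_s`.
  have hx : M.isInternal.proj p x = M.compProj (e s) p x := by
    have := (M.isInternal).proj_map M.isInternal (M.act (e s)) Function.injective_id
      (fun p x hx => M.act_mem (H.idem s) hx) p x
    rw [mem_weight.1 hw] at this
    exact this
  rw [hx]
  refine hc p _ ?_ (compProj_mem M (H.idem s) p x)
  rw [← compProj_d M (H.idem s), hd, map_zero]

/-- A cocycle `x` is the sum of the cocycles `x e_s`, because the idempotents add up to 1. -/
theorem acyclic_of_weights (H : IsDirectedFamily F e h) {M : FinDGModule F A}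
    (hM : ∀ s, ∀ x, M.d x = 0 → x ∈ M.weight (e s) → x ∈ LinearMap.range M.d) (x : M.carrier)
    (hx : M.d x = 0) : x ∈ LinearMap.range M.d := by
  have : x = ∑ s, M.act (e s) x := by
    simp only [act_apply]
    rw [← Finset.sum_smul, ← Finset.op_sum, H.sum_eq_one, MulOpposite.op_one, one_smul]
  rw [this]
  refine sum_mem fun s _ => hM s _ ?_ (mem_weight.2 ?_)
  · rw [d_act M (H.idem s), hx, map_zero]
  · rw [act_act, (H.idem s).mul_self]

section Cone

variable {M : FinDGModule F A} {s : ι} {i j : ℤ} {x : M.carrier} (hx : x ∈ M.gr i j)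
  (hd : M.d x = 0)

/-- In such a weight `t` the summand coming from `e_s A` is zero, so the cone reduces to `M` and
inherits its acyclicity there. -/
theorem cone_weight_of_not_lt (H : IsDirectedFamily F e h) {t : ι} (hst : s ≠ t) (hlt : ¬h s < h t)
    (hM : ∀ y, M.d y = 0 → y ∈ M.weight (e t) → y ∈ LinearMap.range M.d)
    (z : (cone (ofCocycle (H.idem s) M hx hd)).carrier)
    (hz : (cone (ofCocycle (H.idem s) M hx hd)).d z = 0)
    (hw : z ∈ (cone (ofCocycle (H.idem s) M hx hd)).weight (e t)) :
    z ∈ LinearMap.range (cone (ofCocycle (H.idem s) M hx hd)).d := by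
  obtain ⟨a, y⟩ := z
  have hw := (mem_weight_cone _ (e t) _).1 hw
  have ha : a = 0 := H.eq_zero_of_mem_weight hst hlt hw.1
  subst ha
  have hy : M.d y = 0 := by
    have := congrArg Prod.snd hz
    change Hom.toLin (ofCocycle (H.idem s) M hx hd) 0 + M.d y = 0 at this
    rwa [map_zero, zero_add] at this
  obtain ⟨w, rfl⟩ := hM y hy hw.2
  refine ⟨(0, w), Prod.ext ?_ ?_⟩
  · change -((((proj (H.idem s)).shift (-i)).qshift j).d 0) = 0
    rw [map_zero, neg_zero]
  · change Hom.toLin (ofCocycle (H.idem s) M hx hd) 0 + M.d w = M.d w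
    rw [map_zero, zero_add]

variable [Module.Finite F A]

/-- In weight `s` the cone adds to `M` only the line of the generator, whose differential is `x`. As
`x` is not a boundary in `M`, no cocycle of the cone involves the generator; thus the cohomology of
`M` maps onto that of the cone in weight `s`, and the nonzero class of `x` dies. -/
theorem finrank_cone_lt (H : IsDirectedFamily F e h) (hxw : x ∈ M.weight (e s))
    (hr : x ∉ LinearMap.range M.d) :
    Module.finrank F ((cone (ofCocycle (H.idem s) M hx hd)).cohomologyIn
      ((cone (ofCocycle (H.idem s) M hx hd)).weight (e s))) <
    Module.finrank F (M.cohomologyIn (M.weight (e s))) := by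
  set f := ofCocycle (H.idem s) M hx hd with hf
  have hmap : ∀ y ∈ M.weight (e s), Hom.toLin (coneInr f) y ∈ (cone f).weight (e s) := fun y hy =>
    mem_weight.2 (by rw [← Hom.map_act, mem_weight.1 hy])
  have hxs : M.act (e s) x = x := mem_weight.1 hxw
  have hsurj : Function.Surjective (cohomologyInMap (coneInr f) hmap) := by
    rw [cohomologyInMap_surjective_iff]
    rintro ⟨a, y⟩ hz hw
    have hw := (mem_weight_cone f (e s) _).1 hw
    obtain ⟨c, hc⟩ := H.val_of_mem_weight hw.1
    have h2 : M.act a.1 x + M.d y = 0 := congrArg Prod.snd hz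
    rw [hc] at h2
    have h3 : M.act (c • e s) x = c • x := by
      rw [act_apply, MulOpposite.op_smul, smul_assoc, ← act_apply, hxs]
    rw [h3] at h2
    -- By `h2`, `c x = -d y`; with `c` invertible, `x` would be the differential of `-c⁻¹ y`.
    have hc0 : c = 0 := by
      by_contra hc0
      refine hr ⟨-(c⁻¹ • y), ?_⟩
      rw [map_neg, map_smul, eq_neg_of_add_eq_zero_right h2, smul_neg, neg_neg, smul_smul,
        inv_mul_cancel₀ hc0, one_smul]
    have ha : a = 0 := Subtype.ext (by rw [hc, hc0, zero_smul]; rfl)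
    subst ha
    rw [hc0, zero_smul, zero_add] at h2
    refine ⟨y, h2, hw.2, ?_⟩
    -- The cocycle is now `(0, y)`, which is the image of `y` itself, so the difference to be
    -- bounded is 0.
    exact (sub_self (Hom.toLin (coneInr f) y)).symm ▸ zero_mem _
  have hker : Submodule.Quotient.mk ⟨x, hd, hxw⟩ ∈
      LinearMap.ker (cohomologyInMap (coneInr f) hmap) := by
    rw [LinearMap.mem_ker, cohomologyInMap_mk, cohomologyIn_mk_eq_zero]
    -- The generator is the primitive: its differential in the cone is `(-d e_s, x e_s) = (0, x)`,
    -- where `x e_s = x` since `x` has weight `s`.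
    refine ⟨(gen (H.idem s), 0), Prod.ext ?_ ?_⟩
    · change -((-i).negOnePow • (proj (H.idem s)).d (gen (H.idem s))) = 0
      rw [d_gen, smul_zero, neg_zero]
    · change M.act (e s) x + M.d 0 = x
      rw [map_zero, add_zero, hxs]
  have hpos : 0 < Module.finrank F (LinearMap.ker (cohomologyInMap (coneInr f) hmap)) := by
    rw [Module.finrank_pos_iff_exists_ne_zero]
    refine ⟨⟨_, hker⟩, fun h0 => hr ?_⟩
    exact cohomologyIn_mk_eq_zero.1 (congrArg Subtype.val h0)
  have := LinearMap.finrank_range_add_finrank_ker (cohomologyInMap (coneInr f) hmap)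
  rw [LinearMap.range_eq_top.2 hsurj, finrank_top] at this
  omega

end Cone

/-- The class of `e_s A` in `K₀`. -/
noncomputable def clsProj (H : IsDirectedFamily F e h) (s : ι) : KZero F A :=
  KZero.cls ((DerivedCat.Q F A).obj (proj (H.idem s)))

theorem cls_shift_mem (H : IsDirectedFamily F e h) (s : ι) (i j : ℤ) :
    KZero.cls ((DerivedCat.Q F A).obj (((proj (H.idem s)).shift i).qshift j)) ∈
      Submodule.span ℤ[T;T⁻¹] (Set.range H.clsProj) := by
  rw [← KZero.T_smul_cls, KZero.cls_shift]
  exact Submodule.smul_mem _ _ (zsmul_mem (Submodule.subset_span (Set.mem_range_self s)) _)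

/-- Double induction: on the size of the upward closed set `U` that supports the cohomology and,
inside it, on the dimension of the cohomology in a weight `s` of minimal height in `U`. Coning off a
cocycle of weight `s` lowers the second number and can create cohomology only in weights above `s`,
which belong to `U`. -/
theorem cls_mem_span_of_support (H : IsDirectedFamily F e h) [Module.Finite F A] (U : Finset ι)
    (hU : ∀ s ∈ U, ∀ t, h s < h t → t ∈ U) (M : FinDGModule F A)
    (hM : ∀ s ∉ U, ∀ x, M.d x = 0 → x ∈ M.weight (e s) → x ∈ LinearMap.range M.d) :
    KZero.cls ((DerivedCat.Q F A).obj M) ∈ Submodule.span ℤ[T;T⁻¹] (Set.range H.clsProj) := by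
  classical
  induction hn : U.card generalizing U M with
  | zero =>
    rw [KZero.cls_eq_zero_of_acyclic]
    · exact zero_mem _
    · refine H.acyclic_of_weights fun s => hM s ?_
      rw [Finset.card_eq_zero.1 hn]
      exact Finset.notMem_empty s
  | succ n ih =>
    obtain ⟨s, hs, hmin⟩ := U.exists_min_image h (Finset.card_pos.1 (by omega))
    induction hm : Module.finrank F (M.cohomologyIn (M.weight (e s)))
      using Nat.strong_induction_on generalizing M with
    | _ m ihm =>
    by_cases hc : ∀ x, M.d x = 0 → x ∈ M.weight (e s) → x ∈ LinearMap.range M.d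
    · refine ih (U.erase s) (fun t ht t' htt' => ?_) M (fun t ht => ?_) ?_
      · have ht := Finset.mem_erase.1 ht
        refine Finset.mem_erase.2 ⟨?_, hU t ht.2 t' htt'⟩
        rintro rfl
        exact absurd htt' (not_lt.2 (hmin t ht.2))
      · by_cases hts : t = s
        · rw [hts]; exact hc
        · exact hM t fun htU => ht (Finset.mem_erase.2 ⟨hts, htU⟩)
      · rw [Finset.card_erase_of_mem hs, hn, Nat.add_sub_cancel]
    · obtain ⟨⟨i, j⟩, x, hd, hx, hr⟩ := H.exists_cocycle hc
      have hcone := KZero.cls_cone (ofCocycle (H.idem s) M hx.1 hd)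
      rw [hcone]
      refine add_mem (H.cls_shift_mem s (-i) j)
        (ihm _ (hm ▸ H.finrank_cone_lt hx.1 hd hx.2 hr) _ (fun t ht z hz hw => ?_) rfl)
      -- A weight `t` outside `U` cannot be higher than `s`, for `U` contains `s` and everything
      -- above it; so the cone has no cohomology there.
      refine H.cone_weight_of_not_lt hx.1 hd ?_ (fun hlt => ht (hU s hs t hlt)) (hM t ht) z hz hw
      rintro rfl
      exact ht hs

variable [Module.Finite F A]

theorem span_clsProj (H : IsDirectedFamily F e h) : Submodule.span ℤ[T;T⁻¹] (Set.range H.clsProj) = ⊤ := by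
  rw [eq_top_iff]
  rintro x -
  induction x using KZero.induction_on with
  | cls M =>
    exact H.cls_mem_span_of_support Finset.univ (fun _ _ _ _ => Finset.mem_univ _) M
      fun s hs => absurd (Finset.mem_univ s) hs
  | neg x hx => exact neg_mem hx
  | add x y hx hy => exact add_mem hx hy

/-- The part `(e_s A) e_s` is the line of `e_s`, placed in bidegree (0, 0), and `e_s ≠ 0`. -/
theorem euler_proj_self (H : IsDirectedFamily F e h) (s : ι) : (proj (H.idem s)).euler (e s) = 1 := by
  have hgen : gen (H.idem s) ≠ 0 := fun h0 => H.ne_zero s (congrArg Subtype.val h0)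
  have hmem : ∀ y ∈ (proj (H.idem s)).weight (e s), ∃ c : F, c • gen (H.idem s) = y := fun y hy => by
    obtain ⟨c, hc⟩ := H.val_of_mem_weight hy
    exact ⟨c, Subtype.ext hc.symm⟩
  have hgr : gen (H.idem s) ∈ (proj (H.idem s)).gr 0 0 := (H.idem s).mem
  refine eulerSum_single ?_ fun p hp => ?_
  · have : (proj (H.idem s)).comp (e s) (0, 0) = Submodule.span F {gen (H.idem s)} := by
      ext y
      rw [Submodule.mem_span_singleton]
      constructor
      · exact fun hy => hmem y hy.2
      · rintro ⟨c, rfl⟩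
        refine Submodule.smul_mem _ c ⟨hgr, mem_weight.2 (Subtype.ext (H.idem s).mul_self)⟩
    rw [this, finrank_span_singleton hgen]
  · have : (proj (H.idem s)).comp (e s) p = ⊥ := by
      rw [eq_bot_iff]
      intro y hy
      obtain ⟨c, rfl⟩ := hmem y hy.2
      -- A multiple of the generator lying in degree `p ≠ (0, 0)` equals its own component of degree
      -- `p`, which is zero.
      have h1 := (proj (H.idem s)).isInternal.proj_of_mem (i := p) hy.1
      rw [map_smul, (proj (H.idem s)).isInternal.proj_of_mem_ne (i := (0, 0)) hp.symm hgr,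
        smul_zero] at h1
      exact h1.symm
    rw [this, finrank_bot]

theorem euler_proj_of_not_lt (H : IsDirectedFamily F e h) {s t : ι} (hst : s ≠ t) (hlt : ¬h s < h t) :
    (proj (H.idem s)).euler (e t) = 0 := by
  have : ∀ p, Module.finrank F ((proj (H.idem s)).comp (e t) p) = 0 := fun p => by
    have : (proj (H.idem s)).comp (e t) p = ⊥ :=
      eq_bot_iff.2 fun y hy => H.eq_zero_of_mem_weight hst hlt hy.2
    rw [this, finrank_bot]
  rw [euler]
  simp only [this]
  exact eulerSum_zero

/-- The Euler forms and the classes pair to a unitriangular matrix, so the index of least height in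
a relation can be isolated. -/
theorem linearIndependent_clsProj (H : IsDirectedFamily F e h) : LinearIndependent ℤ[T;T⁻¹] H.clsProj := by
  rw [Fintype.linearIndependent_iff]
  intro g hg
  by_contra! hne
  obtain ⟨s₀, hs₀⟩ := hne
  classical
  -- With `h s` minimal among the indices with nonzero coefficient, no other such `t` has `h t < h
  -- s`, so the Euler form of `e_s` kills every term but that of `s`.
  obtain ⟨s, hs, hmin⟩ := (Finset.univ.filter fun s => g s ≠ 0).exists_min_image h
    ⟨s₀, by simpa using hs₀⟩
  rw [Finset.mem_filter] at hs
  have := congrArg (KZero.eulerHom (H.idem s)) hg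
  rw [map_sum, map_zero, Finset.sum_eq_single s] at this
  · rw [map_smul, clsProj, KZero.eulerHom_cls, H.euler_proj_self, smul_eq_mul, mul_one] at this
    exact hs.2 this
  · intro t _ hts
    rw [map_smul, clsProj, KZero.eulerHom_cls]
    by_cases hgt : g t = 0
    · rw [hgt, zero_smul]
    · rw [H.euler_proj_of_not_lt hts (not_lt.2 (hmin t (by simpa using hgt))), smul_zero]
  · exact fun h => absurd (Finset.mem_univ s) h

/-- The basis of `K₀` by the classes of the dg modules `e_s A`. -/
noncomputable def basis (H : IsDirectedFamily F e h) : Module.Basis ι ℤ[T;T⁻¹] (KZero F A) :=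
  Module.Basis.mk H.linearIndependent_clsProj H.span_clsProj.ge

theorem basis_apply (H : IsDirectedFamily F e h) (s : ι) : H.basis s = H.clsProj s := Module.Basis.mk_apply _ _ _

end IsDirectedFamily

end Directed

/-! ### Bases of direct sums and finiteness of exterior algebras -/

theorem DFinsupp.basis_apply {ι R : Type*} {M η : ι → Type*} [DecidableEq ι] [Semiring R]
    [∀ i, AddCommMonoid (M i)] [∀ i, Module R (M i)] (b : ∀ i, Module.Basis (η i) R (M i))
    (a : Σ i, η i) : DFinsupp.basis b a = DFinsupp.single a.1 (b a.1 a.2) := by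
  apply (DFinsupp.basis b).repr.injective
  rw [Module.Basis.repr_self]
  change _ = (sigmaFinsuppLequivDFinsupp R).symm
    (DFinsupp.mapRange.linearEquiv (fun i => (b i).repr) _)
  rw [LinearEquiv.eq_symm_apply, DFinsupp.mapRange.linearEquiv_apply, DFinsupp.mapRange_single,
    Module.Basis.repr_self]
  exact sigmaFinsuppEquivDFinsupp_single a 1

/-- Exterior powers beyond the dimension of `V` vanish, which leaves finitely many
finite-dimensional summands. -/
theorem ExteriorAlgebra.finite_of_finite (F V : Type*) [Field F] [AddCommGroup V] [Module F V]
    [Module.Finite F V] : Module.Finite F (ExteriorAlgebra F V) := by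
  have htop : (⨆ i : ℕ, ⋀[F]^i V) = ⊤ :=
    (DirectSum.Decomposition.isInternal fun i : ℕ => ⋀[F]^i V).submodule_iSup_eq_top
  have hle : (⨆ i : ℕ, ⋀[F]^i V) ≤
      -- The `+ 1` keeps the top exterior power, in degree `finrank F V`.
      (Finset.range (Module.finrank F V + 1)).sup fun i => ⋀[F]^i V := by
    refine iSup_le fun i => ?_
    by_cases hi : i ∈ Finset.range (Module.finrank F V + 1)
    · exact Finset.le_sup (f := fun i => ⋀[F]^i V) hi
    · have h0 : Module.finrank F (⋀[F]^i V) = 0 := by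
        rw [exteriorPower.finrank_eq, Nat.choose_eq_zero_iff]
        simpa [Nat.lt_succ_iff] using hi
      rw [Submodule.finrank_eq_zero.1 h0]
      exact bot_le
  rw [htop] at hle
  have : Module.Finite F ↥((Finset.range (Module.finrank F V + 1)).sup fun i => ⋀[F]^i V) :=
    inferInstance
  rw [top_le_iff.1 hle] at this
  exact Module.Finite.equiv Submodule.topEquiv

/-! ### The strand algebra is directed -/

namespace NilStrands

variable (F : Type u) [Field F] {n k : ℕ}

instance finite_RNil : Module.Finite F (RNil F n k) := by
  have : ∀ c : Diagram n k, Module.Finite F (Dots F c.2.1) := fun c =>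
    ExteriorAlgebra.finite_of_finite F _
  have : Module.Finite F (AllStrands F n k) :=
    inferInstanceAs (Module.Finite F (∀ c : Diagram n k, Dots F c.2.1))
  exact Module.Finite.of_injective (RNil.incl F n k).toLinearMap Subtype.val_injective

variable {F}

theorem eq_of_forall_apply_eq {S T : KSubset n k} (φ : S.1 ≃ T.1)
    (h : ∀ s : S.1, (φ s : Fin n) = s) : S = T := by
  refine Subtype.ext (Finset.eq_of_subset_of_card_le (fun s hs => ?_) (by rw [S.2, T.2]))
  have := (φ ⟨s, hs⟩).2
  rwa [h ⟨s, hs⟩] at this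

/-- The difference `total T - total S` is the sum of the nonnegative numbers `φ s - s`, and it is
zero only if each of them is. -/
theorem Nondecreasing.total_lt_or {S T : KSubset n k} {φ : S.1 ≃ T.1} (h : Nondecreasing φ) :
    total S < total T ∨ ∀ s : S.1, (φ s : Fin n) = s := by
  have hS : total S = ∑ s : S.1, (((s : Fin n) : ℤ) + 1) := (Finset.sum_coe_sort S.1 _).symm
  have hT : total T = ∑ s : S.1, (((φ s : Fin n) : ℤ) + 1) := by
    rw [φ.sum_comp (fun t : T.1 => (((t : Fin n) : ℤ) + 1))]
    exact (Finset.sum_coe_sort T.1 _).symm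
  have hle : ∀ s ∈ (Finset.univ : Finset S.1),
      (((s : Fin n) : ℤ) + 1) ≤ (((φ s : Fin n) : ℤ) + 1) := fun s _ => by
    have : ((s : Fin n) : ℕ) ≤ ((φ s : Fin n) : ℕ) := h s
    omega
  rw [hS, hT]
  rcases (Finset.sum_le_sum hle).lt_or_eq with hlt | heq
  · exact Or.inl hlt
  · right
    intro s
    have := (Finset.sum_eq_sum_iff_of_le hle).1 heq s (Finset.mem_univ s)
    exact Fin.ext (by omega)

namespace AllStrands

theorem idem_apply_of_ne {S S' T' : KSubset n k} (h : S' ≠ S) (φ : S'.1 ≃ T'.1) :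
    (idem S : AllStrands F n k) ⟨S', T', φ⟩ = 0 := if_neg fun h' => h h'.1

theorem idem_apply (S T : KSubset n k) (φ : S.1 ≃ T.1) :
    (idem S : AllStrands F n k) ⟨S, T, φ⟩ = (1 : AllStrands F n k) ⟨S, T, φ⟩ :=
  if_congr (and_iff_right rfl) rfl rfl

theorem idem_apply_of_ne_right {S S' T' : KSubset n k} (h : T' ≠ S) (φ : S'.1 ≃ T'.1) :
    (idem S : AllStrands F n k) ⟨S', T', φ⟩ = 0 :=
  if_neg fun h' => h ((eq_of_forall_apply_eq φ h'.2).symm.trans h'.1)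

theorem idem_apply_right (S T : KSubset n k) (φ : S.1 ≃ T.1) :
    (idem T : AllStrands F n k) ⟨S, T, φ⟩ = (1 : AllStrands F n k) ⟨S, T, φ⟩ :=
  if_congr (and_iff_right_of_imp fun h => eq_of_forall_apply_eq φ h) rfl rfl

/-- A coefficient of a product at source `S` involves the first factor only at source `S`, where
`idem S` and the unit agree; so the unit law applies. The same argument works on the right with
targets. -/
theorem idem_mul_apply (S T : KSubset n k) (f : AllStrands F n k) (φ : S.1 ≃ T.1) :
    (idem S * f : AllStrands F n k) ⟨S, T, φ⟩ = f ⟨S, T, φ⟩ := by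
  refine Eq.trans ?_ (congrFun (one_mul f) _)
  simp only [mul_apply, idem_apply]

theorem idem_mul_apply_of_ne {S S' T' : KSubset n k} (h : S' ≠ S) (f : AllStrands F n k)
    (φ : S'.1 ≃ T'.1) : (idem S * f : AllStrands F n k) ⟨S', T', φ⟩ = 0 := by
  simp only [mul_apply, idem_apply_of_ne h, map_zero, zero_mul, ite_self, Finset.sum_const_zero]

theorem mul_idem_apply (S T : KSubset n k) (f : AllStrands F n k) (φ : S.1 ≃ T.1) :
    (f * idem T : AllStrands F n k) ⟨S, T, φ⟩ = f ⟨S, T, φ⟩ := by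
  refine Eq.trans ?_ (congrFun (mul_one f) _)
  simp only [mul_apply, idem_apply_right]

theorem mul_idem_apply_of_ne {S S' T' : KSubset n k} (h : T' ≠ S) (f : AllStrands F n k)
    (φ : S'.1 ≃ T'.1) : (f * idem S : AllStrands F n k) ⟨S', T', φ⟩ = 0 := by
  simp only [mul_apply, idem_apply_of_ne_right h, mul_zero, ite_self, Finset.sum_const_zero]

theorem sum_idem : ∑ S : KSubset n k, (idem S : AllStrands F n k) = 1 := by
  ext S T φ
  refine (Finset.sum_apply (M := fun c : Diagram n k => Dots F c.2.1) _ _ _).trans ?_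
  rw [Finset.sum_eq_single S, idem_apply]
  · exact fun S' _ h => idem_apply_of_ne h.symm φ
  · exact fun h => absurd (Finset.mem_univ S) h

/-- Multiplying by the two idempotents keeps the coefficients from `S` to `T` and erases all others.
The corner conditions of a directed family are thereby read off coefficient by coefficient. -/
theorem idem_mul_mul_idem {S T : KSubset n k} {f : AllStrands F n k} {x : AllStrands F n k}
    (hx : ∀ S' T' (φ : S'.1 ≃ T'.1), ¬(S' = S ∧ T' = T) → x ⟨S', T', φ⟩ = 0)
    (h : ∀ φ : S.1 ≃ T.1, f ⟨S, T, φ⟩ = x ⟨S, T, φ⟩) : idem S * f * idem T = x := by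
  ext S' T' φ
  by_cases hT : T' = T
  · subst hT
    rw [mul_idem_apply]
    by_cases hS : S' = S
    · subst hS
      rw [idem_mul_apply, h]
    · rw [idem_mul_apply_of_ne hS, hx _ _ _ fun h' => hS h'.1]
  · rw [mul_idem_apply_of_ne hT, hx _ _ _ fun h' => hT h'.2]

end AllStrands

/-- The identity has no increasing strand, so no dot is allowed and only scalars remain. -/
theorem exists_smul_of_mem_allowedDots_refl {S : KSubset n k} {x : Dots F S}
    (hx : x ∈ allowedDots F (Equiv.refl S.1)) : ∃ c : F, x = c • 1 := by
  have hempty : {x : Dots F S | ∃ t : S.1, IsIncreasingEnd (Equiv.refl S.1) t ∧ x = dot t} = ∅ :=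
    Set.eq_empty_of_forall_notMem fun x ⟨t, ht, _⟩ => lt_irrefl _ ht
  rw [allowedDots, hempty, Algebra.adjoin_empty, Algebra.mem_bot] at hx
  obtain ⟨c, rfl⟩ := hx
  exact ⟨c, Algebra.algebraMap_eq_smul_one c⟩

variable (F n k) in
-- The height is the sum of the elements of `S`. A strand diagram in the algebra raises it, or is an
-- identity diagram without dots.
theorem isDirectedFamily_oneAt :
    IsDirectedFamily F (fun S : KSubset n k => oneAt F S) total where
  idem S := ⟨oneAt_mul_self F S, oneAt_mem F S, d_oneAt F S⟩
  sum_eq_one := by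
    apply Subtype.ext
    refine Eq.trans ?_ AllStrands.sum_idem
    exact map_sum (RNil.incl F n k) _ _
  ne_zero S h := by
    have h1 : (AllStrands.idem S : AllStrands F n k) ⟨S, S, Equiv.refl _⟩ = 0 :=
      congrFun (congrArg Subtype.val h) _
    rw [AllStrands.idem_apply_same] at h1
    exact one_ne_zero h1
  triangular S T hST hlt a := by
    apply Subtype.ext
    refine AllStrands.idem_mul_mul_idem (x := 0) (fun _ _ _ _ => rfl) fun φ => ?_
    refine (a.2 S T φ).1 fun hφ => ?_
    rcases hφ.total_lt_or with h | h
    · exact hlt h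
    · exact hST (eq_of_forall_apply_eq φ h)
  diagonal S a := by
    -- The scalar `c` is the coefficient of `a` at the identity diagram of `S`.
    obtain ⟨c, hc⟩ := exists_smul_of_mem_allowedDots_refl (a.2 S S (Equiv.refl _)).2
    refine ⟨c, Subtype.ext ?_⟩
    change AllStrands.idem S * a.1 * AllStrands.idem S = c • AllStrands.idem S
    refine AllStrands.idem_mul_mul_idem (fun S' T' φ h => ?_) fun φ => ?_
    · rw [AllStrands.smul_apply]
      by_cases hS : S' = S
      · rw [AllStrands.idem_apply_of_ne_right fun hT => h ⟨hS, hT⟩, smul_zero]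
      · rw [AllStrands.idem_apply_of_ne hS, smul_zero]
    · rw [AllStrands.smul_apply]
      by_cases hφ : φ = Equiv.refl _
      · subst hφ
        rw [AllStrands.idem_apply_same]
        exact hc
      · rw [AllStrands.idem_apply, AllStrands.one_apply_of_ne_refl φ hφ, smul_zero]
        -- A nondecreasing bijection from `S` to itself cannot raise the sum of the elements, so it
        -- is the identity; at any other `φ` the coefficient of `a` vanishes.
        refine (a.2 S S φ).1 fun hn => hφ ?_
        rcases hn.total_lt_or with h | h
        · exact absurd h (lt_irrefl _)
        · exact Equiv.ext fun s => Subtype.ext (h s)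

/-! ### The two bases and the isomorphism -/

/-- The basis of `K₀` by the classes `[P(S)]`. -/
noncomputable def basisKZero (F : Type u) [Field F] (n k : ℕ) :
    Module.Basis (KSubset n k) ℤ[T;T⁻¹] (KZero F (RNil F n k)) :=
  (isDirectedFamily_oneAt F n k).basis

theorem basisKZero_apply (S : KSubset n k) : basisKZero F n k S = clsP F S :=
  (isDirectedFamily_oneAt F n k).basis_apply S

/-- The basis of `V^{⊗ n}` by tensor products of basis vectors of `V`. -/
noncomputable def basisVTensor (n : ℕ) : Module.Basis (Fin n → Bool) ℤ[T;T⁻¹] (VTensor n) :=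
  Basis.piTensorProduct fun _ => Pi.basisFun ℤ[T;T⁻¹] Bool

theorem basisVTensor_apply (n : ℕ) (p : Fin n → Bool) :
    basisVTensor n p = PiTensorProduct.tprod ℤ[T;T⁻¹] fun i => vec (p i) := by
  rw [basisVTensor, Basis.piTensorProduct_apply]
  congr 1
  funext i
  rw [Pi.basisFun_apply]
  rfl

/-- Subsets of `{1, …, n}` as indicator functions. -/
noncomputable def indicatorEquiv (n : ℕ) : (Σ k : Fin (n + 1), KSubset n k) ≃ (Fin n → Bool) :=
  Equiv.ofBijective (fun S => fun i => decide (i ∈ S.2.1)) (by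
    constructor
    · rintro ⟨⟨k, hk⟩, S, hS⟩ ⟨⟨l, hl⟩, T, hT⟩ h
      have hST : S = T := Finset.ext fun i => decide_eq_decide.1 (congrFun h i)
      subst hST
      -- The indices `k` and `l` are both the cardinality of the common subset.
      dsimp only at hS hT
      subst hS
      subst hT
      rfl
    · intro p
      refine ⟨⟨⟨(Finset.univ.filter fun i => p i = true).card, ?_⟩,
        Finset.univ.filter fun i => p i = true, rfl⟩, ?_⟩
      · exact Nat.lt_succ_of_le ((Finset.card_le_univ _).trans (Fintype.card_fin n).le)
      · funext i
        simp)

/-- The basis of `⨁ K₀` by the classes `[P(S)]`. -/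
noncomputable def basisDirectSum (F : Type u) [Field F] (n : ℕ) :
    Module.Basis (Σ k : Fin (n + 1), KSubset n k) ℤ[T;T⁻¹]
      (⨁ k : Fin (n + 1), KZero F (RNil F n k)) :=
  DFinsupp.basis fun k : Fin (n + 1) => basisKZero F n k

theorem basisDirectSum_apply (n : ℕ) (k : Fin (n + 1)) (S : KSubset n k) :
    basisDirectSum F n ⟨k, S⟩ = DirectSum.lof ℤ[T;T⁻¹] (Fin (n + 1))
      (fun k => KZero F (RNil F n k)) k (clsP F S) := by
  rw [← basisKZero_apply]
  exact DFinsupp.basis_apply (fun k : Fin (n + 1) => basisKZero F n k) ⟨k, S⟩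

end NilStrands

theorem theorem1p7 (F : Type u) [Field F] (n : ℕ) :
    Module.Free ℤ[T;T⁻¹] (⨁ k : Fin (n + 1), KZero F (NilStrands.RNil F n k)) ∧
    Module.Free ℤ[T;T⁻¹] (NilStrands.VTensor n) ∧
    ∃ Φ : (⨁ k : Fin (n + 1), KZero F (NilStrands.RNil F n k)) ≃ₗ[ℤ[T;T⁻¹]]
        NilStrands.VTensor n,
      ∀ (k : Fin (n + 1)) (S : NilStrands.KSubset n k),
        Φ (DirectSum.lof ℤ[T;T⁻¹] (Fin (n + 1)) (fun k => KZero F (NilStrands.RNil F n k)) k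
          (NilStrands.clsP F S)) = NilStrands.vecOf S := by
  refine ⟨.of_basis (NilStrands.basisDirectSum F n), .of_basis (NilStrands.basisVTensor n),
    (NilStrands.basisDirectSum F n).equiv (NilStrands.basisVTensor n)
      (NilStrands.indicatorEquiv n), fun k S => ?_⟩
  rw [← NilStrands.basisDirectSum_apply, Module.Basis.equiv_apply, NilStrands.basisVTensor_apply]
  -- By construction the indicator of `S` at `i` is `decide (i ∈ S.1)`, which is the label used in
  -- `vecOf`.
  rfl
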